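/- A polygon means a closed region of $\mathbb{R}^2$ bounded by a simple closed polygonal curve. Let $\mathcal{W}\subset\mathbb{R}^2$ be a polygon and let $O_1,\dots,O_n\subset\mathbb{R}^2$ be pairwise disjoint polygons (the obstacles) such that the free workspace $\mathcal{W}_{\mathrm{free}}=\mathrm{cl}\big(\mathcal{W}\setminus\bigcup_{i=1}^n O_i\big)$ is connected. Call $O_i$ homotopy-relevant if there are two paths in $\mathcal{W}_{\mathrm{free}}$ with common endpoints that are not homotopic (relative to their endpoints) in $\mathcal{W}_{\mathrm{free}}$ but are homotopic in $\mathrm{cl}\big(\mathcal{W}\setminus\bigcup_{j\ne i}O_j\big)$. Let $O_{i_1},\dots,O_{i_m}$ be the distinct homotopy-relevant obstacles, and let $\sigma_1,\dots,\sigma_m$ be pairwise disjoint infinite rays such that $\sigma_j$ starts at a point in the interior of $O_{i_j}$. Let $\mathbb{F}_m$ be the free group on $\sigma_1,\dots,\sigma_m$. The signature $h(\gamma)\in\mathbb{F}_m$ of a path $\gamma:[0,1]\to\mathcal{W}_{\mathrm{free}}$ is the reduced word obtained by recording, in order along $\gamma$, the letter $\sigma_j^{\pm1}$ each time $\gamma$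 crosses $\sigma_j$, with exponent $+1$ from right to left and $-1$ from left to right, points of $\sigma_j$ counting as lying to its left; for an arbitrary continuous $\gamma$ it is $F(1)$, where $F:[0,1]\to\mathbb{F}_m$ is determined by $F(0)=1$ and the condition that for each $t$ and all $s$ sufficiently close to $t$, $F(s)=F(t)\,c(\gamma(t),\gamma(s))$, with $c(x,y)$ the letter recorded along the straight segment from $x$ to $y$. Fix an anchor $x_{\mathrm a}\in\mathcal{W}_{\mathrm{free}}$, a covering map $f:\widetilde{\mathcal{W}}_{\mathrm{free}}\to\mathcal{W}_{\mathrm{free}}$ with $\widetilde{\mathcal{W}}_{\mathrm{free}}$ simply connected, and a point $\widetilde{x}_{\mathrm a}\in f^{-1}(x_{\mathrm a})$. A configuration is a continuous path $\gamma:[0,1]\to\mathcal{W}_{\mathrm{free}}$ with $\gamma(0)=x_{\mathrm a}$ (of unrestricted length: $l=\infty$), its reduced configuration is $r(\gamma)=(\gamma(1),h(\gamma))$, and $\widetilde\gamma$ denotes its unique lift with $\widetilde\gamma(0)=\widetilde{x}_{\mathrm a}$. Then: 1. every configuration has a well-defined signature $h(\gamma)$, and $r$ maps the set of configurations onto $\mathcal{W}_{\mathrm{free}}\times\mathbb{F}_m$;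 2. there is exactly one map $g:\mathcal{W}_{\mathrm{free}}\times\mathbb{F}_m\to\widetilde{\mathcal{W}}_{\mathrm{free}}$ with $g(\gamma(1),h(\gamma))=\widetilde\gamma(1)$ for every configuration $\gamma$, and $g$ is bijective; 3. two configurations $\gamma_1,\gamma_2$ with $\gamma_1(1)=\gamma_2(1)$ are homotopic relative to their endpoints if and only if $\widetilde\gamma_1(1)=\widetilde\gamma_2(1)$. -/

import Mathlib

open Set Topology
open scoped unitInterval

noncomputable section

namespace Tether

/-- The Euclidean plane. -/
abbrev Plane : Type := EuclideanSpace ℝ (Fin 2)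

/-- A (closed, simple) polygon: a finite union of nondegenerate triangles whose interior and whose
complement are both connected. These are exactly the closed regions bounded by a simple closed
polygonal curve; neither convexity nor any other restriction on the shape is imposed. -/
def IsPolygon (P : Set Plane) : Prop :=
  (∃ T : Set (Fin 3 → Plane), T.Finite ∧ (∀ t ∈ T, AffineIndependent ℝ t) ∧
    P = ⋃ t ∈ T, convexHull ℝ (range t)) ∧
  IsConnected (interior P) ∧ IsConnected Pᶜ

/-- The free workspace `cl (W \ ⋃ i, O i)`. -/
def freeSpace {n : ℕ} (W : Set Plane) (O : Fin n → Set Plane) : Set Plane :=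
  closure (W \ ⋃ i, O i)

/-- The free workspace that is left when the `i`-th obstacle is taken away. -/
def freeSpaceWithout {n : ℕ} (W : Set Plane) (O : Fin n → Set Plane) (i : Fin n) : Set Plane :=
  closure (W \ ⋃ j ∈ {j : Fin n | j ≠ i}, O j)

theorem freeSpace_subset_without {n : ℕ} (W : Set Plane) (O : Fin n → Set Plane) (i : Fin n) :
    freeSpace W O ⊆ freeSpaceWithout W O i :=
  closure_mono (sdiff_subset_sdiff_right (iUnion₂_subset fun j _ => subset_iUnion O j))

/-- The `i`-th obstacle gives rise to multiple homotopy classes: there are two paths in the free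
workspace, with the same endpoints, that are not homotopic there but become homotopic
when the `i`-th obstacle is taken away. -/
def IsRelevant {n : ℕ} (W : Set Plane) (O : Fin n → Set Plane) (i : Fin n) : Prop :=
  ∃ (a b : freeSpace W O) (γ₁ γ₂ : Path a b), ¬ γ₁.Homotopic γ₂ ∧
    (γ₁.map (continuous_inclusion (freeSpace_subset_without W O i))).Homotopic
      (γ₂.map (continuous_inclusion (freeSpace_subset_without W O i)))

/-- The infinite ray that starts at `z` and has direction `v`. -/
def ray (z v : Plane) : Set Plane := {x | ∃ t : ℝ, 0 ≤ t ∧ x = z + t • v}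

/-- `1` on the closed half-plane to the left of the oriented line through `z` with direction `v`,
and `0` on the open half-plane to its right. -/
def side (z v x : Plane) : ℤ :=
  open Classical in if 0 ≤ v 0 * (x - z) 1 - v 1 * (x - z) 0 then 1 else 0

/-- The signed crossing number of the straight segment from `x` to `y` with the ray: `1` if the
ray is crossed from right to left, `-1` if it is crossed from left to right, `0` otherwise.
Points on the ray count as lying to its left. -/
def crossing (z v x y : Plane) : ℤ :=
  open Classical in
  if (segment ℝ x y ∩ ray z v).Nonempty then side z v y - side z v x else 0

/-- The letters contributed by the straight segment from `x` to `y`. It is used only for segments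
so short that they meet at most one of the (pairwise disjoint) rays, so that at most one factor
differs from `1` and the order of the factors plays no role. -/
def crossingWord {m : ℕ} (z v : Fin m → Plane) (x y : Plane) : FreeGroup (Fin m) :=
  (List.ofFn fun j => FreeGroup.of j ^ crossing (z j) (v j) x y).prod

/-- `w` is the (reduced) word of signed crossings of the path `γ` with the rays.
Here `F t` is the word read up to time `t`: it starts as the empty word, and near every time `t`
it changes, by multiplication on the right, by the letters for the crossings between `γ t` and
`γ s`. -/
def IsSignature {m : ℕ} (z v : Fin m → Plane) {X : Set Plane} (γ : C(I, X))
    (w : FreeGroup (Fin m)) : Prop :=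
  ∃ F : I → FreeGroup (Fin m), F 0 = 1 ∧ F 1 = w ∧
    ∀ t, ∀ᶠ s in 𝓝 t, F s = F t * crossingWord z v (γ t) (γ s)

/-- The signature of the path `γ` with respect to the generating rays. -/
def signature {m : ℕ} (z v : Fin m → Plane) {X : Set Plane} (γ : C(I, X)) : FreeGroup (Fin m) :=
  Classical.epsilon (IsSignature z v γ)

/-- The configurations of a tethered robot with anchor `a` (and no bound on the tether length):
the continuous paths in `X` that start at `a`. -/
abbrev Config {X : Set Plane} (a : X) : Type := {γ : C(I, X) // γ 0 = a}

/-- The reduced configuration `(γ(1), h(γ))`. -/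
def reduced {m : ℕ} (z v : Fin m → Plane) {X : Set Plane} {a : X} (γ : Config a) :
    X × FreeGroup (Fin m) :=
  (γ.1 1, signature z v γ.1)

/-- The endpoint of the unique lift of `γ` that starts at the point `e` over the anchor. -/
def liftEnd {X : Set Plane} {E : Type*} [TopologicalSpace E] {p : E → X} (hp : IsCoveringMap p)
    {a : X} {e : E} (he : p e = a) (γ : Config a) : E :=
  hp.liftPath γ.1 e (γ.2.trans he.symm) 1

end Tether

end

/-!
The free workspace `K` is compared with the plane `Ω` punctured at the starting points of the rays.

*Signatures classify paths in `Ω`.* Away from the punctures the crossing words of short segments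
are differences of a local potential with values in the free group, so reading a word along a path
is lifting the path to a covering of `Ω` with discrete fiber the free group (`IsRaySystem.cover`).
Hence signatures exist, are unique, and depend on the homotopy class only. The plane cut along the
rays is contractible (`IsRaySystem.contractible_slit`), so for a covering `p : E → X` and a map
`f : Ω → X` the lifts of `f` over the cut plane are permuted by the free group, and the endpoint
of a lift of a path is determined by its starting point and the signature
(`IsRaySystem.lift_eq_of_isSignature`). Going around the starting points of rays shows that every
word is the signature of a path with given endpoints (`IsRaySystem.reaches`).

*`Ω` retracts onto `K`.* If each bounded component of the complement of the compact connected set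
`K` contains exactly one puncture, and `K` is a finite union of convex sets, then there is a
retraction of `Ω` onto `K` under which paths with endpoints in `K` are homotopic to their images
(`Holes.deforms`). The set `K` is a retract of a neighborhood, and a fine square grid reduces the
plane to that neighborhood: squares that contain a puncture are projected to their boundary, and
squares away from `K` with a free side are collapsed as long as possible. Every square that is left
can be reached from `K`, and lies close to `K` because points away from `K` are joined to a
puncture or to infinity. The edges that are left outside these squares are collapsed too: there is
no loop among them, because a circle-valued map on `Ω` that vanishes on `K` lifts to the reals
(`Holes.exists_real_lift`), being a sum of maps that are supported in single components.

*The holes of `K` are the relevant obstacles.* A component of the complement of `K` that does not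
leave the workspace is the interior of one obstacle (`exists_isOuter`). If the interior of an
obstacle meets the unbounded component, the free workspace without this obstacle still lies in `Ω`,
so the retraction turns homotopies there into homotopies in `K` (`disjoint_of_isRelevant`). If it
does not, two paths that pass the obstacle on different sides have different signatures for an
auxiliary family of parallel rays, but become homotopic when the hole is filled
(`isRelevant_of_disjoint`).

Thus signatures of paths in `K` determine and are determined by homotopy classes relative to the
endpoints, every word occurs, and the universal covering turns homotopy classes into endpoints of
lifts.
-/

noncomputable section

namespace Tether

/-! ### Rays, strips and crossing numbers -/

/-- The plane without the points `z j`. -/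
def punctured {ι : Type*} (z : ι → Plane) : Set Plane := (range z)ᶜ

/-- A linear coordinate transverse to the line through `z` with direction `v`, positive on its
left. -/
def height (z v x : Plane) : ℝ := v 0 * (x - z) 1 - v 1 * (x - z) 0

/-- A linear coordinate along the line through `z` with direction `v`, increasing in the direction
`v` and zero at `z`. -/
def along (z v x : Plane) : ℝ := v 0 * (x - z) 0 + v 1 * (x - z) 1

/-- Finitely many pairwise disjoint rays with nonzero directions. -/
structure IsRaySystem {m : ℕ} (z v : Fin m → Plane) : Prop where
  ne_zero : ∀ j, v j ≠ 0
  disjoint : ∀ j k, j ≠ k → Disjoint (ray (z j) (v j)) (ray (z k) (v k))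

theorem continuous_height (z v : Plane) : Continuous (height z v) := by
  unfold height; fun_prop

theorem continuous_along (z v : Plane) : Continuous (along z v) := by
  unfold along; fun_prop

theorem normSq_pos {v : Plane} (hv : v ≠ 0) : 0 < v 0 ^ 2 + v 1 ^ 2 := by
  by_contra! h
  apply hv
  ext i
  fin_cases i
  · simpa using (by nlinarith [sq_nonneg (v 0), sq_nonneg (v 1)] : v 0 = 0)
  · simpa using (by nlinarith [sq_nonneg (v 0), sq_nonneg (v 1)] : v 1 = 0)

theorem mem_ray_iff {z v : Plane} (hv : v ≠ 0) (x : Plane) :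
    x ∈ ray z v ↔ height z v x = 0 ∧ 0 ≤ along z v x := by
  have hpos := normSq_pos hv
  constructor
  · rintro ⟨t, ht, rfl⟩
    simp only [height, along, PiLp.sub_apply, PiLp.add_apply, PiLp.smul_apply, smul_eq_mul]
    refine ⟨by ring, ?_⟩
    have : v 0 * (z 0 + t * v 0 - z 0) + v 1 * (z 1 + t * v 1 - z 1)
        = t * (v 0 ^ 2 + v 1 ^ 2) := by ring
    rw [this]; positivity
  · rintro ⟨h0, h1⟩
    refine ⟨along z v x / (v 0 ^ 2 + v 1 ^ 2), by positivity, ?_⟩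
    simp only [height, along, PiLp.sub_apply] at h0 h1 ⊢
    ext i
    fin_cases i
    · simp only [Fin.zero_eta, PiLp.add_apply, PiLp.smul_apply, smul_eq_mul]
      field_simp
      linear_combination (-v 1) * h0
    · simp only [Fin.mk_one, PiLp.add_apply, PiLp.smul_apply, smul_eq_mul]
      field_simp
      linear_combination (v 0) * h0

theorem isClosed_ray {z v : Plane} (hv : v ≠ 0) : IsClosed (ray z v) := by
  have : ray z v = {x | height z v x = 0} ∩ {x | 0 ≤ along z v x} := by
    ext x; exact mem_ray_iff hv x
  rw [this]
  exact (isClosed_eq (continuous_height z v) continuous_const).inter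
    (isClosed_le continuous_const (continuous_along z v))

theorem start_mem_ray (z v : Plane) : z ∈ ray z v := ⟨0, le_rfl, by simp⟩

theorem height_combo (z v x y : Plane) {a b : ℝ} (hab : a + b = 1) :
    height z v (a • x + b • y) = a * height z v x + b * height z v y := by
  simp only [height, PiLp.sub_apply, PiLp.add_apply, PiLp.smul_apply, smul_eq_mul]
  linear_combination (z 1 * v 0 - z 0 * v 1) * hab

theorem along_combo (z v x y : Plane) {a b : ℝ} (hab : a + b = 1) :
    along z v (a • x + b • y) = a * along z v x + b * along z v y := by
  simp only [along, PiLp.sub_apply, PiLp.add_apply, PiLp.smul_apply, smul_eq_mul]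
  linear_combination (z 1 * v 1 + z 0 * v 0) * hab

theorem side_of_nonneg {z v x : Plane} (h : 0 ≤ height z v x) : side z v x = 1 := by
  simp only [side]; exact if_pos h

theorem side_of_neg {z v x : Plane} (h : height z v x < 0) : side z v x = 0 := by
  simp only [side]; exact if_neg (not_le.2 h)

theorem crossing_of_disjoint {z v : Plane} {D : Set Plane} (hD : Convex ℝ D)
    (h : Disjoint D (ray z v)) {x y : Plane} (hx : x ∈ D) (hy : y ∈ D) : crossing z v x y = 0 := by
  simp only [crossing]
  refine if_neg ?_
  rintro ⟨w, hw, hw'⟩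
  exact h.le_bot ⟨hD.segment_subset hx hy hw, hw'⟩

/-- Inside a convex set that meets the ray but does not contain its starting point, the ray is as
good as the whole line: crossing numbers are differences of sides. -/
theorem crossing_of_convex {z v : Plane} (hv : v ≠ 0) {D : Set Plane} (hD : Convex ℝ D)
    (hz : z ∉ D) {p : Plane} (hp : p ∈ D) (hpr : p ∈ ray z v) {x y : Plane} (hx : x ∈ D)
    (hy : y ∈ D) : crossing z v x y = side z v y - side z v x := by
  have key : ∀ w ∈ D, height z v w = 0 → w ∈ ray z v := by
    intro w hw h0
    by_contra hwr
    rw [mem_ray_iff hv] at hwr hpr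
    have hneg : along z v w < 0 := by
      by_contra! h; exact hwr ⟨h0, h⟩
    obtain ⟨hp0, hp1⟩ := hpr
    apply hz
    have hd : 0 < along z v p - along z v w := by linarith
    set a := along z v p / (along z v p - along z v w) with ha
    set b := -along z v w / (along z v p - along z v w) with hb
    have hab : a + b = 1 := by rw [ha, hb]; field_simp; ring
    have hmem : a • w + b • p ∈ D :=
      hD hw hp (by positivity) (div_nonneg (by linarith) hd.le) hab
    have hz' : a • w + b • p ∈ ray z v := by
      rw [mem_ray_iff hv, height_combo _ _ _ _ hab, along_combo _ _ _ _ hab, h0, hp0]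
      refine ⟨by ring, ?_⟩
      have : a * along z v w + b * along z v p = 0 := by rw [ha, hb]; field_simp; ring
      rw [this]
    obtain ⟨t, ht, hw'⟩ := hz'
    have h3 : along z v (z + t • v) = 0 := by
      rw [← hw', along_combo _ _ _ _ hab, ha, hb]; field_simp; ring
    have h4 : along z v (z + t • v) = t * (v 0 ^ 2 + v 1 ^ 2) := by
      simp only [along, PiLp.sub_apply, PiLp.add_apply, PiLp.smul_apply, smul_eq_mul]; ring
    have h5 : t = 0 := by
      have := normSq_pos hv
      rw [h4] at h3
      rcases mul_eq_zero.1 h3 with h | h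
      · exact h
      · linarith
    rw [hw', h5] at hmem
    simpa using hmem
  simp only [crossing]
  split_ifs with h
  · rfl
  · by_contra hne
    apply h
    have main : ∀ x y : Plane, x ∈ D → y ∈ D → height z v x < 0 → 0 ≤ height z v y →
        ∃ w ∈ segment ℝ x y, height z v w = 0 := by
      intro x y _ _ h1 h2
      have hd : 0 < height z v y - height z v x := by linarith
      have hab : height z v y / (height z v y - height z v x) +
          -height z v x / (height z v y - height z v x) = 1 := by field_simp; ring
      refine ⟨_, ⟨_, _, div_nonneg h2 hd.le, div_nonneg (by linarith) hd.le, hab, rfl⟩, ?_⟩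
      rw [height_combo _ _ _ _ hab]; field_simp; ring
    rcases le_or_gt 0 (height z v x) with h1 | h1 <;> rcases le_or_gt 0 (height z v y) with h2 | h2
    · exact absurd (by rw [side_of_nonneg h1, side_of_nonneg h2]; simp) hne
    · obtain ⟨w, hw, hw0⟩ := main y x hy hx h2 h1
      exact ⟨w, segment_symm ℝ y x ▸ hw, key w (hD.segment_subset hy hx hw) hw0⟩
    · obtain ⟨w, hw, hw0⟩ := main x y hx hy h1 h2
      exact ⟨w, hw, key w (hD.segment_subset hx hy hw) hw0⟩
    · exact absurd (by rw [side_of_neg h1, side_of_neg h2]; simp) hne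

/-! ### Crossing words near a point -/

section Signature

variable {m : ℕ} {z v : Fin m → Plane}

theorem crossingWord_eq_one {x y : Plane} (h : ∀ j, crossing (z j) (v j) x y = 0) :
    crossingWord z v x y = 1 := by
  simp only [crossingWord, h, zpow_zero]
  apply List.prod_eq_one
  intro g hg
  obtain ⟨i, rfl⟩ := (List.mem_ofFn' _ _).1 hg
  rfl

theorem prod_ofFn_ite {G : Type*} [Monoid G] (g : G) :
    ∀ {m : ℕ} (j : Fin m), (List.ofFn fun i => if i = j then g else 1).prod = g
  | 0, j => j.elim0
  | m + 1, j => by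
    rw [List.ofFn_succ, List.prod_cons]
    induction j using Fin.cases with
    | zero =>
      rw [if_pos rfl, List.prod_eq_one, mul_one]
      intro h hh
      obtain ⟨i, rfl⟩ := (List.mem_ofFn' _ _).1 hh
      exact if_neg (Fin.succ_ne_zero i)
    | succ j =>
      rw [if_neg (Fin.succ_ne_zero j).symm, one_mul]
      simpa only [Fin.succ_inj] using prod_ofFn_ite g j

theorem crossingWord_eq_of {x y : Plane} (j : Fin m)
    (h : ∀ k, k ≠ j → crossing (z k) (v k) x y = 0) :
    crossingWord z v x y = FreeGroup.of j ^ crossing (z j) (v j) x y := by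
  rw [crossingWord, ← prod_ofFn_ite (FreeGroup.of j ^ crossing (z j) (v j) x y) j]
  congr 2
  funext k
  by_cases hk : k = j
  · subst hk; simp
  · simp [hk, h k hk]

theorem IsRaySystem.isClosed_rays (hs : IsRaySystem z v) (s : Set (Fin m)) :
    IsClosed (⋃ j ∈ s, ray (z j) (v j)) :=
  s.toFinite.isClosed_biUnion fun j _ => isClosed_ray (hs.ne_zero j)

/-- The plane cut along all rays. -/
def slit (z v : Fin m → Plane) : Set Plane := (⋃ j, ray (z j) (v j))ᶜ

theorem mem_slit {x : Plane} : x ∈ slit z v ↔ ∀ j, x ∉ ray (z j) (v j) := by simp [slit]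

theorem IsRaySystem.isOpen_slit (hs : IsRaySystem z v) : IsOpen (slit z v) :=
  (isClosed_iUnion_of_finite fun j => isClosed_ray (hs.ne_zero j)).isOpen_compl

theorem isOpen_punctured {ι : Type*} [Finite ι] (z : ι → Plane) : IsOpen (punctured z) :=
  (finite_range z).isClosed.isOpen_compl

theorem slit_subset_punctured : slit z v ⊆ punctured z := by
  rintro x hx ⟨j, rfl⟩
  exact mem_slit.1 hx j (start_mem_ray _ _)

theorem IsRaySystem.exists_ball_slit (hs : IsRaySystem z v) {x : Plane} (hx : x ∈ slit z v) :
    ∃ ε > 0, Metric.ball x ε ⊆ slit z v ∧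
      ∀ y ∈ Metric.ball x ε, ∀ y' ∈ Metric.ball x ε, crossingWord z v y y' = 1 := by
  obtain ⟨ε, hε, h⟩ := Metric.isOpen_iff.1 hs.isOpen_slit x hx
  refine ⟨ε, hε, h, fun y hy y' hy' => crossingWord_eq_one fun j =>
    crossing_of_disjoint (convex_ball x ε) ?_ hy hy'⟩
  exact disjoint_left.2 fun w hw => mem_slit.1 (h hw) j

theorem IsRaySystem.exists_ball_ray (hs : IsRaySystem z v) {j : Fin m} {x : Plane}
    (hx : x ∈ ray (z j) (v j)) (hxz : x ≠ z j) :
    ∃ ε > 0, (∀ k ≠ j, Disjoint (Metric.ball x ε) (ray (z k) (v k))) ∧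
      z j ∉ Metric.ball x ε ∧
      ∀ y ∈ Metric.ball x ε, ∀ y' ∈ Metric.ball x ε,
        crossingWord z v y y' =
          FreeGroup.of j ^ (side (z j) (v j) y' - side (z j) (v j) y) := by
  have hcl : IsClosed ((⋃ k ∈ {k | k ≠ j}, ray (z k) (v k)) ∪ {z j}) :=
    (hs.isClosed_rays _).union isClosed_singleton
  have hmem : x ∈ ((⋃ k ∈ {k | k ≠ j}, ray (z k) (v k)) ∪ {z j})ᶜ := by
    simp only [mem_ofPred_eq, compl_union, mem_inter_iff, mem_compl_iff, mem_iUnion, not_exists,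
      mem_singleton_iff]
    exact ⟨fun k hk hxk => (hs.disjoint k j hk).le_bot ⟨hxk, hx⟩, hxz⟩
  obtain ⟨ε, hε, h⟩ := Metric.isOpen_iff.1 hcl.isOpen_compl x hmem
  have hd : ∀ k ≠ j, Disjoint (Metric.ball x ε) (ray (z k) (v k)) := fun k hk =>
    disjoint_left.2 fun w hw hwk => h hw (Or.inl (mem_biUnion (show k ∈ {k | k ≠ j} from hk) hwk))
  have hzj : z j ∉ Metric.ball x ε := fun hw => h hw (Or.inr rfl)
  refine ⟨ε, hε, hd, hzj, fun y hy y' hy' => ?_⟩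
  rw [crossingWord_eq_of j fun k hk => crossing_of_disjoint (convex_ball x ε) (hd k hk) hy hy',
    crossing_of_convex (hs.ne_zero j) (convex_ball x ε) hzj (Metric.mem_ball_self hε) hx hy hy']

/-- Near every point of the punctured plane the crossing words are differences of a potential. -/
theorem IsRaySystem.exists_potential (hs : IsRaySystem z v) (x : punctured z) :
    ∃ ε > 0, ∃ k : Plane → FreeGroup (Fin m), ∀ y ∈ Metric.ball (x : Plane) ε,
      ∀ y' ∈ Metric.ball (x : Plane) ε, crossingWord z v y y' = (k y)⁻¹ * k y' := by
  by_cases hx : (x : Plane) ∈ slit z v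
  · obtain ⟨ε, hε, -, h⟩ := hs.exists_ball_slit hx
    exact ⟨ε, hε, fun _ => 1, fun y hy y' hy' => by simp [h y hy y' hy']⟩
  · obtain ⟨j, hj⟩ : ∃ j, (x : Plane) ∈ ray (z j) (v j) := by
      by_contra! h; exact hx (mem_slit.2 h)
    obtain ⟨ε, hε, -, -, h⟩ := hs.exists_ball_ray hj fun h => x.2 ⟨j, h.symm⟩
    refine ⟨ε, hε, fun y => FreeGroup.of j ^ side (z j) (v j) y, fun y hy y' hy' => ?_⟩
    rw [h y hy y' hy', ← zpow_neg, ← zpow_add]; congr 1; ring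

/-! ### The signature covering -/

/-- Radii of the balls on which the crossing words have a potential. -/
def IsRaySystem.radius (hs : IsRaySystem z v) (x : punctured z) : ℝ :=
  (hs.exists_potential x).choose

theorem IsRaySystem.radius_pos (hs : IsRaySystem z v) (x : punctured z) : 0 < hs.radius x :=
  (hs.exists_potential x).choose_spec.1

/-- A potential for the crossing words on the ball around `x`. -/
def IsRaySystem.potential (hs : IsRaySystem z v) (x : punctured z) :
    Plane → FreeGroup (Fin m) :=
  (hs.exists_potential x).choose_spec.2.choose

/-- The ball around `x` on which `hs.potential x` is a potential for the crossing words. -/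
def IsRaySystem.chart (hs : IsRaySystem z v) (x : punctured z) : Set (punctured z) :=
  Subtype.val ⁻¹' Metric.ball (x : Plane) (hs.radius x)

theorem IsRaySystem.isOpen_chart (hs : IsRaySystem z v) (x : punctured z) :
    IsOpen (hs.chart x) := Metric.isOpen_ball.preimage continuous_subtype_val

theorem IsRaySystem.mem_chart (hs : IsRaySystem z v) (x : punctured z) : x ∈ hs.chart x :=
  Metric.mem_ball_self (hs.radius_pos x)

theorem IsRaySystem.crossingWord_eq (hs : IsRaySystem z v) {x y y' : punctured z}
    (hy : y ∈ hs.chart x) (hy' : y' ∈ hs.chart x) :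
    crossingWord z v y y' = (hs.potential x y)⁻¹ * hs.potential x y' :=
  (hs.exists_potential x).choose_spec.2.choose_spec y hy y' hy'

/-- The fibers of the signature covering are discrete. -/
instance : TopologicalSpace (FreeGroup (Fin m)) := ⊥

instance : DiscreteTopology (FreeGroup (Fin m)) := ⟨rfl⟩

/-- The covering of the punctured plane whose sheets are indexed by the free group and whose
monodromy along a path is multiplication by its signature. The coordinate `h` in the chart around
`i` of a point over `y` stands for the word `h * hs.potential i y`. -/
def IsRaySystem.cover (hs : IsRaySystem z v) :
    FiberBundleCore (punctured z) (punctured z) (FreeGroup (Fin m)) where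
  baseSet := hs.chart
  isOpen_baseSet := hs.isOpen_chart
  indexAt := id
  mem_baseSet_at := hs.mem_chart
  coordChange i j y h := h * hs.potential i y * (hs.potential j y)⁻¹
  coordChange_self i x _ h := by group
  continuousOn_coordChange i j := by
    rintro ⟨x, h⟩ ⟨⟨hxi, hxj⟩, -⟩
    have hcont : Continuous fun p : punctured z × FreeGroup (Fin m) =>
        p.2 * (hs.potential i x * (hs.potential j x)⁻¹) :=
      (continuous_of_discreteTopology (f := fun h : FreeGroup (Fin m) =>
        h * (hs.potential i x * (hs.potential j x)⁻¹))).comp continuous_snd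
    refine hcont.continuousWithinAt.congr (fun p hp => ?_) (by group)
    have h1 := hs.crossingWord_eq hxi hp.1.1
    rw [hs.crossingWord_eq hxj hp.1.2] at h1
    have h2 : hs.potential i p.1 * (hs.potential j p.1)⁻¹ =
        hs.potential i x * (hs.potential j x)⁻¹ := by
      rw [eq_mul_inv_iff_mul_eq, mul_assoc, ← mul_right_inj (hs.potential i x)⁻¹, ← mul_assoc,
        ← h1]
      group
    rw [mul_assoc, h2]
  coordChange_comp i j k x _ h := by group

/-- `γ` is lifted to the signature covering by the function `F` that reads the word of `γ`. -/
def Reads (z v : Fin m → Plane) {X : Set Plane} (γ : C(I, X)) (F : I → FreeGroup (Fin m)) : Prop :=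
  ∀ t, ∀ᶠ s in 𝓝 t, F s = F t * crossingWord z v (γ t) (γ s)

/-- The point with word `g` over `x` in the signature covering. -/
def IsRaySystem.lift (hs : IsRaySystem z v) (x : punctured z) (g : FreeGroup (Fin m)) :
    hs.cover.TotalSpace :=
  ⟨x, g * (hs.potential x x)⁻¹⟩

theorem IsRaySystem.exists_lift (hs : IsRaySystem z v) (y : hs.cover.TotalSpace) :
    ∃ g, y = hs.lift y.1 g := by
  obtain ⟨x, h⟩ := y
  refine ⟨(show FreeGroup (Fin m) from h) * hs.potential x x, ?_⟩
  exact congrArg (Bundle.TotalSpace.mk x)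
    (mul_inv_cancel_right (show FreeGroup (Fin m) from h) (hs.potential x x)).symm

theorem IsRaySystem.lift_injective (hs : IsRaySystem z v) {x : punctured z}
    {g g' : FreeGroup (Fin m)} (h : hs.lift x g = hs.lift x g') : g = g' := by
  simp only [IsRaySystem.lift] at h
  injection h with _ h
  exact mul_right_cancel (show g * (hs.potential x x)⁻¹ = g' * (hs.potential x x)⁻¹ from h)

theorem IsRaySystem.reads_iff (hs : IsRaySystem z v) (γ : C(I, punctured z))
    (F : I → FreeGroup (Fin m)) :
    Reads z v γ F ↔ Continuous fun t => hs.lift (γ t) (F t) := by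
  rw [continuous_iff_continuousAt]
  refine forall_congr' fun t => ?_
  have h1 : ContinuousAt (fun s => (hs.lift (γ s) (F s)).proj) t := γ.continuous.continuousAt
  rw [FiberBundle.continuousAt_totalSpace, and_iff_right h1, ContinuousAt,
    nhds_discrete (FreeGroup (Fin m)), Filter.tendsto_pure]
  have h2 : ∀ s, (trivializationAt (FreeGroup (Fin m)) hs.cover.Fiber (γ t)
      (hs.lift (γ s) (F s))).2 = F s * (hs.potential (γ t) (γ s))⁻¹ := fun s => by
    change F s * (hs.potential (γ s) (γ s))⁻¹ * hs.potential (γ s) (γ s) *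
      (hs.potential (γ t) (γ s))⁻¹ = _
    group
  have h3 : ∀ᶠ s in 𝓝 t, γ s ∈ hs.chart (γ t) :=
    γ.continuous.continuousAt.eventually ((hs.isOpen_chart _).mem_nhds (hs.mem_chart _))
  refine ⟨fun h => ?_, fun h => ?_⟩
  · filter_upwards [h, h3] with s h hs'
    refine (h2 s).trans (Eq.trans ?_ (h2 t).symm)
    rw [h, hs.crossingWord_eq (hs.mem_chart _) hs']; group
  · filter_upwards [h, h3] with s h hs'
    have h := (h2 s).symm.trans (h.trans (h2 t))
    rw [hs.crossingWord_eq (hs.mem_chart _) hs', ← mul_assoc, ← h]; group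

theorem IsRaySystem.isCoveringMap_proj (hs : IsRaySystem z v) :
    IsCoveringMap (Bundle.TotalSpace.proj : hs.cover.TotalSpace → punctured z) :=
  FiberBundle.isCoveringMap

theorem IsRaySystem.exists_reads (hs : IsRaySystem z v) (γ : C(I, punctured z))
    (g : FreeGroup (Fin m)) : ∃ F, F 0 = g ∧ Reads z v γ F := by
  obtain ⟨Γ, hΓ, h0⟩ := hs.isCoveringMap_proj.exists_path_lifts γ (hs.lift (γ 0) g) rfl
  choose F hF using fun t => hs.exists_lift (Γ t)
  have h1 : ∀ t, Γ t = hs.lift (γ t) (F t) := fun t => by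
    rw [← congrFun hΓ t]; exact hF t
  refine ⟨F, hs.lift_injective ((h1 0).symm.trans h0), (hs.reads_iff γ F).2 ?_⟩
  simpa only [← h1] using Γ.continuous

/-- Words read along paths that are homotopic in the punctured plane agree. -/
theorem IsRaySystem.reads_homotopic (hs : IsRaySystem z v) {γ γ' : C(I, punctured z)}
    {F F' : I → FreeGroup (Fin m)} (hF : Reads z v γ F) (hF' : Reads z v γ' F')
    (h0 : F 0 = F' 0) (h : γ.HomotopicRel γ' {0, 1}) : F 1 = F' 1 := by
  have e0 : γ 0 = γ' 0 := h.some.fst_eq_snd (by simp)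
  have e1 : γ 1 = γ' 1 := h.some.fst_eq_snd (by simp)
  have l : (fun t => hs.lift (γ t) (F t)) =
      hs.isCoveringMap_proj.liftPath γ (hs.lift (γ 0) (F 0)) rfl :=
    (hs.isCoveringMap_proj.eq_liftPath_iff rfl).2 ⟨(hs.reads_iff _ _).1 hF, rfl, rfl⟩
  have l' : (fun t => hs.lift (γ' t) (F' t)) =
      hs.isCoveringMap_proj.liftPath γ' (hs.lift (γ 0) (F 0)) e0.symm :=
    (hs.isCoveringMap_proj.eq_liftPath_iff _).2 ⟨(hs.reads_iff _ _).1 hF', rfl, by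
      simp only [e0, h0]⟩
  have := hs.isCoveringMap_proj.liftPath_apply_one_eq_of_homotopicRel h
    (hs.lift (γ 0) (F 0)) rfl e0.symm
  rw [← congrFun l 1, ← congrFun l' 1] at this
  simp only [e1] at this
  exact hs.lift_injective this

theorem IsRaySystem.exists_isSignature (hs : IsRaySystem z v) (γ : C(I, punctured z)) :
    ∃ w, IsSignature z v γ w := by
  obtain ⟨F, h0, hF⟩ := hs.exists_reads γ 1
  exact ⟨F 1, F, h0, rfl, hF⟩

theorem IsRaySystem.isSignature_homotopic (hs : IsRaySystem z v) {γ γ' : C(I, punctured z)}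
    {w w' : FreeGroup (Fin m)} (hw : IsSignature z v γ w) (hw' : IsSignature z v γ' w')
    (h : γ.HomotopicRel γ' {0, 1}) : w = w' := by
  obtain ⟨F, h0, rfl, hF⟩ := hw
  obtain ⟨F', h0', rfl, hF'⟩ := hw'
  exact hs.reads_homotopic hF hF' (h0.trans h0'.symm) h

theorem IsRaySystem.isSignature_trans (hs : IsRaySystem z v) {a b c : punctured z}
    {γ : Path a b} {γ' : Path b c} {w w' : FreeGroup (Fin m)}
    (hw : IsSignature z v γ.toContinuousMap w) (hw' : IsSignature z v γ'.toContinuousMap w') :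
    IsSignature z v (γ.trans γ').toContinuousMap (w * w') := by
  obtain ⟨F, h0, rfl, hF⟩ := hw
  obtain ⟨F', h0', rfl, hF'⟩ := hw'
  have c1 := (hs.reads_iff _ _).1 hF
  have c2 : Continuous fun t => hs.lift (γ' t) (F 1 * F' t) := by
    refine (hs.reads_iff γ'.toContinuousMap _).1 fun t => ?_
    filter_upwards [hF' t] with s h
    rw [h, mul_assoc]
  let Γ : Path (hs.lift a 1) (hs.lift b (F 1)) := ⟨⟨_, c1⟩, by simp [h0], by simp⟩
  let Γ' : Path (hs.lift b (F 1)) (hs.lift c (F 1 * F' 1)) := ⟨⟨_, c2⟩, by simp [h0'], by simp⟩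
  choose G hG using fun t => hs.exists_lift ((Γ.trans Γ') t)
  have hproj : ∀ t, ((Γ.trans Γ') t).1 = (γ.trans γ') t := fun t => by
    simp only [Path.trans_apply]; split_ifs <;> rfl
  simp only [hproj] at hG
  refine ⟨G, ?_, ?_, (hs.reads_iff _ _).2 ?_⟩
  · have := hG 0
    rw [Path.source, Path.source] at this
    exact (hs.lift_injective this).symm
  · have := hG 1
    rw [Path.target, Path.target] at this
    exact (hs.lift_injective this).symm
  · refine (Γ.trans Γ').continuous.congr fun t => hG t

/-- The signature of a path along which the crossing words have a potential. -/
theorem isSignature_of_potential {X : Set Plane} {γ : C(I, X)} (k : I → FreeGroup (Fin m))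
    (h : ∀ t, ∀ᶠ s in 𝓝 t, crossingWord z v (γ t) (γ s) = (k t)⁻¹ * k s) :
    IsSignature z v γ ((k 0)⁻¹ * k 1) := by
  refine ⟨fun t => (k 0)⁻¹ * k t, by simp, rfl, fun t => ?_⟩
  filter_upwards [h t] with s hs
  rw [hs]; group

theorem IsRaySystem.isSignature_of_slit (hs : IsRaySystem z v) {X : Set Plane} {γ : C(I, X)}
    (h : ∀ t, (γ t : Plane) ∈ slit z v) : IsSignature z v γ 1 := by
  have := isSignature_of_potential (z := z) (v := v) (γ := γ) (fun _ => 1) fun t => by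
    obtain ⟨ε, hε, -, h1⟩ := hs.exists_ball_slit (h t)
    have h2 : ∀ᶠ s in 𝓝 t, (γ s : Plane) ∈ Metric.ball (γ t : Plane) ε :=
      (continuous_subtype_val.comp γ.continuous).continuousAt.eventually
        (Metric.ball_mem_nhds _ hε)
    filter_upwards [h2] with s hs'
    simp [h1 _ (Metric.mem_ball_self hε) _ hs']
  simpa using this

theorem IsSignature.inv (hs : IsRaySystem z v) {a b : punctured z} {γ : Path a b}
    {w : FreeGroup (Fin m)} (hw : IsSignature z v γ.toContinuousMap w) :
    IsSignature z v γ.symm.toContinuousMap w⁻¹ := by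
  obtain ⟨w', hw'⟩ := hs.exists_isSignature γ.symm.toContinuousMap
  have h := hs.isSignature_trans hw hw'
  have h1 : IsSignature z v (Path.refl a).toContinuousMap 1 :=
    ⟨fun _ => 1, rfl, rfl, fun t => .of_forall fun s => by
      change 1 = 1 * crossingWord z v a a
      rw [crossingWord_eq_one]; simp
      intro j; simp [crossing]⟩
  have := hs.isSignature_homotopic h h1 (Path.Homotopic.symm ⟨Path.Homotopy.reflTransSymm γ⟩)
  rwa [← eq_inv_of_mul_eq_one_right this]

end Signature

/-! ### The plane cut along disjoint rays is contractible -/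

section Slit

variable {m : ℕ} {z v : Fin m → Plane}

/-- Disjoint rays are a positive distance apart: a half-strip around one of them avoids the
other. -/
theorem exists_strip_pair {z v z' v' : Plane} (hv : v ≠ 0)
    (h : Disjoint (ray z v) (ray z' v')) :
    ∃ ε > 0, ∀ x ∈ ray z' v', |height z v x| < ε → along z v x ≤ -ε := by
  have hform : ∀ t : ℝ, height z v (z' + t • v') =
      height z v z' + t * (v 0 * v' 1 - v 1 * v' 0) ∧
      along z v (z' + t • v') = along z v z' + t * (v 0 * v' 0 + v 1 * v' 1) := fun t => by
    simp only [height, along, PiLp.sub_apply, PiLp.add_apply, PiLp.smul_apply, smul_eq_mul]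
    constructor <;> ring
  have hdis : ∀ t : ℝ, 0 ≤ t → height z v z' + t * (v 0 * v' 1 - v 1 * v' 0) = 0 →
      along z v z' + t * (v 0 * v' 0 + v 1 * v' 1) < 0 := by
    intro t ht h0
    by_contra! h1
    refine h.le_bot ⟨?_, t, ht, rfl⟩
    rw [mem_ray_iff hv, (hform t).1, (hform t).2]
    exact ⟨h0, h1⟩
  generalize height z v z' = a at hform hdis
  generalize along z v z' = c at hform hdis
  generalize v 0 * v' 1 - v 1 * v' 0 = b at hform hdis
  generalize v 0 * v' 0 + v 1 * v' 1 = d at hform hdis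
  suffices H : ∃ ε > 0, ∀ t : ℝ, 0 ≤ t → |a + t * b| < ε → c + t * d ≤ -ε by
    obtain ⟨ε, hε, H⟩ := H
    refine ⟨ε, hε, ?_⟩
    rintro x ⟨t, ht, rfl⟩
    rw [(hform t).1, (hform t).2]
    exact H t ht
  by_cases hb : b = 0
  · subst hb
    by_cases ha : a = 0
    · subst ha
      have hd : d ≤ 0 := by
        by_contra! hd
        have h1 := hdis (|c| / d) (by positivity) (by simp)
        have : |c| / d * d = |c| := by field_simp
        rw [this] at h1
        linarith [neg_abs_le c]
      have hc := hdis 0 le_rfl (by simp)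
      exact ⟨-c, by linarith, fun t ht _ => by nlinarith⟩
    · exact ⟨|a|, abs_pos.2 ha, fun t _ h => absurd h (by simp)⟩
  · by_cases ht0 : 0 ≤ -a / b
    · have h1 := hdis (-a / b) ht0 (by field_simp; ring)
      set η := -(c + -a / b * d) with hη
      have hη0 : 0 < η := by linarith
      have hb' : 0 < |b| := abs_pos.2 hb
      refine ⟨η / (1 + |d| / |b|), by positivity, fun t ht h => ?_⟩
      set ε := η / (1 + |d| / |b|) with hε
      have hεη : ε + ε * (|d| / |b|) = η := by rw [hε]; field_simp
      have h2 : a + t * b = (t - -a / b) * b := by field_simp; ring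
      rw [h2, abs_mul] at h
      have h3 : |t - -a / b| ≤ ε / |b| := by rw [le_div_iff₀ hb']; exact h.le
      have h4 : (t - -a / b) * d ≤ ε / |b| * |d| :=
        (le_abs_self _).trans (by rw [abs_mul]; gcongr)
      have h5 : ε / |b| * |d| = ε * (|d| / |b|) := by ring
      have h6 : c + t * d = -η + (t - -a / b) * d := by rw [hη]; ring
      rw [h6]; linarith
    · push Not at ht0
      have ha : a ≠ 0 := by rintro rfl; simp at ht0
      refine ⟨|a|, abs_pos.2 ha, fun t ht h => absurd h (not_lt.2 ?_)⟩
      have hab : 0 ≤ a * b := by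
        have : -a / b * b ^ 2 ≤ 0 := mul_nonpos_of_nonpos_of_nonneg ht0.le (sq_nonneg b)
        have h2 : -a / b * b ^ 2 = -(a * b) := by field_simp
        linarith
      refine sq_le_sq.1 ?_
      nlinarith [mul_nonneg ht hab, sq_nonneg (t * b)]

theorem IsRaySystem.exists_strip (hs : IsRaySystem z v) (j : Fin m) :
    ∃ ε > 0, ∀ k ≠ j, ∀ x ∈ ray (z k) (v k), |height (z j) (v j) x| < ε →
      along (z j) (v j) x ≤ -ε := by
  have : ∀ k, ∃ ε > 0, k ≠ j → ∀ x ∈ ray (z k) (v k), |height (z j) (v j) x| < ε →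
      along (z j) (v j) x ≤ -ε := fun k => by
    by_cases hk : k = j
    · exact ⟨1, one_pos, fun h => absurd hk h⟩
    · obtain ⟨ε, hε, h⟩ := exists_strip_pair (hs.ne_zero j) (hs.disjoint j k (Ne.symm hk))
      exact ⟨ε, hε, fun _ => h⟩
  choose ε hε h using this
  refine ⟨Finset.univ.inf' ⟨j, Finset.mem_univ j⟩ ε, (Finset.lt_inf'_iff _).2 fun k _ => hε k,
    fun k hk x hx hh => ?_⟩
  have hle := Finset.inf'_le ε (Finset.mem_univ k)
  linarith [h k hk x hx (hh.trans_le hle)]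

/-- The amount by which `x` is moved against the direction of a ray. It vanishes outside a
half-strip of width `ε` around the ray and exceeds `along z v x` on the ray. -/
def pushAmount (z v : Plane) (ε : ℝ) (x : Plane) : ℝ :=
  max 0 (along z v x + ε / 2) * max 0 (1 - |height z v x| / ε)

/-- The push of the plane off the ray. -/
def pushOff (z v : Plane) (ε : ℝ) (x : Plane) : Plane :=
  x - (pushAmount z v ε x / (v 0 ^ 2 + v 1 ^ 2)) • v

theorem continuous_pushOff (z v : Plane) (ε : ℝ) : Continuous (pushOff z v ε) := by
  unfold pushOff pushAmount
  have := continuous_height z v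
  have := continuous_along z v
  fun_prop

theorem height_sub_smul (z v x : Plane) (c : ℝ) : height z v (x - c • v) = height z v x := by
  simp only [height, PiLp.sub_apply, PiLp.smul_apply, smul_eq_mul]; ring

theorem along_sub_smul {z v : Plane} (hv : v ≠ 0) (x : Plane) (c : ℝ) :
    along z v (x - (c / (v 0 ^ 2 + v 1 ^ 2)) • v) = along z v x - c := by
  have := (normSq_pos hv).ne'
  simp only [along, PiLp.sub_apply, PiLp.smul_apply, smul_eq_mul]; field_simp; ring

theorem pushOff_notMem {z v : Plane} (hv : v ≠ 0) {ε : ℝ} (hε : 0 < ε) (x : Plane) :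
    pushOff z v ε x ∉ ray z v := by
  rw [mem_ray_iff hv, pushOff, height_sub_smul, along_sub_smul hv]
  rintro ⟨h0, h1⟩
  rw [pushAmount, h0] at h1
  simp only [abs_zero, zero_div, sub_zero, zero_le_one, sup_of_le_right, mul_one] at h1
  have := le_max_right 0 (along z v x + ε / 2)
  linarith

/-- Points of the segment from `x` to its push lie on the ray, or on another ray, only if `x`
does. -/
theorem segment_pushOff {z v : Plane} (hv : v ≠ 0) {ε : ℝ} (hε : 0 < ε) {x : Plane} {t : ℝ}
    (ht : 0 ≤ t) (ht1 : t ≤ 1) :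
    ((1 - t) • x + t • pushOff z v ε x ∈ ray z v → x ∈ ray z v) ∧
    (x = (1 - t) • x + t • pushOff z v ε x ∨
      (|height z v ((1 - t) • x + t • pushOff z v ε x)| < ε ∧
        -ε < along z v ((1 - t) • x + t • pushOff z v ε x))) := by
  have hx : (1 - t) • x + t • pushOff z v ε x =
      x - ((t * pushAmount z v ε x) / (v 0 ^ 2 + v 1 ^ 2)) • v := by
    rw [pushOff, smul_sub, smul_smul, sub_smul, one_smul, mul_div_assoc]; abel
  have hnn : 0 ≤ pushAmount z v ε x := mul_nonneg (le_max_left _ _) (le_max_left _ _)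
  rw [hx, mem_ray_iff hv, mem_ray_iff hv, height_sub_smul, along_sub_smul hv]
  refine ⟨fun h => ⟨h.1, by nlinarith [h.2]⟩, ?_⟩
  by_cases h0 : pushAmount z v ε x = 0
  · left; simp [h0]
  · right
    have h1 : 0 < along z v x + ε / 2 := by
      by_contra! h; exact h0 (by rw [pushAmount, max_eq_left h, zero_mul])
    have h2 : 0 < 1 - |height z v x| / ε := by
      by_contra! h; exact h0 (by rw [pushAmount, max_eq_left h, mul_zero])
    refine ⟨by rw [sub_pos, div_lt_one hε] at h2; exact h2, ?_⟩
    have h3 : pushAmount z v ε x ≤ along z v x + ε / 2 := by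
      rw [pushAmount, max_eq_right h1.le, max_eq_right h2.le]
      have : |height z v x| / ε ≥ 0 := by positivity
      nlinarith
    nlinarith

/-- The plane cut along the rays with index in `s`. -/
def slitOf (z v : Fin m → Plane) (s : Set (Fin m)) : Set Plane := (⋃ j ∈ s, ray (z j) (v j))ᶜ

theorem mem_slitOf {s : Set (Fin m)} {x : Plane} :
    x ∈ slitOf z v s ↔ ∀ j ∈ s, x ∉ ray (z j) (v j) := by simp [slitOf]

theorem slitOf_univ : slitOf z v univ = slit z v := by simp [slitOf, slit]

theorem IsRaySystem.contractible_slitOf (hs : IsRaySystem z v) (s : Finset (Fin m)) :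
    ContractibleSpace (slitOf z v (s : Set (Fin m))) := by
  classical
  induction s using Finset.induction_on with
  | empty =>
    have : slitOf z v ((∅ : Finset (Fin m)) : Set (Fin m)) = univ := by simp [slitOf]
    rw [this]
    exact (Homeomorph.Set.univ Plane).toHomotopyEquiv.contractibleSpace
  | insert j s hj ih =>
    obtain ⟨ε, hε, hstrip⟩ := hs.exists_strip j
    set A := slitOf z v (s : Set (Fin m))
    set B := slitOf z v ((insert j s : Finset (Fin m)) : Set (Fin m))
    have hBA : B ⊆ A := fun x hx => mem_slitOf.2 fun k hk =>
      mem_slitOf.1 hx k (by simpa using Or.inr hk)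
    set q := pushOff (z j) (v j) ε
    have hA : ∀ x ∈ A, ∀ t : ℝ, 0 ≤ t → t ≤ 1 → (1 - t) • x + t • q x ∈ A := by
      intro x hx t ht ht1
      refine mem_slitOf.2 fun k hk hmem => ?_
      have hkj : k ≠ j := by rintro rfl; exact hj (by simpa using hk)
      rcases (segment_pushOff (hs.ne_zero j) hε (x := x) ht ht1).2 with h | h
      · rw [← h] at hmem; exact mem_slitOf.1 hx k hk hmem
      · exact absurd (hstrip k hkj _ hmem h.1) (not_le.2 h.2)
    have hB : ∀ x ∈ B, ∀ t : ℝ, 0 ≤ t → t ≤ 1 → (1 - t) • x + t • q x ∈ B := by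
      intro x hx t ht ht1
      refine mem_slitOf.2 fun k hk hmem => ?_
      rcases Finset.mem_insert.1 (Finset.mem_coe.1 hk) with rfl | hk'
      · exact mem_slitOf.1 hx k hk ((segment_pushOff (hs.ne_zero k) hε ht ht1).1 hmem)
      · exact mem_slitOf.1 (hA x (hBA hx) t ht ht1) k hk' hmem
    have hqB : ∀ x ∈ A, q x ∈ B := by
      intro x hx
      refine mem_slitOf.2 fun k hk hmem => ?_
      rcases Finset.mem_insert.1 (Finset.mem_coe.1 hk) with rfl | hk'
      · exact pushOff_notMem (hs.ne_zero k) hε x hmem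
      · have := hA x hx 1 zero_le_one le_rfl
        simp only [sub_self, zero_smul, one_smul, zero_add] at this
        exact mem_slitOf.1 this k hk' hmem
    have hq : Continuous q := continuous_pushOff _ _ _
    let f : C(A, B) := ⟨fun x => ⟨q x, hqB x x.2⟩, by fun_prop⟩
    let i : C(B, A) := ⟨inclusion hBA, continuous_inclusion hBA⟩
    have hfi : (f.comp i).Homotopic (ContinuousMap.id B) := ContinuousMap.Homotopic.symm
      ⟨{ toFun := fun p => ⟨(1 - (p.1 : ℝ)) • (p.2 : Plane) + (p.1 : ℝ) • q p.2,
            hB p.2 p.2.2 p.1 p.1.2.1 p.1.2.2⟩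
         continuous_toFun := by fun_prop
         map_zero_left := fun x => by ext1; simp
         map_one_left := fun x => by ext1; simp [f, i] }⟩
    have hif : (i.comp f).Homotopic (ContinuousMap.id A) := ContinuousMap.Homotopic.symm
      ⟨{ toFun := fun p => ⟨(1 - (p.1 : ℝ)) • (p.2 : Plane) + (p.1 : ℝ) • q p.2,
            hA p.2 p.2.2 p.1 p.1.2.1 p.1.2.2⟩
         continuous_toFun := by fun_prop
         map_zero_left := fun x => by ext1; simp
         map_one_left := fun x => by ext1; simp [f, i] }⟩
    exact (ContinuousMap.HomotopyEquiv.mk i f hfi hif).contractibleSpace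

theorem IsRaySystem.contractible_slit (hs : IsRaySystem z v) : ContractibleSpace (slit z v) := by
  have := hs.contractible_slitOf Finset.univ
  rwa [Finset.coe_univ, slitOf_univ] at this

end Slit

/-! ### Strips around the rays, and paths with a given signature -/

section Paths

variable {m : ℕ} {z v : Fin m → Plane}

/-- The open half-strip of width `ε` on both sides of a ray, in front of its starting point. -/
def strip (z v : Plane) (ε : ℝ) : Set Plane := {x | |height z v x| < ε ∧ 0 < along z v x}

/-- The part of the strip to the left of the ray. -/
def upperStrip (z v : Plane) (ε : ℝ) : Set Plane := {x ∈ strip z v ε | 0 < height z v x}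

/-- The part of the strip to the right of the ray. -/
def lowerStrip (z v : Plane) (ε : ℝ) : Set Plane := {x ∈ strip z v ε | height z v x < 0}

section strip

variable (z v : Plane) (ε : ℝ)

theorem isOpen_strip : IsOpen (strip z v ε) :=
  (isOpen_lt (continuous_height z v).abs continuous_const).inter
    (isOpen_lt continuous_const (continuous_along z v))

theorem convex_strip : Convex ℝ (strip z v ε) := by
  rintro x ⟨hx, hx'⟩ y ⟨hy, hy'⟩ a b ha hb hab
  rw [abs_lt] at hx hy
  simp only [strip, mem_ofPred_eq, height_combo _ _ _ _ hab, along_combo _ _ _ _ hab, abs_lt]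
  obtain rfl : b = 1 - a := by linarith
  rcases ha.eq_or_lt with rfl | ha
  · simpa using ⟨hy, hy'⟩
  refine ⟨⟨?_, ?_⟩, ?_⟩ <;> nlinarith

theorem convex_upperStrip : Convex ℝ (upperStrip z v ε) := by
  refine (convex_strip z v ε).inter (t := {x | 0 < height z v x}) ?_
  intro x hx y hy a b ha hb hab
  simp only [mem_ofPred_eq, height_combo _ _ _ _ hab] at hx hy ⊢
  obtain rfl : b = 1 - a := by linarith
  rcases ha.eq_or_lt with rfl | ha
  · simpa using hy
  nlinarith [mul_pos ha hx, mul_nonneg hb hy.le]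

theorem convex_lowerStrip : Convex ℝ (lowerStrip z v ε) := by
  refine (convex_strip z v ε).inter (t := {x | height z v x < 0}) ?_
  intro x hx y hy a b ha hb hab
  simp only [mem_ofPred_eq, height_combo _ _ _ _ hab] at hx hy ⊢
  obtain rfl : b = 1 - a := by linarith
  rcases ha.eq_or_lt with rfl | ha
  · simpa using hy
  nlinarith [mul_pos ha (neg_pos.2 hx), mul_nonneg hb (neg_pos.2 hy).le]

variable {z v ε}

theorem exists_mem_strip (hv : v ≠ 0) {h : ℝ} (hh : |h| < ε) :
    ∃ x ∈ strip z v ε, height z v x = h := by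
  have hpos := normSq_pos hv
  have h1 : height z v (z + v + (h / (v 0 ^ 2 + v 1 ^ 2)) • !₂[-v 1, v 0]) = h := by
    simp [height]; field_simp; ring
  have h2 : along z v (z + v + (h / (v 0 ^ 2 + v 1 ^ 2)) • !₂[-v 1, v 0]) =
      v 0 ^ 2 + v 1 ^ 2 := by
    simp [along]; ring
  exact ⟨_, ⟨h1.symm ▸ hh, h2.symm ▸ hpos⟩, h1⟩

theorem upperStrip_nonempty (hv : v ≠ 0) (hε : 0 < ε) : (upperStrip z v ε).Nonempty := by
  obtain ⟨x, hx, h⟩ := exists_mem_strip (z := z) (ε := ε) hv (h := ε / 2)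
    (by rw [abs_lt]; constructor <;> linarith)
  exact ⟨x, hx, by linarith⟩

theorem lowerStrip_nonempty (hv : v ≠ 0) (hε : 0 < ε) : (lowerStrip z v ε).Nonempty := by
  obtain ⟨x, hx, h⟩ := exists_mem_strip (z := z) (ε := ε) hv (h := -ε / 2)
    (by rw [abs_lt]; constructor <;> linarith)
  exact ⟨x, hx, by linarith⟩

theorem start_notMem_strip : z ∉ strip z v ε := fun h => by
  have := h.2; simp [along] at this

theorem mem_strip_of_mem_ray (hv : v ≠ 0) (hε : 0 < ε) {x : Plane} (hx : x ∈ ray z v)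
    (hxz : x ≠ z) : x ∈ strip z v ε := by
  have hx' := (mem_ray_iff hv x).1 hx
  refine ⟨by simpa [hx'.1] using hε, hx'.2.lt_of_ne ?_⟩
  obtain ⟨t, ht, rfl⟩ := hx
  intro h0
  apply hxz
  have : along z v (z + t • v) = t * (v 0 ^ 2 + v 1 ^ 2) := by
    simp [along]; ring
  rw [this] at h0
  rcases mul_eq_zero.1 h0.symm with h | h
  · simp [h]
  · exact absurd h (normSq_pos hv).ne'

end strip

/-- A half-width of the strip around the `j`-th ray for which it avoids the other rays. -/
def IsRaySystem.width (hs : IsRaySystem z v) (j : Fin m) : ℝ := (hs.exists_strip j).choose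

/-- The strip around the `j`-th ray. -/
abbrev IsRaySystem.strip (hs : IsRaySystem z v) (j : Fin m) : Set Plane :=
  Tether.strip (z j) (v j) (hs.width j)

theorem IsRaySystem.width_pos (hs : IsRaySystem z v) (j : Fin m) : 0 < hs.width j :=
  (hs.exists_strip j).choose_spec.1

theorem IsRaySystem.disjoint_strip (hs : IsRaySystem z v) {j k : Fin m} (hk : k ≠ j) :
    Disjoint (hs.strip j) (ray (z k) (v k)) :=
  disjoint_left.2 fun x hx hxk => by
    have := (hs.exists_strip j).choose_spec.2 k hk x hxk hx.1
    linarith [hx.2, (hs.exists_strip j).choose_spec.1]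

theorem IsRaySystem.strip_subset_punctured (hs : IsRaySystem z v) (j : Fin m) :
    hs.strip j ⊆ punctured z := by
  rintro x hx ⟨k, rfl⟩
  by_cases hk : k = j
  · subst hk; exact start_notMem_strip hx
  · exact (hs.disjoint_strip hk).le_bot ⟨hx, start_mem_ray _ _⟩

theorem IsRaySystem.slit_of_strip (hs : IsRaySystem z v) {j : Fin m} {x : Plane}
    (hx : x ∈ hs.strip j) (hx' : x ∉ ray (z j) (v j)) : x ∈ slit z v :=
  mem_slit.2 fun k hk => by
    by_cases h : k = j
    · subst h; exact hx' hk
    · exact (hs.disjoint_strip h).le_bot ⟨hx, hk⟩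

theorem IsRaySystem.upperStrip_subset_slit (hs : IsRaySystem z v) (j : Fin m) :
    upperStrip (z j) (v j) (hs.width j) ⊆ slit z v := fun x hx =>
  hs.slit_of_strip hx.1 fun h => hx.2.ne' ((mem_ray_iff (hs.ne_zero j) x).1 h).1

theorem IsRaySystem.lowerStrip_subset_slit (hs : IsRaySystem z v) (j : Fin m) :
    lowerStrip (z j) (v j) (hs.width j) ⊆ slit z v := fun x hx =>
  hs.slit_of_strip hx.1 fun h => hx.2.ne ((mem_ray_iff (hs.ne_zero j) x).1 h).1

theorem IsRaySystem.crossingWord_strip (hs : IsRaySystem z v) {j : Fin m} {x y : Plane}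
    (hx : x ∈ hs.strip j) (hy : y ∈ hs.strip j) :
    crossingWord z v x y = FreeGroup.of j ^ (side (z j) (v j) y - side (z j) (v j) x) := by
  obtain ⟨p, hp, hp0⟩ := exists_mem_strip (z := z j) (hs.ne_zero j) (h := 0)
    (by simpa using hs.width_pos j)
  rw [crossingWord_eq_of j fun k hk =>
      crossing_of_disjoint (convex_strip _ _ _) (hs.disjoint_strip hk) hx hy,
    crossing_of_convex (hs.ne_zero j) (convex_strip _ _ _) start_notMem_strip hp
      ((mem_ray_iff (hs.ne_zero j) p).2 ⟨hp0, hp.2.le⟩) hx hy]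

/-- A path in a subset of `X` as a path in `X` that stays in the subset. -/
theorem exists_path_of_joinedIn {X D : Set Plane} {x y : Plane} (h : JoinedIn D x y)
    (hD : D ⊆ X) (hx : x ∈ X) (hy : y ∈ X) :
    ∃ γ : Path (⟨x, hx⟩ : X) ⟨y, hy⟩, ∀ t, (γ t : Plane) ∈ D := by
  obtain ⟨γ, hγ⟩ := h
  exact ⟨⟨⟨fun t => ⟨γ t, hD (hγ t)⟩, by fun_prop⟩, by ext1; simp, by ext1; simp⟩, hγ⟩

/-- There is a path from `x` to `y` in the punctured plane with signature `w`. -/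
def Reaches (z v : Fin m → Plane) (x y : punctured z) (w : FreeGroup (Fin m)) : Prop :=
  ∃ γ : Path x y, IsSignature z v γ.toContinuousMap w

theorem IsRaySystem.reaches_trans (hs : IsRaySystem z v) {a b c : punctured z}
    {w w' : FreeGroup (Fin m)} (h : Reaches z v a b w) (h' : Reaches z v b c w') :
    Reaches z v a c (w * w') := by
  obtain ⟨γ, h⟩ := h
  obtain ⟨γ', h'⟩ := h'
  exact ⟨γ.trans γ', hs.isSignature_trans h h'⟩

theorem IsRaySystem.reaches_symm (hs : IsRaySystem z v) {a b : punctured z}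
    {w : FreeGroup (Fin m)} (h : Reaches z v a b w) : Reaches z v b a w⁻¹ := by
  obtain ⟨γ, h⟩ := h
  exact ⟨γ.symm, IsSignature.inv hs h⟩

theorem IsRaySystem.isPathConnected_slit (hs : IsRaySystem z v) : IsPathConnected (slit z v) := by
  have := hs.contractible_slit
  exact isPathConnected_iff_pathConnectedSpace.2 inferInstance

theorem IsRaySystem.reaches_slit (hs : IsRaySystem z v) {a b : punctured z}
    (ha : (a : Plane) ∈ slit z v) (hb : (b : Plane) ∈ slit z v) : Reaches z v a b 1 := by
  obtain ⟨γ, hγ⟩ := exists_path_of_joinedIn (hs.isPathConnected_slit.joinedIn a ha b hb)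
    slit_subset_punctured a.2 b.2
  exact ⟨γ, hs.isSignature_of_slit hγ⟩

theorem IsRaySystem.isSignature_strip (hs : IsRaySystem z v) {j : Fin m} {a b : punctured z}
    {γ : Path a b} (hγ : ∀ t, (γ t : Plane) ∈ hs.strip j) :
    IsSignature z v γ.toContinuousMap
      (FreeGroup.of j ^ (side (z j) (v j) b - side (z j) (v j) a)) := by
  have := isSignature_of_potential (z := z) (v := v) (γ := γ.toContinuousMap)
    (fun t => FreeGroup.of j ^ side (z j) (v j) (γ t)) fun t => .of_forall fun s => by
      rw [← zpow_neg, ← zpow_add, neg_add_eq_sub]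
      exact hs.crossingWord_strip (hγ t) (hγ s)
  simpa [← zpow_neg, ← zpow_add, neg_add_eq_sub] using this

theorem IsRaySystem.reaches_strip (hs : IsRaySystem z v) {j : Fin m} {a b : punctured z}
    (ha : (a : Plane) ∈ hs.strip j) (hb : (b : Plane) ∈ hs.strip j) :
    Reaches z v a b (FreeGroup.of j ^ (side (z j) (v j) b - side (z j) (v j) a)) := by
  obtain ⟨γ, hγ⟩ := exists_path_of_joinedIn
    (((convex_strip _ _ _).isPathConnected ⟨_, ha⟩).joinedIn a ha b hb)
    (hs.strip_subset_punctured j) a.2 b.2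
  exact ⟨γ, hs.isSignature_strip hγ⟩

theorem IsRaySystem.exists_reaches_slit (hs : IsRaySystem z v) (a : punctured z) :
    ∃ b : punctured z, (b : Plane) ∈ slit z v ∧ Reaches z v a b 1 := by
  by_cases ha : (a : Plane) ∈ slit z v
  · exact ⟨a, ha, hs.reaches_slit ha ha⟩
  · obtain ⟨j, hj⟩ : ∃ j, (a : Plane) ∈ ray (z j) (v j) := by
      by_contra! h; exact ha (mem_slit.2 h)
    obtain ⟨b, hb⟩ := upperStrip_nonempty (z := z j) (hs.ne_zero j) (hs.width_pos j)
    have hb' := hs.upperStrip_subset_slit j hb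
    refine ⟨⟨b, slit_subset_punctured hb'⟩, hb', ?_⟩
    have ha' := mem_strip_of_mem_ray (hs.ne_zero j) (hs.width_pos j) hj
      fun h => a.2 ⟨j, h.symm⟩
    have := hs.reaches_strip ha' (b := ⟨b, slit_subset_punctured hb'⟩) hb.1
    rwa [side_of_nonneg hb.2.le, side_of_nonneg ((mem_ray_iff (hs.ne_zero j) _).1 hj).1.ge,
      sub_self, zpow_zero] at this

/-- Every word is the signature of a path with prescribed endpoints in the punctured plane. -/
theorem IsRaySystem.reaches (hs : IsRaySystem z v) (a b : punctured z) (w : FreeGroup (Fin m)) :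
    Reaches z v a b w := by
  obtain ⟨s, hs1, has⟩ := hs.exists_reaches_slit a
  obtain ⟨t, ht1, hbt⟩ := hs.exists_reaches_slit b
  suffices Reaches z v s s w by
    simpa using hs.reaches_trans has (hs.reaches_trans this
      (hs.reaches_trans (hs.reaches_slit hs1 ht1) (hs.reaches_symm hbt)))
  induction w using FreeGroup.induction_on with
  | C1 => exact hs.reaches_slit hs1 hs1
  | of j =>
    obtain ⟨x, hx⟩ := upperStrip_nonempty (z := z j) (hs.ne_zero j) (hs.width_pos j)
    obtain ⟨y, hy⟩ := lowerStrip_nonempty (z := z j) (hs.ne_zero j) (hs.width_pos j)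
    have hx' := hs.upperStrip_subset_slit j hx
    have hy' := hs.lowerStrip_subset_slit j hy
    have h := hs.reaches_strip (a := ⟨y, slit_subset_punctured hy'⟩)
      (b := ⟨x, slit_subset_punctured hx'⟩) hy.1 hx.1
    rw [side_of_nonneg hx.2.le, side_of_neg hy.2, sub_zero, zpow_one] at h
    simpa using hs.reaches_trans (hs.reaches_slit hs1 hy')
      (hs.reaches_trans h (hs.reaches_slit hx' hs1))
  | inv_of j ih => exact hs.reaches_symm ih
  | mul x y hx hy => exact hs.reaches_trans hx hy

/-- Two paths with common endpoints that pass a starting point of a ray on different sides: their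
signatures differ, but they are homotopic once this point is filled in. -/
theorem IsRaySystem.exists_pair_around (hs : IsRaySystem z v) (j : Fin m) (a b : punctured z) :
    ∃ α β : Path a b, ∃ w w' : FreeGroup (Fin m), w ≠ w' ∧
      IsSignature z v α.toContinuousMap w ∧ IsSignature z v β.toContinuousMap w' ∧
      ∀ (Y : Set Plane) (hY : punctured z ⊆ Y), slitOf z v {k | k ≠ j} ⊆ Y →
        (α.map (continuous_inclusion hY)).Homotopic (β.map (continuous_inclusion hY)) := by
  classical
  obtain ⟨x, hx⟩ := upperStrip_nonempty (z := z j) (hs.ne_zero j) (hs.width_pos j)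
  obtain ⟨y, hy⟩ := lowerStrip_nonempty (z := z j) (hs.ne_zero j) (hs.width_pos j)
  have hx' := hs.upperStrip_subset_slit j hx
  have hy' := hs.lowerStrip_subset_slit j hy
  obtain ⟨γ, hγ⟩ := exists_path_of_joinedIn (hs.isPathConnected_slit.joinedIn y hy' x hx')
    slit_subset_punctured (slit_subset_punctured hy') (slit_subset_punctured hx')
  obtain ⟨δ, hδ⟩ := exists_path_of_joinedIn
    (((convex_strip _ _ _).isPathConnected ⟨_, hx.1⟩).joinedIn y hy.1 x hx.1)
    (hs.strip_subset_punctured j) (slit_subset_punctured hy') (slit_subset_punctured hx')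
  have hsδ := hs.isSignature_strip hδ
  have hsγ := hs.isSignature_of_slit hγ
  rw [side_of_nonneg hx.2.le, side_of_neg hy.2, sub_zero, zpow_one] at hsδ
  obtain ⟨p, hp⟩ := hs.reaches a ⟨y, slit_subset_punctured hy'⟩ 1
  obtain ⟨q, hq⟩ := hs.reaches ⟨x, slit_subset_punctured hx'⟩ b 1
  refine ⟨p.trans (δ.trans q), p.trans (γ.trans q), _, _, ?_,
    hs.isSignature_trans hp (hs.isSignature_trans hsδ hq),
    hs.isSignature_trans hp (hs.isSignature_trans hsγ hq), fun Y hY hslit => ?_⟩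
  · simp
  · have hc : ContractibleSpace (slitOf z v {k | k ≠ j}) := by
      have := hs.contractible_slitOf (Finset.univ.filter fun k => k ≠ j)
      rwa [Finset.coe_filter_univ] at this
    have h1 : ∀ t, (γ t : Plane) ∈ slitOf z v {k | k ≠ j} := fun t =>
      mem_slitOf.2 fun k _ => mem_slit.1 (hγ t) k
    have h2 : ∀ t, (δ t : Plane) ∈ slitOf z v {k | k ≠ j} := fun t =>
      mem_slitOf.2 fun k hk h => (hs.disjoint_strip hk).le_bot ⟨hδ t, h⟩
    have e0 : y ∈ slitOf z v {k | k ≠ j} := by simpa using h1 0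
    have e1 : x ∈ slitOf z v {k | k ≠ j} := by simpa using h1 1
    let γ' : Path (⟨y, e0⟩ : slitOf z v {k | k ≠ j}) ⟨x, e1⟩ :=
      ⟨⟨fun t => ⟨γ t, h1 t⟩, by fun_prop⟩, by ext1; simp, by ext1; simp⟩
    let δ' : Path (⟨y, e0⟩ : slitOf z v {k | k ≠ j}) ⟨x, e1⟩ :=
      ⟨⟨fun t => ⟨δ t, h2 t⟩, by fun_prop⟩, by ext1; simp, by ext1; simp⟩
    have h : δ'.Homotopic γ' := SimplyConnectedSpace.paths_homotopic _ _
    have h' : (δ.map (continuous_inclusion hY)).Homotopic (γ.map (continuous_inclusion hY)) :=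
      h.map ⟨inclusion hslit, continuous_inclusion hslit⟩
    simp only [Path.map_trans]
    exact (Path.Homotopic.refl _).hcomp (h'.hcomp (Path.Homotopic.refl _))

end Paths

/-! ### Lifts along a covering are determined by the signature -/

section Lifts

variable {E X : Type*} [TopologicalSpace E] [TopologicalSpace X] {p : E → X} {Y : Set Plane}

/-- Lifts through `p`, over the part `U` of `Y`, of the map `f` on `Y`. -/
def Lifts (p : E → X) (f : C(Y, X)) (U : Set Plane) (hU : U ⊆ Y) : Type _ :=
  {s : C(U, E) // ∀ x : U, p (s x) = f ⟨x, hU x.2⟩}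

variable (hp : IsCoveringMap p) (f : C(Y, X)) {U V N : Set Plane} (hU : U ⊆ Y) (hN : N ⊆ Y)

/-- Over a simply connected set, lifts correspond to the points of the fibre over a base point. -/
def evalLift (hUc : SimplyConnectedSpace U) (hUo : IsOpen U) (x : U) :
    Lifts p f U hU ≃ p ⁻¹' {f ⟨x, hU x.2⟩} :=
  have : LocallyPathConnectedSpace U := hUo.locallyPathConnectedSpace
  Equiv.ofBijective (fun s => ⟨s.1 x, s.2 x⟩) <| by
    have key := fun e he => hp.existsUnique_continuousMap_lifts
      (f.comp ⟨inclusion hU, continuous_inclusion hU⟩) x e he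
    constructor
    · intro s t h
      have h' : s.1 x = t.1 x := congrArg Subtype.val h
      exact Subtype.ext ((key (t.1 x) (t.2 x)).unique ⟨h', funext s.2⟩ ⟨rfl, funext t.2⟩)
    · rintro ⟨e, he⟩
      obtain ⟨s, ⟨h0, hs⟩, -⟩ := key e he
      exact ⟨⟨s, congrFun hs⟩, Subtype.ext h0⟩

/-- Transport of lifts from `U` to `N` by continuation through the connected set `V`. -/
def transferLift (hUc : SimplyConnectedSpace U) (hUo : IsOpen U) (hNc : SimplyConnectedSpace N)
    (hNo : IsOpen N) (hVU : V ⊆ U) (hVN : V ⊆ N) (hV : V.Nonempty) :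
    Lifts p f U hU ≃ Lifts p f N hN :=
  (evalLift hp f hU hUc hUo ⟨hV.some, hVU hV.some_mem⟩).trans
    (evalLift hp f hN hNc hNo ⟨hV.some, hVN hV.some_mem⟩).symm

theorem transferLift_apply (hUc : SimplyConnectedSpace U) (hUo : IsOpen U)
    (hNc : SimplyConnectedSpace N) (hNo : IsOpen N) (hVU : V ⊆ U) (hVN : V ⊆ N)
    (hV : V.Nonempty) (hVc : IsPreconnected V) (s : Lifts p f U hU) {x : Plane} (hx : x ∈ V) :
    (transferLift hp f hU hN hUc hUo hNc hNo hVU hVN hV s).1 ⟨x, hVN hx⟩ =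
      s.1 ⟨x, hVU hx⟩ := by
  set t := transferLift hp f hU hN hUc hUo hNc hNo hVU hVN hV s with ht
  have h0 : t.1 ⟨hV.some, hVN hV.some_mem⟩ = s.1 ⟨hV.some, hVU hV.some_mem⟩ := by
    have := (evalLift hp f hN hNc hNo ⟨hV.some, hVN hV.some_mem⟩).apply_symm_apply
      (evalLift hp f hU hUc hUo ⟨hV.some, hVU hV.some_mem⟩ s)
    exact congrArg Subtype.val this
  have : PreconnectedSpace V := isPreconnected_iff_preconnectedSpace.1 hVc
  have := hp.eq_of_comp_eq (A := V) (g₁ := t.1 ∘ inclusion hVN) (g₂ := s.1 ∘ inclusion hVU)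
    (t.1.continuous.comp (continuous_inclusion hVN))
    (s.1.continuous.comp (continuous_inclusion hVU))
    (by ext y; exact (t.2 (inclusion hVN y)).trans (s.2 (inclusion hVU y)).symm)
    ⟨hV.some, hV.some_mem⟩ h0
  exact congrFun this ⟨x, hx⟩

end Lifts

section Monodromy

variable {m : ℕ} {z v : Fin m → Plane} {E X : Type*} [TopologicalSpace E] [TopologicalSpace X]
  {p : E → X}

theorem Convex.simplyConnectedSpace {U : Set Plane} (hU : Convex ℝ U) (h : U.Nonempty) :
    SimplyConnectedSpace U :=
  have := hU.contractibleSpace h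
  inferInstance

variable (hs : IsRaySystem z v) (hp : IsCoveringMap p) (f : C(punctured z, X))

/-- The lifts over the slit plane. -/
abbrev SlitLifts (p : E → X) (f : C(punctured z, X)) (v : Fin m → Plane) : Type _ :=
  Lifts p f (slit z v) slit_subset_punctured

theorem IsRaySystem.simplyConnected_slit (hs : IsRaySystem z v) :
    SimplyConnectedSpace (slit z v) :=
  have := hs.contractible_slit
  inferInstance

theorem IsRaySystem.simplyConnected_strip (j : Fin m) : SimplyConnectedSpace (hs.strip j) :=
  Convex.simplyConnectedSpace (convex_strip _ _ _)
    ((upperStrip_nonempty (hs.ne_zero j) (hs.width_pos j)).mono fun _ h => h.1)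

/-- Continuation of lifts from the left of a ray across it. -/
def IsRaySystem.fromLeft (j : Fin m) :
    SlitLifts p f v ≃ Lifts p f (hs.strip j) (hs.strip_subset_punctured j) :=
  transferLift hp f _ _ hs.simplyConnected_slit hs.isOpen_slit (hs.simplyConnected_strip j)
    (isOpen_strip _ _ _) (hs.upperStrip_subset_slit j) (fun _ h => h.1)
    (upperStrip_nonempty (hs.ne_zero j) (hs.width_pos j))

/-- Continuation of lifts from the right of a ray across it. -/
def IsRaySystem.fromRight (j : Fin m) :
    SlitLifts p f v ≃ Lifts p f (hs.strip j) (hs.strip_subset_punctured j) :=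
  transferLift hp f _ _ hs.simplyConnected_slit hs.isOpen_slit (hs.simplyConnected_strip j)
    (isOpen_strip _ _ _) (hs.lowerStrip_subset_slit j) (fun _ h => h.1)
    (lowerStrip_nonempty (hs.ne_zero j) (hs.width_pos j))

/-- The action of the free group on the lifts over the slit plane: the generator of a ray
compares the continuations across it. -/
def IsRaySystem.monodromy : FreeGroup (Fin m) →* Equiv.Perm (SlitLifts p f v) :=
  FreeGroup.lift fun j => (hs.fromLeft hp f j).trans (hs.fromRight hp f j).symm

/-- The extension of a lift over the slit plane to the rays, continuous from the left. The last
branch never applies, since a point of a ray other than its start lies in the strip around it. -/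
def IsRaySystem.extend (u : SlitLifts p f v) (x : punctured z) : E :=
  open Classical in
  if h : (x : Plane) ∈ slit z v then u.1 ⟨x, h⟩
  else if h : ∃ j, (x : Plane) ∈ hs.strip j ∧ (x : Plane) ∈ ray (z j) (v j) then
    (hs.fromLeft hp f h.choose u).1 ⟨x, h.choose_spec.1⟩
  else u.1 ⟨_, hs.isPathConnected_slit.nonempty.some_mem⟩

theorem IsRaySystem.extend_of_slit (u : SlitLifts p f v) {x : punctured z}
    (h : (x : Plane) ∈ slit z v) : hs.extend hp f u x = u.1 ⟨x, h⟩ := dif_pos h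

theorem IsRaySystem.extend_of_ray (u : SlitLifts p f v) {j : Fin m} {x : punctured z}
    (h : (x : Plane) ∈ hs.strip j) (h' : (x : Plane) ∈ ray (z j) (v j)) :
    hs.extend hp f u x = (hs.fromLeft hp f j u).1 ⟨x, h⟩ := by
  have hex : ∃ j, (x : Plane) ∈ hs.strip j ∧ (x : Plane) ∈ ray (z j) (v j) := ⟨j, h, h'⟩
  have hj : hex.choose = j := by
    by_contra hne
    exact (hs.disjoint _ _ hne).le_bot ⟨hex.choose_spec.2, h'⟩
  rw [IsRaySystem.extend, dif_neg fun hx => mem_slit.1 hx j h', dif_pos hex]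
  have key : ∀ k (hk : (x : Plane) ∈ hs.strip k), k = j →
      (hs.fromLeft hp f k u).1 ⟨x, hk⟩ = (hs.fromLeft hp f j u).1 ⟨x, h⟩ := by
    rintro k hk rfl; rfl
  exact key _ _ hj

theorem IsRaySystem.extend_of_nonneg (u : SlitLifts p f v) {j : Fin m} {x : punctured z}
    (h : (x : Plane) ∈ hs.strip j) (h0 : 0 ≤ height (z j) (v j) x) :
    hs.extend hp f u x = (hs.fromLeft hp f j u).1 ⟨x, h⟩ := by
  rcases h0.eq_or_lt with h0 | h0
  · exact hs.extend_of_ray hp f u h ((mem_ray_iff (hs.ne_zero j) _).2 ⟨h0.symm, h.2.le⟩)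
  · have hx : (x : Plane) ∈ upperStrip (z j) (v j) (hs.width j) := ⟨h, h0⟩
    rw [hs.extend_of_slit hp f u (hs.upperStrip_subset_slit j hx)]
    exact (transferLift_apply hp f _ _ _ _ _ _ _ _ _ (convex_upperStrip _ _ _).isPreconnected
      u hx).symm

theorem IsRaySystem.extend_of_neg (u : SlitLifts p f v) {j : Fin m} {x : punctured z}
    (h : (x : Plane) ∈ hs.strip j) (h0 : height (z j) (v j) x < 0) :
    hs.extend hp f u x = (hs.fromRight hp f j u).1 ⟨x, h⟩ := by
  have hx : (x : Plane) ∈ lowerStrip (z j) (v j) (hs.width j) := ⟨h, h0⟩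
  rw [hs.extend_of_slit hp f u (hs.lowerStrip_subset_slit j hx)]
  exact (transferLift_apply hp f _ _ _ _ _ _ _ _ _ (convex_lowerStrip _ _ _).isPreconnected
    u hx).symm

/-- On a strip, the extension of the lift that has been corrected by the crossing number is
continuous. -/
theorem IsRaySystem.extend_monodromy (u : SlitLifts p f v) {j : Fin m} {x : punctured z}
    (h : (x : Plane) ∈ hs.strip j) :
    hs.extend hp f
      (hs.monodromy hp f ((FreeGroup.of j ^ (side (z j) (v j) x - 1))⁻¹) u) x =
      (hs.fromLeft hp f j u).1 ⟨x, h⟩ := by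
  rcases le_or_gt 0 (height (z j) (v j) x) with h0 | h0
  · rw [side_of_nonneg h0]
    simpa using hs.extend_of_nonneg hp f u h h0
  · rw [side_of_neg h0, hs.extend_of_neg hp f _ h h0]
    simp [IsRaySystem.monodromy]

theorem IsRaySystem.proj_extend (u : SlitLifts p f v) (x : punctured z) :
    p (hs.extend hp f u x) = f x := by
  by_cases hx : (x : Plane) ∈ slit z v
  · rw [hs.extend_of_slit hp f u hx]; exact u.2 _
  · obtain ⟨j, hj⟩ : ∃ j, (x : Plane) ∈ ray (z j) (v j) := by
      by_contra! h; exact hx (mem_slit.2 h)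
    rw [hs.extend_of_ray hp f u (mem_strip_of_mem_ray (hs.ne_zero j) (hs.width_pos j) hj
      fun h => x.2 ⟨j, h.symm⟩) hj]
    exact (hs.fromLeft hp f j u).2 _

theorem IsRaySystem.exists_extend_eq (x : punctured z) {e : E} (he : p e = f x) :
    ∃ u, hs.extend hp f u x = e := by
  by_cases hx : (x : Plane) ∈ slit z v
  · obtain ⟨u, hu⟩ := (evalLift hp f slit_subset_punctured hs.simplyConnected_slit hs.isOpen_slit
      ⟨x, hx⟩).surjective ⟨e, he⟩
    exact ⟨u, (hs.extend_of_slit hp f u hx).trans (congrArg Subtype.val hu)⟩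
  · obtain ⟨j, hj⟩ : ∃ j, (x : Plane) ∈ ray (z j) (v j) := by
      by_contra! h; exact hx (mem_slit.2 h)
    have hx' := mem_strip_of_mem_ray (hs.ne_zero j) (hs.width_pos j) hj
      fun h => x.2 ⟨j, h.symm⟩
    obtain ⟨t, ht⟩ := (evalLift hp f (hs.strip_subset_punctured j) (hs.simplyConnected_strip j)
      (isOpen_strip _ _ _) ⟨x, hx'⟩).surjective ⟨e, he⟩
    obtain ⟨u, rfl⟩ := (hs.fromLeft hp f j).surjective t
    exact ⟨u, (hs.extend_of_ray hp f u hx' hj).trans (congrArg Subtype.val ht)⟩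

theorem IsRaySystem.continuous_extend (u : SlitLifts p f v) {γ : C(I, punctured z)}
    {F : I → FreeGroup (Fin m)} (hF : Reads z v γ F) :
    Continuous fun t => hs.extend hp f (hs.monodromy hp f (F t)⁻¹ u) (γ t) := by
  rw [continuous_iff_continuousAt]
  intro t
  set u' := hs.monodromy hp f (F t)⁻¹ u with hu'
  have hγ : ContinuousAt (fun s => (γ s : Plane)) t :=
    (continuous_subtype_val.comp γ.continuous).continuousAt
  have hmon : ∀ s, F s = F t * crossingWord z v (γ t) (γ s) →
      hs.monodromy hp f (F s)⁻¹ u =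
        hs.monodromy hp f (crossingWord z v (γ t) (γ s))⁻¹ u' := fun s h => by
    rw [h, hu', mul_inv_rev, map_mul, Equiv.Perm.mul_apply]
  have cont : ∀ {U : Set Plane} (hU : U ⊆ punctured z) (_ : IsOpen U) (_ : (γ t : Plane) ∈ U)
      (s : Lifts p f U hU) (φ : I → E),
      (∀ᶠ r in 𝓝 t, ∀ hr : (γ r : Plane) ∈ U, φ r = s.1 ⟨γ r, hr⟩) → ContinuousAt φ t := by
    intro U hU hUo ht s φ hφ
    have hV : IsOpen {r | (γ r : Plane) ∈ U} :=
      hUo.preimage (continuous_subtype_val.comp γ.continuous)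
    refine (hV.isOpenEmbedding_subtypeVal.continuousAt_iff (x := ⟨t, ht⟩)).1 ?_
    have hψ : Continuous fun r : {r | (γ r : Plane) ∈ U} => s.1 ⟨γ r, r.2⟩ := by fun_prop
    refine hψ.continuousAt.congr ?_
    filter_upwards [continuous_subtype_val.continuousAt.eventually hφ] with r hr
    exact (hr r.2).symm
  by_cases ht : (γ t : Plane) ∈ slit z v
  · obtain ⟨ε, hε, -, h1⟩ := hs.exists_ball_slit ht
    refine cont slit_subset_punctured hs.isOpen_slit ht u' _ ?_
    filter_upwards [hF t, hγ.eventually (Metric.ball_mem_nhds _ hε)] with s h2 h3 hr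
    rw [hmon s h2, h1 _ (Metric.mem_ball_self hε) _ h3, inv_one, map_one,
      Equiv.Perm.one_apply, hs.extend_of_slit hp f u' hr]
  · obtain ⟨j, hj⟩ : ∃ j, (γ t : Plane) ∈ ray (z j) (v j) := by
      by_contra! h; exact ht (mem_slit.2 h)
    have ht' := mem_strip_of_mem_ray (hs.ne_zero j) (hs.width_pos j) hj
      fun h => (γ t).2 ⟨j, h.symm⟩
    refine cont (hs.strip_subset_punctured j) (isOpen_strip _ _ _) ht'
      (hs.fromLeft hp f j u') _ ?_
    filter_upwards [hF t] with s h2 hr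
    rw [hmon s h2, hs.crossingWord_strip ht' hr,
      side_of_nonneg ((mem_ray_iff (hs.ne_zero j) _).1 hj).1.ge, hs.extend_monodromy hp f u' hr]

/-- The endpoint of a lift depends only on its starting point, the endpoint of the path and the
signature. -/
theorem IsRaySystem.lift_eq_of_isSignature (hs : IsRaySystem z v) (hp : IsCoveringMap p)
    (f : C(punctured z, X)) {γ γ' : C(I, punctured z)} {w : FreeGroup (Fin m)}
    (h : IsSignature z v γ w) (h' : IsSignature z v γ' w) (h0 : γ 0 = γ' 0) (h1 : γ 1 = γ' 1)
    {Γ Γ' : C(I, E)} (hΓ : ∀ t, p (Γ t) = f (γ t)) (hΓ' : ∀ t, p (Γ' t) = f (γ' t))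
    (hΓ0 : Γ 0 = Γ' 0) : Γ 1 = Γ' 1 := by
  obtain ⟨u, hu⟩ := hs.exists_extend_eq hp f (γ 0) (hΓ 0)
  have key : ∀ {γ : C(I, punctured z)} {Γ : C(I, E)}, IsSignature z v γ w →
      (∀ t, p (Γ t) = f (γ t)) → hs.extend hp f u (γ 0) = Γ 0 →
      Γ 1 = hs.extend hp f (hs.monodromy hp f w⁻¹ u) (γ 1) := by
    intro γ Γ h hΓ hu
    obtain ⟨F, F0, F1, hF⟩ := h
    have := hp.eq_of_comp_eq Γ.continuous (hs.continuous_extend hp f u hF)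
      (by ext t; exact (hΓ t).trans (hs.proj_extend hp f _ _).symm) 0
      (by simp only [F0, inv_one, map_one, Equiv.Perm.one_apply]; exact hu.symm)
    rw [← F1]
    exact congrFun this 1
  rw [key h hΓ hu, key h' hΓ' (by rw [← h0, hu, hΓ0]), h1]

end Monodromy

/-! ### Finite unions of closed convex sets are neighborhood retracts -/

/-- `K` is an absolute neighborhood extensor for closed subsets of the plane. -/
def IsExtensor (K : Set Plane) : Prop :=
  ∀ (C : Set Plane) (f : Plane → Plane), IsClosed C → ContinuousOn f C → MapsTo f C K →
    ∃ (V : Set Plane) (g : Plane → Plane), IsOpen V ∧ C ⊆ V ∧ ContinuousOn g V ∧ MapsTo g V K ∧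
      EqOn g f C

/-- The plane retracts onto every nonempty closed convex subset, by nearest points. -/
theorem exists_retraction_of_convex {K : Set Plane} (hK : Convex ℝ K) (hc : IsClosed K)
    (hne : K.Nonempty) :
    ∃ r : Plane → Plane, Continuous r ∧ (∀ x, r x ∈ K) ∧ ∀ x ∈ K, r x = x := by
  choose r hrK hr using fun x : Plane =>
    exists_norm_eq_iInf_of_complete_convex hne hc.isComplete hK x
  have hin : ∀ x, ∀ w ∈ K, inner ℝ (x - r x) (w - r x) ≤ 0 := fun x =>
    (norm_eq_iInf_iff_real_inner_le_zero hK (hrK x)).1 (hr x)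
  refine ⟨r, ?_, hrK, fun x hx => ?_⟩
  · refine (LipschitzWith.of_dist_le_mul (K := 1) fun x y => ?_).continuous
    have h1 := hin x (r y) (hrK y)
    have h2 := hin y (r x) (hrK x)
    have h3 : ‖r x - r y‖ * ‖r x - r y‖ ≤ inner ℝ (x - y) (r x - r y) := by
      have e1 : inner ℝ (x - y) (r x - r y) = inner ℝ (r x - r y) (r x - r y) -
          inner ℝ (x - r x) (r y - r x) - inner ℝ (y - r y) (r x - r y) := by
        simp only [inner_sub_left, inner_sub_right]; ring
      rw [e1, real_inner_self_eq_norm_mul_norm]; linarith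
    have h4 := real_inner_le_norm (x - y) (r x - r y)
    rw [dist_eq_norm, dist_eq_norm, NNReal.coe_one, one_mul]
    by_contra! hlt
    nlinarith [norm_nonneg (x - y), norm_nonneg (r x - r y)]
  · have h := hin x x hx
    rw [real_inner_self_eq_norm_mul_norm] at h
    have : ‖x - r x‖ = 0 := by nlinarith [norm_nonneg (x - r x)]
    exact (sub_eq_zero.1 (norm_eq_zero.1 this)).symm

theorem isExtensor_of_convex {K : Set Plane} (hK : Convex ℝ K) (hc : IsClosed K) :
    IsExtensor K := by
  intro C f hC hf hfK
  rcases K.eq_empty_or_nonempty with rfl | hne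
  · obtain rfl : C = ∅ := eq_empty_of_forall_notMem fun x hx => hfK hx
    exact ⟨∅, f, isOpen_empty, le_rfl, hf, hfK, fun _ _ => rfl⟩
  · obtain ⟨r, hr, hrK, hrid⟩ := exists_retraction_of_convex hK hc hne
    obtain ⟨g, hg⟩ := ContinuousMap.exists_restrict_eq (Y := Plane) hC
      ⟨C.domRestrict f, continuousOn_iff_continuous_domRestrict.1 hf⟩
    refine ⟨univ, fun x => r (g x), isOpen_univ, subset_univ _,
      (hr.comp g.continuous).continuousOn, fun x _ => hrK _, fun x hx => ?_⟩
    have : g x = f x := congrArg (fun h : C(C, Plane) => h ⟨x, hx⟩) hg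
    simp only [this]
    exact hrid _ (hfK hx)

/-- The union of two closed extensors is an extensor if their intersection is one: the domain is
cut along the points equidistant to the two parts of the closed set. -/
theorem IsExtensor.union {A B : Set Plane} (hA : IsExtensor A) (hB : IsExtensor B)
    (hAB : IsExtensor (A ∩ B)) (hAc : IsClosed A) (hBc : IsClosed B) : IsExtensor (A ∪ B) := by
  intro C f hC hf hfK
  obtain ⟨CA, hCA, CB, hCB, hAC, hBC, hCAm, hCBm, hCAB⟩ :
      ∃ CA : Set Plane, IsClosed CA ∧ ∃ CB : Set Plane, IsClosed CB ∧ CA ⊆ C ∧ CB ⊆ C ∧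
        MapsTo f CA A ∧ MapsTo f CB B ∧ C ⊆ CA ∪ CB :=
    ⟨_, hf.preimage_isClosed_of_isClosed hC hAc, _, hf.preimage_isClosed_of_isClosed hC hBc,
      inter_subset_left, inter_subset_left, fun x hx => hx.2, fun x hx => hx.2,
      fun x hx => (hfK hx).imp (fun h => ⟨hx, h⟩) (fun h => ⟨hx, h⟩)⟩
  -- if one of the parts is empty there is nothing to glue
  rcases CA.eq_empty_or_nonempty with rfl | hneA
  · obtain ⟨V, g, h1, h2, h3, h4, h5⟩ := hB CB f hCB (hf.mono hBC) hCBm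
    rw [empty_union] at hCAB
    exact ⟨V, g, h1, hCAB.trans h2, h3, h4.mono_right subset_union_right, h5.mono hCAB⟩
  rcases CB.eq_empty_or_nonempty with rfl | hneB
  · obtain ⟨V, g, h1, h2, h3, h4, h5⟩ := hA CA f hCA (hf.mono hAC) hCAm
    rw [union_empty] at hCAB
    exact ⟨V, g, h1, hCAB.trans h2, h3, h4.mono_right subset_union_left, h5.mono hCAB⟩
  set XA : Set Plane := {x | Metric.infDist x CA ≤ Metric.infDist x CB} with hXA
  set XB : Set Plane := {x | Metric.infDist x CB ≤ Metric.infDist x CA} with hXB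
  have hXAc : IsClosed XA :=
    isClosed_le (Metric.continuous_infDist_pt _) (Metric.continuous_infDist_pt _)
  have hXBc : IsClosed XB :=
    isClosed_le (Metric.continuous_infDist_pt _) (Metric.continuous_infDist_pt _)
  have hcover : ∀ x, x ∈ XA ∨ x ∈ XB := fun x =>
    le_total (Metric.infDist x CA) (Metric.infDist x CB)
  have hXAC : ∀ x ∈ C, x ∈ XA → x ∈ CA := by
    intro x hx hxA
    rcases hCAB hx with h | h
    · exact h
    · rw [hXA, mem_ofPred_eq, Metric.infDist_zero_of_mem h] at hxA
      exact (hCA.mem_iff_infDist_zero hneA).2 (le_antisymm hxA Metric.infDist_nonneg)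
  have hXBC : ∀ x ∈ C, x ∈ XB → x ∈ CB := by
    intro x hx hxB
    rcases hCAB hx with h | h
    · rw [hXB, mem_ofPred_eq, Metric.infDist_zero_of_mem h] at hxB
      exact (hCB.mem_iff_infDist_zero hneB).2 (le_antisymm hxB Metric.infDist_nonneg)
    · exact h
  obtain ⟨V0, g0, hV0, hCV0, hg0, hg0m, hg0f⟩ := hAB (CA ∩ CB) f (hCA.inter hCB)
    (hf.mono (inter_subset_left.trans hAC)) fun x hx => ⟨hCAm hx.1, hCBm hx.2⟩
  obtain ⟨O0, hO0, hCO0, hO0V⟩ := normal_exists_closure_subset (hCA.inter hCB) hV0 hCV0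
  set D : Set Plane := XA ∩ XB ∩ closure O0 with hD
  have hDc : IsClosed D := (hXAc.inter hXBc).inter isClosed_closure
  -- extension over the part of the plane closer to one of the two closed sets
  have main : ∀ {A' CA' : Set Plane}, IsExtensor A' → IsClosed CA' → CA' ⊆ C → A ∩ B ⊆ A' →
      MapsTo f CA' A' → (∀ x ∈ C, x ∈ D → x ∈ CA ∩ CB) →
      ∃ (V : Set Plane) (g : Plane → Plane), IsOpen V ∧ CA' ⊆ V ∧ D ⊆ V ∧ ContinuousOn g V ∧
        MapsTo g V A' ∧ EqOn g f CA' ∧ EqOn g g0 D := by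
    intro A' CA' hA' hCA' hCA'C hABA' hm hCD
    classical
    have hgl : ContinuousOn (D.piecewise g0 f) (D ∪ CA') := by
      refine ContinuousOn.union_of_isClosed ?_ ?_ hDc hCA'
      · exact (hg0.mono (inter_subset_right.trans hO0V)).congr (piecewise_eqOn D g0 f)
      · refine (hf.mono hCA'C).congr fun x hx => ?_
        by_cases hxD : x ∈ D
        · rw [piecewise_eq_of_mem _ _ _ hxD]; exact hg0f (hCD x (hCA'C hx) hxD)
        · rw [piecewise_eq_of_notMem _ _ _ hxD]
    obtain ⟨V, g, h1, h2, h3, h4, h5⟩ := hA' (D ∪ CA') (D.piecewise g0 f) (hDc.union hCA') hgl (by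
      rintro x (hx | hx)
      · rw [piecewise_eq_of_mem _ _ _ hx]; exact hABA' (hg0m (hO0V hx.2))
      · by_cases hxD : x ∈ D
        · rw [piecewise_eq_of_mem _ _ _ hxD]; exact hABA' (hg0m (hO0V hxD.2))
        · rw [piecewise_eq_of_notMem _ _ _ hxD]; exact hm hx)
    refine ⟨V, g, h1, subset_union_right.trans h2, subset_union_left.trans h2, h3, h4,
      fun x hx => ?_, fun x hx => ?_⟩
    · rw [h5 (Or.inr hx)]
      by_cases hxD : x ∈ D
      · rw [piecewise_eq_of_mem _ _ _ hxD]; exact hg0f (hCD x (hCA'C hx) hxD)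
      · rw [piecewise_eq_of_notMem _ _ _ hxD]
    · rw [h5 (Or.inl hx), piecewise_eq_of_mem _ _ _ hx]
  have hCD : ∀ x ∈ C, x ∈ D → x ∈ CA ∩ CB := fun x hx hxD =>
    ⟨hXAC x hx hxD.1.1, hXBC x hx hxD.1.2⟩
  obtain ⟨VA, gA, hVA, hCVA, hDVA, hgA, hgAm, hgAf, hgA0⟩ :=
    main hA hCA hAC inter_subset_left hCAm hCD
  obtain ⟨VB, gB, hVB, hCVB, hDVB, hgB, hgBm, hgBf, hgB0⟩ :=
    main hB hCB hBC inter_subset_right hCBm hCD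
  classical
  set V : Set Plane := (VA ∪ XAᶜ) ∩ (VB ∪ XBᶜ) ∩ (O0 ∪ (XA ∩ XB)ᶜ) with hV
  have hVAx : ∀ x ∈ V, x ∈ XA → x ∈ VA := fun x hx hxA => hx.1.1.resolve_right fun h => h hxA
  have hVBx : ∀ x ∈ V, x ∈ XB → x ∈ VB := fun x hx hxB => hx.1.2.resolve_right fun h => h hxB
  have hagree : ∀ x ∈ V, x ∈ XA → x ∈ XB → gA x = gB x := by
    intro x hx hxA hxB
    have : x ∈ D := ⟨⟨hxA, hxB⟩, subset_closure (hx.2.resolve_right fun h => h ⟨hxA, hxB⟩)⟩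
    rw [hgA0 this, hgB0 this]
  refine ⟨V, XA.piecewise gA gB, ((hVA.union hXAc.isOpen_compl).inter
    (hVB.union hXBc.isOpen_compl)).inter (hO0.union (hXAc.inter hXBc).isOpen_compl), ?_, ?_, ?_, ?_⟩
  · intro x hx
    refine ⟨⟨?_, ?_⟩, ?_⟩
    · by_cases h : x ∈ XA
      · exact Or.inl (hCVA (hXAC x hx h))
      · exact Or.inr h
    · by_cases h : x ∈ XB
      · exact Or.inl (hCVB (hXBC x hx h))
      · exact Or.inr h
    · by_cases h : x ∈ XA ∩ XB
      · exact Or.inl (hCO0 ⟨hXAC x hx h.1, hXBC x hx h.2⟩)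
      · exact Or.inr h
  · have h1 : ContinuousOn (XA.piecewise gA gB) (V ∩ XA) :=
      (hgA.mono fun x hx => hVAx x hx.1 hx.2).congr fun x hx => piecewise_eq_of_mem _ _ _ hx.2
    have h2 : ContinuousOn (XA.piecewise gA gB) (V ∩ XB) := by
      refine (hgB.mono fun x hx => hVBx x hx.1 hx.2).congr fun x hx => ?_
      by_cases h : x ∈ XA
      · rw [piecewise_eq_of_mem _ _ _ h, hagree x hx.1 h hx.2]
      · rw [piecewise_eq_of_notMem _ _ _ h]
    intro x hx
    have hu : V = V ∩ XA ∪ V ∩ XB := by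
      rw [← inter_union_distrib_left, (eq_univ_of_forall hcover : XA ∪ XB = univ), inter_univ]
    rw [hu]
    refine ContinuousWithinAt.union ?_ ?_
    · by_cases h : x ∈ XA
      · exact h1 x ⟨hx, h⟩
      · exact continuousWithinAt_of_notMem_closure fun hcl =>
          h (hXAc.closure_subset_iff.2 inter_subset_right hcl)
    · by_cases h : x ∈ XB
      · exact h2 x ⟨hx, h⟩
      · exact continuousWithinAt_of_notMem_closure fun hcl =>
          h (hXBc.closure_subset_iff.2 inter_subset_right hcl)
  · intro x hx
    by_cases h : x ∈ XA
    · rw [piecewise_eq_of_mem _ _ _ h]; exact Or.inl (hgAm (hVAx x hx h))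
    · rw [piecewise_eq_of_notMem _ _ _ h]
      exact Or.inr (hgBm (hVBx x hx ((hcover x).resolve_left h)))
  · intro x hx
    by_cases h : x ∈ XA
    · rw [piecewise_eq_of_mem _ _ _ h]; exact hgAf (hXAC x hx h)
    · rw [piecewise_eq_of_notMem _ _ _ h]
      exact hgBf (hXBC x hx ((hcover x).resolve_left h))

theorem isExtensor_biUnion {ι : Type*} (s : Finset ι) (A : ι → Set Plane)
    (hA : ∀ i ∈ s, Convex ℝ (A i)) (hc : ∀ i ∈ s, IsClosed (A i)) :
    IsExtensor (⋃ i ∈ s, A i) := by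
  classical
  induction s using Finset.induction_on generalizing A with
  | empty => simpa using isExtensor_of_convex convex_empty isClosed_empty
  | insert i s hi ih =>
    have h1 : ∀ k ∈ s, k ∈ insert i s := fun k hk => Finset.mem_insert_of_mem hk
    have hi' := Finset.mem_insert_self i s
    rw [Finset.set_biUnion_insert]
    refine IsExtensor.union (isExtensor_of_convex (hA i hi') (hc i hi'))
      (ih A (fun k hk => hA k (h1 k hk)) fun k hk => hc k (h1 k hk)) ?_ (hc i hi')
      (s.finite_toSet.isClosed_biUnion fun k hk => hc k (h1 k hk))
    rw [inter_iUnion₂]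
    exact ih (fun k => A i ∩ A k) (fun k hk => (hA i hi').inter (hA k (h1 k hk)))
      fun k hk => (hc i hi').inter (hc k (h1 k hk))

/-- A finite union of closed convex sets is a retract of a neighborhood. -/
theorem exists_neighborhood_retraction {ι : Type*} (s : Finset ι) (A : ι → Set Plane)
    (hA : ∀ i ∈ s, Convex ℝ (A i)) (hc : ∀ i ∈ s, IsClosed (A i)) :
    ∃ (V : Set Plane) (r : Plane → Plane), IsOpen V ∧ (⋃ i ∈ s, A i) ⊆ V ∧ ContinuousOn r V ∧
      MapsTo r V (⋃ i ∈ s, A i) ∧ EqOn r id (⋃ i ∈ s, A i) :=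
  isExtensor_biUnion s A hA hc _ id (s.finite_toSet.isClosed_biUnion hc) continuousOn_id
    (mapsTo_id _)

/-! ### Circle-valued maps on the complement of one point in each hole -/

theorem isCoveringMap_circle : IsCoveringMap ((↑) : ℝ → UnitAddCircle) :=
  AddCircle.isCoveringMap_coe 1

/-- A real function with constant value modulo `1` on a connected set is constant there. -/
theorem eq_of_coe_eq {A : Type*} [TopologicalSpace A] {s : Set A} (hs : IsPreconnected s)
    {μ : A → ℝ} (hμ : ContinuousOn μ s) (c : UnitAddCircle)
    (h : ∀ x ∈ s, (μ x : UnitAddCircle) = c) {x y : A} (hx : x ∈ s) (hy : y ∈ s) : μ x = μ y :=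
  isCoveringMap_circle.constOn_of_comp hs hμ
    (fun a ha a' ha' => (h a ha).trans (h a' ha').symm) hx hy

theorem exists_real_lift_of_contractible {A : Type*} [TopologicalSpace A] [ContractibleSpace A]
    [LocallyPathConnectedSpace A] {f : A → UnitAddCircle} (hf : Continuous f) :
    ∃ μ : A → ℝ, Continuous μ ∧ ∀ x, (μ x : UnitAddCircle) = f x := by
  obtain ⟨a⟩ : Nonempty A := inferInstance
  obtain ⟨t, ht⟩ := QuotientAddGroup.mk_surjective (f a)
  obtain ⟨μ, ⟨-, hμ⟩, -⟩ := isCoveringMap_circle.existsUnique_continuousMap_lifts ⟨f, hf⟩ a t ht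
  exact ⟨μ, μ.continuous, congrFun hμ⟩

/-- Polar coordinates around `z`, in logarithmic form. -/
def expAt (z : Plane) (w : ℂ) : Plane := z + Complex.orthonormalBasisOneI.repr (Complex.exp w)

theorem continuous_expAt (z : Plane) : Continuous (expAt z) := by
  unfold expAt; fun_prop

theorem isOpenMap_expAt (z : Plane) : IsOpenMap (expAt z) :=
  (Homeomorph.addLeft z).isOpenMap.comp
    (Complex.orthonormalBasisOneI.repr.toHomeomorph.isOpenMap.comp Complex.isOpenMap_exp)

theorem expAt_ne (z : Plane) (w : ℂ) : expAt z w ≠ z := by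
  simp [expAt, Complex.exp_ne_zero]

theorem exists_expAt_eq {z x : Plane} (h : x ≠ z) : ∃ w, expAt z w = x := by
  refine ⟨Complex.log (Complex.orthonormalBasisOneI.repr.symm (x - z)), ?_⟩
  rw [expAt, Complex.exp_log]
  · rw [LinearIsometryEquiv.apply_symm_apply, add_sub_cancel]
  · rw [ne_eq, LinearIsometryEquiv.map_eq_zero_iff, sub_eq_zero]
    exact h

theorem expAt_eq_iff {z : Plane} {w w' : ℂ} :
    expAt z w = expAt z w' ↔ ∃ n : ℤ, w = w' + n * (2 * Real.pi * Complex.I) := by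
  simp only [expAt, add_right_inj, EmbeddingLike.apply_eq_iff_eq, Complex.exp_eq_exp_iff_exists_int]

theorem dist_expAt (z : Plane) (w : ℂ) : dist (expAt z w) z = Real.exp w.re := by
  simp [expAt, dist_eq_norm, Complex.norm_exp]

/-- A circle-valued map on the plane without one point that vanishes near infinity lifts to a
real-valued one: large circles, hence all circles around the point, have degree zero. -/
theorem exists_real_lift_of_punctured {z : Plane} {f : Plane → UnitAddCircle}
    (hf : ContinuousOn f {z}ᶜ) {R : ℝ} (hR : ∀ x, R < dist x z → f x = 0) :
    ∃ μ : Plane → ℝ, ContinuousOn μ {z}ᶜ ∧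
      ∀ x ∈ ({z}ᶜ : Set Plane), (μ x : UnitAddCircle) = f x := by
  obtain ⟨μ, hμ, hμf⟩ := exists_real_lift_of_contractible
    (hf.comp_continuous (continuous_expAt z) fun w => expAt_ne z w)
  have hper : ∀ w, μ (w + 2 * Real.pi * Complex.I) = μ w := by
    set H : Set ℂ := {w | Real.log (max R 1) < w.re}
    have hH : IsPreconnected H := (convex_halfSpace_re_gt _).isPreconnected
    have h0 : ∀ w ∈ H, (μ w : UnitAddCircle) = 0 := fun w hw => by
      rw [hμf]
      refine hR _ ?_
      rw [dist_expAt]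
      have := (Real.log_lt_iff_lt_exp (by positivity)).1 hw
      exact (le_max_left _ _).trans_lt this
    set w₀ : ℂ := ((Real.log (max R 1) + 1 : ℝ) : ℂ)
    have hw₀ : w₀ ∈ H := by simp [H, w₀]
    have hw₁ : w₀ + 2 * Real.pi * Complex.I ∈ H := by simp [H, w₀]
    have := isCoveringMap_circle.eq_of_comp_eq (g₁ := fun w => μ (w + 2 * Real.pi * Complex.I))
      (g₂ := μ) (by fun_prop) hμ (by
        ext w
        simp only [Function.comp_apply, hμf]
        congr 1
        exact expAt_eq_iff.2 ⟨1, by simp⟩) w₀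
      (eq_of_coe_eq hH hμ.continuousOn 0 h0 hw₁ hw₀)
    exact congrFun this
  have hper' : ∀ (n : ℤ) w, μ (w + n * (2 * Real.pi * Complex.I)) = μ w := by
    intro n w
    induction n using Int.induction_on with
    | zero => simp
    | succ n ih =>
      rw [← ih, ← hper (w + ((n : ℕ) : ℤ) * (2 * Real.pi * Complex.I))]; congr 1; push_cast; ring
    | pred n ih =>
      rw [← ih, ← hper]; congr 1; push_cast; ring
  choose! l hl using fun (x : Plane) (h : x ∈ ({z}ᶜ : Set Plane)) => exists_expAt_eq h
  have hlw : ∀ w, μ (l (expAt z w)) = μ w := fun w => by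
    obtain ⟨n, hn⟩ := expAt_eq_iff.1 (hl (expAt z w) (expAt_ne z w))
    rw [hn, hper']
  refine ⟨fun x => μ (l x), ?_, fun x hx => ?_⟩
  · rw [continuousOn_open_iff isOpen_compl_singleton]
    intro t ht
    convert isOpenMap_expAt z _ (ht.preimage hμ) using 1
    ext x
    constructor
    · rintro ⟨hx, hxt⟩
      exact ⟨l x, hxt, hl x hx⟩
    · rintro ⟨w, hw, rfl⟩
      exact ⟨expAt_ne z w, by simpa only [mem_preimage, hlw] using hw⟩
  · rw [hμf, Function.comp_apply, hl x hx]

/-- A compact connected set `K` in the plane together with the bounded components `U j` of its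
complement and a point `z j` in each of them. -/
structure Holes {ι : Type*} (K : Set Plane) (U : ι → Set Plane) (z : ι → Plane) : Prop where
  isCompact : IsCompact K
  isConnected : IsConnected K
  isOpen : ∀ j, IsOpen (U j)
  isPreconnected : ∀ j, IsPreconnected (U j)
  mem : ∀ j, z j ∈ U j
  isBounded : ∀ j, Bornology.IsBounded (U j)
  disjoint : ∀ j k, j ≠ k → Disjoint (U j) (U k)
  disjoint_left : ∀ j, Disjoint K (U j)
  frontier_subset : ∀ j, frontier (U j) ⊆ K
  isPreconnected_outer : IsPreconnected (K ∪ ⋃ j, U j)ᶜ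

namespace Holes

variable {ι : Type*} {K : Set Plane} {U : ι → Set Plane} {z : ι → Plane}

theorem subset_punctured (h : Holes K U z) : K ⊆ punctured z := by
  rintro x hx ⟨j, rfl⟩
  exact (h.disjoint_left j).le_bot ⟨hx, h.mem j⟩

theorem eq_of_mem (h : Holes K U z) {j k : ι} {x : Plane} (hj : x ∈ U j) (hk : x ∈ U k) :
    j = k := by
  by_contra hne
  exact (h.disjoint j k hne).le_bot ⟨hj, hk⟩

theorem closure_subset (h : Holes K U z) (j : ι) : closure (U j) ⊆ K ∪ U j := by
  rw [closure_eq_self_union_frontier]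
  exact union_subset subset_union_right ((h.frontier_subset j).trans subset_union_left)

theorem eq_of_mem_closure (h : Holes K U z) {j k : ι} {x : Plane} (hj : x ∈ U j)
    (hk : x ∈ closure (U k)) : j = k := by
  rcases h.closure_subset k hk with hx | hx
  · exact absurd hj (Set.disjoint_left.1 (h.disjoint_left j) hx)
  · exact h.eq_of_mem hj hx

theorem isClosed_inner [Finite ι] (h : Holes K U z) : IsClosed (K ∪ ⋃ j, U j) := by
  have : K ∪ ⋃ j, U j = K ∪ ⋃ j, closure (U j) := by
    refine subset_antisymm (union_subset_union_right _ (iUnion_mono fun j => subset_closure))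
      (union_subset subset_union_left (iUnion_subset fun j => (h.closure_subset j).trans
        (union_subset_union_right _ (subset_iUnion U j))))
  rw [this]
  exact h.isCompact.isClosed.union (isClosed_iUnion_of_finite fun j => isClosed_closure)

theorem frontier_outer [Finite ι] (h : Holes K U z) : frontier (K ∪ ⋃ j, U j)ᶜ ⊆ K := by
  rw [frontier_compl]
  rintro x ⟨hx, hx'⟩
  rw [h.isClosed_inner.closure_eq] at hx
  rcases hx with hx | hx
  · exact hx
  · exact absurd (interior_mono subset_union_right
      ((isOpen_iUnion h.isOpen).interior_eq.symm ▸ hx)) hx'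

theorem continuousOn_indicator {T : Type*} [TopologicalSpace T] [Zero T] {D V : Set Plane}
    {f : Plane → T} (hf : ContinuousOn f (D ∩ closure V)) (h0 : ∀ x ∈ D ∩ frontier V, f x = 0) :
    ContinuousOn (V.indicator f) D := by
  classical
  rw [← piecewise_eq_indicator]
  exact ContinuousOn.piecewise (fun x hx => h0 x hx) hf continuousOn_const

/-- A circle-valued map on the complement of the points `z j` that vanishes on `K` lifts to a
real-valued one: it is the sum of its parts in the components of the complement of `K`, each of
which extends by zero to the plane without at most one point. -/
theorem exists_real_lift [Finite ι] (h : Holes K U z) {f : Plane → UnitAddCircle}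
    (hf : ContinuousOn f (punctured z)) (hK : ∀ x ∈ K, f x = 0) :
    ∃ μ : Plane → ℝ, ContinuousOn μ (punctured z) ∧
      ∀ x ∈ punctured z, (μ x : UnitAddCircle) = f x := by
  classical
  have := Fintype.ofFinite ι
  obtain ⟨a, ha⟩ := h.isConnected.nonempty
  -- the real function that lifts the part of `f` in `V`, normalised to vanish on `K`
  have part : ∀ (V D : Set Plane), frontier V ⊆ K → K ⊆ D → K ∩ V ⊆ ∅ → punctured z ⊆ D →
      (∃ μ : Plane → ℝ, ContinuousOn μ D ∧ ∀ x ∈ D, (μ x : UnitAddCircle) = V.indicator f x) →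
      ∃ μ : Plane → ℝ, ContinuousOn μ (punctured z) ∧ (∀ x ∉ V, μ x = 0) ∧
        ∀ x ∈ V ∩ punctured z, (μ x : UnitAddCircle) = f x := by
    rintro V D hV hKD hKV hD ⟨μ, hμ, hμf⟩
    have h0 : ∀ x ∈ K, (μ x : UnitAddCircle) = 0 := fun x hx => by
      rw [hμf x (hKD hx), indicator_of_notMem fun hxV => hKV ⟨hx, hxV⟩]
    have hconst : ∀ x ∈ K, μ x = μ a := fun x hx =>
      eq_of_coe_eq h.isConnected.isPreconnected (hμ.mono hKD) 0 h0 hx ha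
    refine ⟨V.indicator fun x => μ x - μ a, continuousOn_indicator
      ((hμ.sub continuousOn_const).mono (inter_subset_left.trans hD)) fun x hx => ?_,
      fun x hx => indicator_of_notMem hx _, fun x hx => ?_⟩
    · rw [hconst x (hV hx.2), sub_self]
    · rw [indicator_of_mem hx.1, AddCircle.coe_sub, h0 a ha, sub_zero, hμf x (hD hx.2),
        indicator_of_mem hx.1]
  have inner : ∀ j, ∃ μ : Plane → ℝ, ContinuousOn μ (punctured z) ∧ (∀ x ∉ U j, μ x = 0) ∧
      ∀ x ∈ U j ∩ punctured z, (μ x : UnitAddCircle) = f x := by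
    intro j
    have hKj : K ⊆ {z j}ᶜ := fun x hx hxz => h.subset_punctured hx ⟨j, hxz.symm⟩
    refine part (U j) {z j}ᶜ (h.frontier_subset j) hKj
      (fun x hx => (h.disjoint_left j).le_bot hx) (fun x hx hxz => hx ⟨j, hxz.symm⟩) ?_
    obtain ⟨R, hR⟩ := (h.isBounded j).subset_closedBall (z j)
    refine exists_real_lift_of_punctured (R := R) (continuousOn_indicator (hf.mono ?_) ?_) ?_
    · rintro x ⟨hx, hxj⟩ ⟨k, rfl⟩
      obtain rfl := h.eq_of_mem_closure (h.mem k) hxj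
      exact hx rfl
    · exact fun x hx => hK x (h.frontier_subset j hx.2)
    · exact fun x hx => indicator_of_notMem (fun hxU => absurd (hR hxU) (by simpa using hx)) _
  choose μ hμ hμ0 hμf using inner
  set V := (K ∪ ⋃ j, U j)ᶜ with hV
  obtain ⟨ν, hν, hν0, hνf⟩ := part V univ h.frontier_outer (subset_univ _)
    (fun x hx => hx.2 (Or.inl hx.1)) (subset_univ _) (by
      have hVz : univ ∩ closure V ⊆ punctured z := by
        rintro x ⟨-, hx⟩ ⟨j, rfl⟩
        have hj : z j ∈ interior (K ∪ ⋃ j, U j) :=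
          interior_maximal ((subset_iUnion U j).trans subset_union_right) (h.isOpen j) (h.mem j)
        rw [hV, closure_compl] at hx
        exact hx hj
      obtain ⟨μ, hμ, hμf⟩ := exists_real_lift_of_contractible (A := Plane)
        (f := V.indicator f) (continuousOn_univ.1 (continuousOn_indicator (hf.mono hVz)
          fun x hx => hK x (h.frontier_outer hx.2)))
      exact ⟨μ, hμ.continuousOn, fun x _ => hμf x⟩)
  refine ⟨fun x => ν x + ∑ j, μ j x, hν.add (continuousOn_finsetSum _ fun j _ => hμ j),
    fun x hx => ?_⟩
  by_cases hxV : x ∈ V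
  · have : ∀ j, μ j x = 0 := fun j => hμ0 j x fun hj =>
      hxV (Or.inr (mem_iUnion_of_mem j hj))
    simp only [this, Finset.sum_const_zero, add_zero]
    exact hνf x ⟨hxV, hx⟩
  · simp only [hν0 x hxV, zero_add]
    rcases not_not.1 hxV with hxK | hxU
    · have : ∀ j, μ j x = 0 := fun j => hμ0 j x fun hj =>
        (h.disjoint_left j).le_bot ⟨hxK, hj⟩
      simp [this, hK x hxK]
    · obtain ⟨j, hj⟩ := mem_iUnion.1 hxU
      rw [Finset.sum_eq_single j (fun k _ hk => hμ0 k x fun hk' => hk (h.eq_of_mem hk' hj))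
        (fun hj' => absurd (Finset.mem_univ j) hj')]
      exact hμf j x ⟨hj, hx⟩

end Holes

/-! ### Retractions along which paths are homotopic -/

/-- `B` can be retracted onto `A` in such a way that every path in `B` with endpoints in `A` is
homotopic in `Y`, relative to its endpoints, to its image. -/
def Deforms (Y A B : Set Plane) : Prop :=
  A ⊆ B ∧ B ⊆ Y ∧ ∃ r : Plane → Plane, ContinuousOn r B ∧ MapsTo r B A ∧ EqOn r id A ∧
    ∀ γ γ' : C(I, Y), (∀ t, (γ t : Plane) ∈ B) → (γ 0 : Plane) ∈ A → (γ 1 : Plane) ∈ A →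
      (∀ t, (γ' t : Plane) = r (γ t)) → γ.HomotopicRel γ' {0, 1}

theorem Deforms.refl {Y A : Set Plane} (h : A ⊆ Y) : Deforms Y A A := by
  refine ⟨le_rfl, h, id, continuousOn_id, mapsTo_id _, fun _ _ => rfl, fun γ γ' _ _ _ h => ?_⟩
  obtain rfl : γ = γ' := by ext1 t; exact Subtype.ext (h t).symm
  exact ContinuousMap.HomotopicRel.refl _

theorem Deforms.trans {Y A B C : Set Plane} (h₁ : Deforms Y A B) (h₂ : Deforms Y B C) :
    Deforms Y A C := by
  obtain ⟨hAB, hBY, r, hr, hrA, hrid, hrγ⟩ := h₁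
  obtain ⟨hBC, hCY, s, hs, hsB, hsid, hsγ⟩ := h₂
  refine ⟨hAB.trans hBC, hCY, r ∘ s, hr.comp hs hsB, hrA.comp hsB, fun x hx => ?_,
    fun γ γ' hγ h0 h1 hγ' => ?_⟩
  · simp only [Function.comp_apply, hsid (hAB hx), id, hrid hx]
  · have hc : Continuous fun t => s (γ t) :=
      hs.comp_continuous (continuous_subtype_val.comp γ.continuous) hγ
    let δ : C(I, Y) := ⟨fun t => ⟨s (γ t), hBY (hsB (hγ t))⟩, hc.subtype_mk _⟩
    have e0 : s (γ 0) = γ 0 := hsid (hAB h0)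
    have e1 : s (γ 1) = γ 1 := hsid (hAB h1)
    exact (hsγ γ δ hγ (hAB h0) (hAB h1) fun _ => rfl).trans
      (hrγ δ γ' (fun t => hsB (hγ t)) (show s (γ 0) ∈ A by rw [e0]; exact h0)
        (show s (γ 1) ∈ A by rw [e1]; exact h1) hγ')

/-- Retractions that move points along segments in `Y`. -/
theorem Deforms.of_segment {Y A B : Set Plane} (hAB : A ⊆ B) (r : Plane → Plane)
    (hr : ContinuousOn r B) (hrA : MapsTo r B A) (hrid : EqOn r id A)
    (hseg : ∀ x ∈ B, segment ℝ x (r x) ⊆ Y) : Deforms Y A B := by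
  refine ⟨hAB, fun x hx => hseg x hx (left_mem_segment ℝ _ _), r, hr, hrA, hrid,
    fun γ γ' hγ h0 h1 hγ' => ?_⟩
  have hmem : ∀ p : I × I,
      (1 - (p.1 : ℝ)) • (γ p.2 : Plane) + (p.1 : ℝ) • (γ' p.2 : Plane) ∈ Y := fun p => by
    rw [hγ']
    exact hseg _ (hγ _) ⟨_, _, by linarith [p.1.2.2], p.1.2.1, by ring, rfl⟩
  refine ⟨⟨⟨⟨fun p => ⟨_, hmem p⟩, Continuous.subtype_mk (by fun_prop) _⟩, fun t => ?_,
    fun t => ?_⟩, ?_⟩⟩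
  · ext1; simp
  · ext1; simp
  · intro t x hx
    have : (γ' x : Plane) = γ x := by
      rw [hγ']
      rcases hx with rfl | rfl
      · exact hrid h0
      · exact hrid h1
    ext1
    simp [this, ← add_smul]

/-- A retraction of one closed piece `D` of `A ∪ D`, extended by the identity. -/
theorem Deforms.glue {Y A B D : Set Plane} {A' D' : Set Plane} (hA : A = B ∩ A')
    (hA' : IsClosed A') (hD : D = B ∩ D') (hD' : IsClosed D') (hB : B ⊆ A ∪ D) (hBY : B ⊆ Y)
    (r : Plane → Plane) (hr : ContinuousOn r D) (hrA : MapsTo r D A) (hrid : ∀ x ∈ A ∩ D, r x = x)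
    (hseg : ∀ x ∈ D, segment ℝ x (r x) ⊆ Y) : Deforms Y A B := by
  classical
  have hid : ∀ x ∈ A, D.piecewise r id x = x := fun x hx => by
    by_cases h : x ∈ D
    · rw [piecewise_eq_of_mem _ _ _ h, hrid x ⟨hx, h⟩]
    · rw [piecewise_eq_of_notMem _ _ _ h, id]
  have hAB : A ⊆ B := hA ▸ inter_subset_left
  refine Deforms.of_segment hAB (D.piecewise r id) ?_ ?_ hid ?_
  · have h1 : ContinuousOn (D.piecewise r id) (B ∩ A') := by
      rw [← hA]; exact continuousOn_id.congr hid
    have h2 : ContinuousOn (D.piecewise r id) (B ∩ D') := by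
      rw [← hD]; exact hr.congr (piecewise_eqOn D r id)
    have hu : B = B ∩ A' ∪ B ∩ D' := by
      rw [← hA, ← hD]
      exact subset_antisymm hB (union_subset hAB (hD ▸ inter_subset_left))
    intro x hx
    rw [hu]
    refine ContinuousWithinAt.union ?_ ?_
    · by_cases h : x ∈ A'
      · exact h1 x ⟨hx, h⟩
      · exact continuousWithinAt_of_notMem_closure fun hcl =>
          h (hA'.closure_subset_iff.2 inter_subset_right hcl)
    · by_cases h : x ∈ D'
      · exact h2 x ⟨hx, h⟩
      · exact continuousWithinAt_of_notMem_closure fun hcl =>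
          h (hD'.closure_subset_iff.2 inter_subset_right hcl)
  · intro x hx
    by_cases h : x ∈ D
    · rw [piecewise_eq_of_mem _ _ _ h]; exact hrA h
    · rw [piecewise_eq_of_notMem _ _ _ h]; exact (hB hx).resolve_right h
  · intro x hx
    by_cases h : x ∈ D
    · rw [piecewise_eq_of_mem _ _ _ h]; exact hseg x h
    · rw [piecewise_eq_of_notMem _ _ _ h, id, segment_same]
      exact singleton_subset_iff.2 (hBY hx)

/-! ### Square grids -/

/-- The grid coordinate of a point: multiples of the mesh `δ` with origin `α` become integers. -/
def gridCoord (α δ : ℝ) (i : Fin 2) (x : Plane) : ℝ := (x i - α) / δ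

/-- Cells of the square grid. An even entry `2 * k` stands for the coordinate `k`, an odd entry
`2 * k + 1` for the interval from `k` to `k + 1`. -/
abbrev Cell : Type := Fin 2 → ℤ

/-- The open cell that contains `x`. -/
def cellOf (α δ : ℝ) (x : Plane) : Cell := fun i => ⌊gridCoord α δ i x⌋ + ⌈gridCoord α δ i x⌉

/-- The closed cell with index `n`. -/
def cell (α δ : ℝ) (n : Cell) : Set Plane :=
  {x | ∀ i, ((n i / 2 : ℤ) : ℝ) ≤ gridCoord α δ i x ∧ gridCoord α δ i x ≤ ((n i + 1) / 2 : ℤ)}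

/-- `m` is a face of `n`. -/
def IsFace (m n : Cell) : Prop := ∀ i, m i = n i ∨ (n i % 2 = 1 ∧ (m i = n i - 1 ∨ m i = n i + 1))

/-- The cell is two-dimensional. -/
def IsSquare2 (n : Cell) : Prop := ∀ i, n i % 2 = 1

theorem IsFace.refl (n : Cell) : IsFace n n := fun _ => Or.inl rfl

theorem IsFace.trans {l m n : Cell} (h : IsFace l m) (h' : IsFace m n) : IsFace l n := fun i => by
  have := h i; have := h' i; omega

theorem IsSquare2.eq_of_isFace {m n : Cell} (hm : IsSquare2 m) (h : IsFace m n) : m = n := by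
  funext i; have := h i; have := hm i; omega

section Grid

variable {α δ : ℝ}

theorem continuous_gridCoord (i : Fin 2) : Continuous (gridCoord α δ i) := by
  unfold gridCoord; fun_prop

theorem mem_cell_iff {n : Cell} {x : Plane} : x ∈ cell α δ n ↔ IsFace (cellOf α δ x) n := by
  refine forall_congr' fun i => ?_
  rw [← Int.le_floor, ← Int.ceil_le]
  simp only [cellOf]
  have h1 := Int.floor_le_ceil (gridCoord α δ i x)
  have h2 := Int.ceil_le_floor_add_one (gridCoord α δ i x)
  omega

theorem mem_cell_cellOf (x : Plane) : x ∈ cell α δ (cellOf α δ x) := mem_cell_iff.2 (IsFace.refl _)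

theorem cell_mono {m n : Cell} (h : IsFace m n) : cell α δ m ⊆ cell α δ n := fun _ hx =>
  mem_cell_iff.2 ((mem_cell_iff.1 hx).trans h)

theorem cell_eq (n : Cell) : cell α δ n =
    ⋂ i, gridCoord α δ i ⁻¹' Icc ((n i / 2 : ℤ) : ℝ) (((n i + 1) / 2 : ℤ) : ℝ) := by
  ext x; simp [cell]

theorem isClosed_cell (n : Cell) : IsClosed (cell α δ n) := by
  rw [cell_eq]
  exact isClosed_iInter fun i => isClosed_Icc.preimage (continuous_gridCoord i)

theorem gridCoord_combo (i : Fin 2) (x y : Plane) {a b : ℝ} (hab : a + b = 1) :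
    gridCoord α δ i (a • x + b • y) = a * gridCoord α δ i x + b * gridCoord α δ i y := by
  simp only [gridCoord, PiLp.add_apply, PiLp.smul_apply, smul_eq_mul]
  obtain rfl : b = 1 - a := by linarith
  ring

theorem convex_cell (n : Cell) : Convex ℝ (cell α δ n) := by
  rw [cell_eq]
  refine convex_iInter fun i x hx y hy a b ha hb hab => ?_
  rw [mem_preimage, gridCoord_combo i x y hab]
  exact convex_Icc _ _ hx hy ha hb hab

theorem cellOf_eq_two_mul_iff {x : Plane} {i : Fin 2} {k : ℤ} :
    cellOf α δ x i = 2 * k ↔ gridCoord α δ i x = k := by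
  simp only [cellOf]
  have h1 := Int.floor_le_ceil (gridCoord α δ i x)
  have h2 := Int.ceil_le_floor_add_one (gridCoord α δ i x)
  constructor
  · intro h
    have hf : k ≤ ⌊gridCoord α δ i x⌋ := by omega
    have hc : ⌈gridCoord α δ i x⌉ ≤ k := by omega
    exact le_antisymm (Int.ceil_le.1 hc) (Int.le_floor.1 hf)
  · intro h
    rw [h, Int.floor_intCast, Int.ceil_intCast]; ring

/-- The point with given grid coordinates. -/
def gridPoint (α δ : ℝ) (s : Fin 2 → ℝ) : Plane := !₂[α + δ * s 0, α + δ * s 1]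

theorem gridCoord_gridPoint (hδ : δ ≠ 0) (s : Fin 2 → ℝ) (i : Fin 2) :
    gridCoord α δ i (gridPoint α δ s) = s i := by
  fin_cases i <;> simp [gridCoord, gridPoint] <;> field_simp

theorem continuous_gridPoint {A : Type*} [TopologicalSpace A] {s : A → Fin 2 → ℝ}
    (hs : ∀ i, Continuous fun a => s a i) : Continuous fun a => gridPoint α δ (s a) := by
  have h0 := hs 0
  have h1 := hs 1
  unfold gridPoint
  refine (PiLp.continuous_toLp 2 _).comp (continuous_pi fun i => ?_)
  fin_cases i
  · simpa using by fun_prop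
  · simpa using by fun_prop

theorem eq_of_gridCoord (hδ : δ ≠ 0) {x y : Plane}
    (h : ∀ i, gridCoord α δ i x = gridCoord α δ i y) : x = y := by
  ext i
  have := h i
  simp only [gridCoord] at this
  field_simp at this
  linarith

/-- The set of points in the open cells from `C`. -/
def carrier (α δ : ℝ) (C : Finset Cell) : Set Plane := {x | cellOf α δ x ∈ C}

/-- `C` is a subcomplex of the grid. -/
def IsComplex (C : Finset Cell) : Prop := ∀ n ∈ C, ∀ m, IsFace m n → m ∈ C

theorem carrier_mono {C C' : Finset Cell} (h : C ⊆ C') : carrier α δ C ⊆ carrier α δ C' :=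
  fun _ hx => h hx

theorem IsComplex.carrier_eq {C : Finset Cell} (hC : IsComplex C) :
    carrier α δ C = ⋃ n ∈ C, cell α δ n := by
  ext x
  simp only [carrier, mem_ofPred_eq, mem_iUnion, mem_cell_iff, exists_prop]
  exact ⟨fun h => ⟨_, h, IsFace.refl _⟩, fun ⟨n, hn, h⟩ => hC n hn _ h⟩

theorem IsComplex.isClosed_carrier {C : Finset Cell} (hC : IsComplex C) :
    IsClosed (carrier α δ C) := by
  rw [hC.carrier_eq]
  exact C.finite_toSet.isClosed_biUnion fun n _ => isClosed_cell n

theorem IsComplex.cell_subset {C : Finset Cell} (hC : IsComplex C) {n : Cell} (hn : n ∈ C) :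
    cell α δ n ⊆ carrier α δ C := fun _ hx => hC n hn _ (mem_cell_iff.1 hx)

/-! ### Central projections of squares -/

/-- The four affine functions that are nonnegative on a square: its distances to the sides. -/
def wall (α δ : ℝ) (n : Cell) (k : Fin 2 × Bool) (x : Plane) : ℝ :=
  if k.2 then ((n k.1 + 1) / 2 : ℤ) - gridCoord α δ k.1 x
  else gridCoord α δ k.1 x - (n k.1 / 2 : ℤ)

theorem continuous_wall (n : Cell) (k : Fin 2 × Bool) : Continuous (wall α δ n k) := by
  unfold wall
  have := continuous_gridCoord (α := α) (δ := δ) k.1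
  split_ifs <;> fun_prop

theorem wall_combo (n : Cell) (k : Fin 2 × Bool) (x y : Plane) {a b : ℝ} (hab : a + b = 1) :
    wall α δ n k (a • x + b • y) = a * wall α δ n k x + b * wall α δ n k y := by
  unfold wall
  rw [gridCoord_combo _ _ _ hab]
  obtain rfl : b = 1 - a := by linarith
  split_ifs <;> ring

theorem mem_cell_iff_wall {n : Cell} {x : Plane} :
    x ∈ cell α δ n ↔ ∀ k, 0 ≤ wall α δ n k x := by
  simp only [cell, mem_ofPred_eq, Prod.forall, Bool.forall_bool, wall, Bool.false_eq_true,
    if_false, if_true, sub_nonneg]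

/-- Central projection from `q` of a convex set cut out by affine inequalities `0 ≤ ℓ k` onto the
walls that belong to `S`, the walls on whose inner side `q` lies. -/
theorem exists_projection {κ : Type*} (ℓ : κ → Plane → ℝ) (hℓ : ∀ k, Continuous (ℓ k))
    (hcombo : ∀ k x y (a b : ℝ), a + b = 1 → ℓ k (a • x + b • y) = a * ℓ k x + b * ℓ k y)
    (q : Plane) (S : Finset κ) (hS : S.Nonempty) (hq : ∀ k ∈ S, 0 < ℓ k q)
    (hq' : ∀ k ∉ S, ℓ k q ≤ 0) (D : Set Plane) (hD : ∀ x ∈ D, ∀ k, 0 ≤ ℓ k x)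
    (hDq : ∀ x ∈ D, ∃ k ∈ S, ℓ k x < ℓ k q) :
    ∃ r : Plane → Plane, ContinuousOn r D ∧ ∀ x ∈ D, (∀ k, 0 ≤ ℓ k (r x)) ∧
      (∃ k ∈ S, ℓ k (r x) = 0) ∧ ((∃ k ∈ S, ℓ k x = 0) → r x = x) ∧
      ∃ c : ℝ, 1 ≤ c ∧ r x = (1 - c) • q + c • x := by
  set ν : Plane → ℝ := fun x => S.sup' hS fun k => 1 - ℓ k x / ℓ k q with hν
  have hνc : Continuous ν :=
    Continuous.finset_sup'_apply hS fun k _ => continuous_const.sub ((hℓ k).div_const _)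
  have hνpos : ∀ x ∈ D, 0 < ν x := fun x hx => by
    obtain ⟨k, hk, hlt⟩ := hDq x hx
    refine lt_of_lt_of_le ?_ (Finset.le_sup' (fun k => 1 - ℓ k x / ℓ k q) hk)
    rw [sub_pos, div_lt_one (hq k hk)]; exact hlt
  have hνle : ∀ x ∈ D, ν x ≤ 1 := fun x hx =>
    Finset.sup'_le _ _ fun k hk => sub_le_self _ (div_nonneg (hD x hx k) (hq k hk).le)
  have hform : ∀ k x, ℓ k ((1 - (ν x)⁻¹) • q + (ν x)⁻¹ • x) =
      (1 - (ν x)⁻¹) * ℓ k q + (ν x)⁻¹ * ℓ k x := fun k x => hcombo k _ _ _ _ (by ring)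
  refine ⟨fun x => (1 - (ν x)⁻¹) • q + (ν x)⁻¹ • x, ?_, fun x hx => ⟨fun k => ?_, ?_, ?_, ?_⟩⟩
  · have : ContinuousOn (fun x => (ν x)⁻¹) D := hνc.continuousOn.inv₀ fun x hx => (hνpos x hx).ne'
    fun_prop
  · have h0 := hνpos x hx
    have h1 : 1 ≤ (ν x)⁻¹ := (one_le_inv₀ h0).2 (hνle x hx)
    rw [hform]
    by_cases hk : k ∈ S
    · have h2 : 1 - ℓ k x / ℓ k q ≤ ν x := Finset.le_sup' (fun k => 1 - ℓ k x / ℓ k q) hk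
      have h3 := hq k hk
      have h4 : ℓ k q - ℓ k x ≤ ν x * ℓ k q := by
        have : (1 - ℓ k x / ℓ k q) * ℓ k q ≤ ν x * ℓ k q := by gcongr
        rwa [sub_mul, one_mul, div_mul_cancel₀ _ h3.ne'] at this
      have h5 : (1 - (ν x)⁻¹) * ℓ k q + (ν x)⁻¹ * ℓ k x =
          (ν x)⁻¹ * (ν x * ℓ k q - (ℓ k q - ℓ k x)) := by field_simp; ring
      rw [h5]
      exact mul_nonneg (inv_nonneg.2 h0.le) (by linarith)
    · have h3 := hq' k hk
      have h4 := hD x hx k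
      nlinarith
  · have h0 := hνpos x hx
    obtain ⟨k, hk, hk'⟩ := Finset.exists_mem_eq_sup' hS fun k => 1 - ℓ k x / ℓ k q
    refine ⟨k, hk, ?_⟩
    have h2 : ν x = 1 - ℓ k x / ℓ k q := hk'
    have h3 := (hq k hk).ne'
    rw [hform]
    have h5 : (1 - (ν x)⁻¹) * ℓ k q + (ν x)⁻¹ * ℓ k x =
        (ν x)⁻¹ * (ν x * ℓ k q - (ℓ k q - ℓ k x)) := by field_simp; ring
    rw [h5, h2]; field_simp; ring
  · rintro ⟨k, hk, hk0⟩
    have h1 : ν x = 1 := by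
      refine le_antisymm (hνle x hx) ?_
      have := Finset.le_sup' (fun k => 1 - ℓ k x / ℓ k q) hk
      simpa [hk0] using this
    simp [h1]
  · exact ⟨(ν x)⁻¹, (one_le_inv₀ (hνpos x hx)).2 (hνle x hx), rfl⟩

end Grid

/-! ### Elementary collapses in the grid -/

section Collapse

variable {α δ : ℝ}

/-- The direction of the outer normal of a wall. -/
def wallShift (k : Fin 2 × Bool) : ℤ := if k.2 then 1 else -1

theorem wallShift_cases (k : Fin 2 × Bool) : wallShift k = 1 ∨ wallShift k = -1 := by
  unfold wallShift; split_ifs <;> simp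

theorem eq_of_wallShift {k k' : Fin 2 × Bool} (h1 : k.1 = k'.1)
    (h2 : wallShift k = wallShift k') : k = k' := by
  obtain ⟨i, b⟩ := k
  obtain ⟨i', b'⟩ := k'
  cases b <;> cases b' <;> simp_all [wallShift]

theorem wall_eq_zero_iff {n : Cell} {k : Fin 2 × Bool} (hn : n k.1 % 2 = 1) {x : Plane} :
    wall α δ n k x = 0 ↔ cellOf α δ x k.1 = n k.1 + wallShift k := by
  unfold wall wallShift
  split_ifs
  · rw [show n k.1 + 1 = 2 * ((n k.1 + 1) / 2) by omega, cellOf_eq_two_mul_iff, sub_eq_zero]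
    rw [show 2 * ((n k.1 + 1) / 2) / 2 = (n k.1 + 1) / 2 by omega]
    exact eq_comm
  · rw [show n k.1 + -1 = 2 * (n k.1 / 2) by omega, cellOf_eq_two_mul_iff, sub_eq_zero]

theorem wall_add_wall {n : Cell} {i : Fin 2} (hn : n i % 2 = 1) (x : Plane) :
    wall α δ n (i, true) x + wall α δ n (i, false) x = 1 := by
  simp only [wall, if_true, Bool.false_eq_true, if_false]
  have : ((n i + 1) / 2 : ℤ) = n i / 2 + 1 := by omega
  rw [this]; push_cast; ring

theorem exists_wall_eq_zero {n : Cell} (hn : IsSquare2 n) {x : Plane} (hx : x ∈ cell α δ n)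
    {i : Fin 2} (hi : cellOf α δ x i ≠ n i) : ∃ b, wall α δ n (i, b) x = 0 := by
  rcases mem_cell_iff.1 hx i with h | ⟨-, h | h⟩
  · exact absurd h hi
  · exact ⟨false, (wall_eq_zero_iff (hn i)).2 (by simp [wallShift, h]; ring)⟩
  · exact ⟨true, (wall_eq_zero_iff (hn i)).2 (by simp [wallShift, h])⟩

theorem IsComplex.erase_square {C : Finset Cell} (hC : IsComplex C) {n : Cell}
    (hn : IsSquare2 n) : IsComplex (C.erase n) := fun m hm l hl => by
  refine Finset.mem_erase.2 ⟨?_, hC m (Finset.mem_of_mem_erase hm) l hl⟩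
  rintro rfl
  exact (Finset.mem_erase.1 hm).1 (hn.eq_of_isFace hl).symm

/-- A square without one of its interior points retracts onto its boundary. -/
theorem IsComplex.deforms_erase_square (hδ : δ ≠ 0) {C : Finset Cell} (hC : IsComplex C)
    {n : Cell} (hnC : n ∈ C) (hn : IsSquare2 n) {Z : Set Plane}
    (hZ : ∀ y ∈ Z, IsSquare2 (cellOf α δ y)) {z : Plane} (hzZ : z ∈ Z) (hzn : cellOf α δ z = n)
    (huniq : ∀ y ∈ Z, cellOf α δ y = n → y = z) :
    Deforms Zᶜ (carrier α δ (C.erase n) \ Z) (carrier α δ C \ Z) := by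
  have hpos : ∀ k, 0 < wall α δ n k z := fun k => by
    refine (mem_cell_iff_wall.1 (hzn ▸ mem_cell_cellOf z) k).lt_of_ne fun h => ?_
    have := (wall_eq_zero_iff (hn k.1)).1 h.symm
    rw [hzn] at this
    have := wallShift_cases k
    omega
  obtain ⟨r, hr, hr'⟩ := exists_projection (wall α δ n) (continuous_wall n)
    (fun k x y a b hab => wall_combo n k x y hab) z Finset.univ ⟨(0, true), Finset.mem_univ _⟩
    (fun k _ => hpos k) (fun k hk => absurd (Finset.mem_univ k) hk) (cell α δ n \ Z)
    (fun x hx => mem_cell_iff_wall.1 hx.1) (fun x hx => by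
      have hxz : x ≠ z := fun h => hx.2 (h ▸ hzZ)
      obtain ⟨i, hi⟩ : ∃ i, gridCoord α δ i x ≠ gridCoord α δ i z := by
        by_contra! h; exact hxz (eq_of_gridCoord hδ h)
      rcases lt_or_gt_of_ne hi with h | h
      · exact ⟨(i, false), Finset.mem_univ _, by simpa [wall] using h⟩
      · exact ⟨(i, true), Finset.mem_univ _, by simpa [wall] using h⟩)
  refine Deforms.glue (A' := carrier α δ (C.erase n)) (D := cell α δ n \ Z) (D' := cell α δ n)
    ?_ (hC.erase_square hn).isClosed_carrier ?_ (isClosed_cell n) ?_ (fun x hx => hx.2) r hr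
    ?_ ?_ ?_
  · ext x
    exact ⟨fun h => ⟨⟨Finset.mem_of_mem_erase h.1, h.2⟩, h.1⟩, fun h => ⟨h.2, h.1.2⟩⟩
  · ext x
    exact ⟨fun h => ⟨⟨hC.cell_subset hnC h.1, h.2⟩, h.1⟩, fun h => ⟨h.2, h.1.2⟩⟩
  · rintro x ⟨hx, hxZ⟩
    by_cases h : cellOf α δ x = n
    · exact Or.inr ⟨h ▸ mem_cell_cellOf x, hxZ⟩
    · exact Or.inl ⟨Finset.mem_erase.2 ⟨h, hx⟩, hxZ⟩
  · intro x hx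
    obtain ⟨h1, ⟨k, -, hk⟩, -⟩ := hr' x hx
    have hk' := (wall_eq_zero_iff (hn k.1)).1 hk
    have hc := wallShift_cases k
    have hmem := mem_cell_iff.1 (mem_cell_iff_wall.2 h1)
    have hnk := hn k.1
    refine ⟨Finset.mem_erase.2 ⟨fun h => ?_, hC n hnC _ hmem⟩, fun hZ' => ?_⟩
    · rw [h] at hk'; omega
    · have := hZ _ hZ' k.1; omega
  · rintro x ⟨hx, hxD⟩
    obtain ⟨i, hi⟩ : ∃ i, cellOf α δ x i ≠ n i := by
      by_contra! h; exact (Finset.mem_erase.1 hx.1).1 (funext h)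
    obtain ⟨b, hb⟩ := exists_wall_eq_zero hn hxD.1 hi
    exact (hr' x hxD).2.2.1 ⟨_, Finset.mem_univ _, hb⟩
  · rintro x hx y hy hyZ
    obtain ⟨h1, -, -, c, hc, hrx⟩ := hr' x hx
    have hyn : y ∈ cell α δ n := (convex_cell n).segment_subset hx.1 (mem_cell_iff_wall.2 h1) hy
    have hyz : y = z := huniq y hyZ ((hZ y hyZ).eq_of_isFace (mem_cell_iff.1 hyn))
    obtain ⟨a, b, ha, hb, hab, rfl⟩ := hy
    rw [hrx] at hyz
    have h2 : (a + b * c) • (x - z) = 0 := by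
      rw [← sub_eq_zero] at hyz
      rw [← hyz]
      obtain rfl : a = 1 - b := by linarith
      module
    rcases smul_eq_zero.1 h2 with h | h
    · nlinarith
    · exact hx.2 (sub_eq_zero.1 h ▸ hzZ)

/-- The side of the square `n` in the wall `k`. -/
def sideCell (n : Cell) (k : Fin 2 × Bool) : Cell := Function.update n k.1 (n k.1 + wallShift k)

/-- The square on the other side of the wall `k`. -/
def nextCell (n : Cell) (k : Fin 2 × Bool) : Cell :=
  Function.update n k.1 (n k.1 + 2 * wallShift k)

theorem sideCell_isFace {n : Cell} (hn : IsSquare2 n) (k : Fin 2 × Bool) :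
    IsFace (sideCell n k) n := fun i => by
  by_cases h : i = k.1
  · subst h
    have := wallShift_cases k
    have := hn k.1
    simp only [sideCell, Function.update_self]; omega
  · simp [sideCell, h]

theorem nextCell_isSquare2 {n : Cell} (hn : IsSquare2 n) (k : Fin 2 × Bool) :
    IsSquare2 (nextCell n k) := fun i => by
  by_cases h : i = k.1
  · subst h
    have := hn k.1
    simp only [nextCell, Function.update_self]; omega
  · simpa [nextCell, h] using hn i

theorem eq_of_sideCell_isFace {n m : Cell} (hn : IsSquare2 n) (k : Fin 2 × Bool)
    (h : IsFace (sideCell n k) m) : m = sideCell n k ∨ m = n ∨ m = nextCell n k := by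
  have hoff : ∀ i, i ≠ k.1 → m i = n i := fun i hi => by
    have h1 := h i
    have h2 := hn i
    simp only [sideCell, Function.update_of_ne hi] at h1; omega
  have hon := h k.1
  simp only [sideCell, Function.update_self] at hon
  have hc := wallShift_cases k
  have : m k.1 = n k.1 + wallShift k ∨ m k.1 = n k.1 ∨ m k.1 = n k.1 + 2 * wallShift k := by omega
  rcases this with h1 | h1 | h1
  · exact Or.inl (Function.eq_update_iff.2 ⟨h1, hoff⟩)
  · refine Or.inr (Or.inl (funext fun i => ?_))
    by_cases hi : i = k.1
    · rw [hi, h1]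
    · exact hoff i hi
  · exact Or.inr (Or.inr (Function.eq_update_iff.2 ⟨h1, hoff⟩))

theorem IsComplex.erase_pair {C : Finset Cell} (hC : IsComplex C) {n : Cell} (hn : IsSquare2 n)
    {k : Fin 2 × Bool} (hk : nextCell n k ∉ C) : IsComplex ((C.erase n).erase (sideCell n k)) := by
  intro m hm l hl
  obtain ⟨hm1, hm2, hm3⟩ : m ≠ sideCell n k ∧ m ≠ n ∧ m ∈ C := by
    simpa [Finset.mem_erase] using hm
  refine Finset.mem_erase.2 ⟨?_, Finset.mem_erase.2 ⟨?_, hC m hm3 l hl⟩⟩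
  · rintro rfl
    rcases eq_of_sideCell_isFace hn k hl with h | h | h
    · exact hm1 h
    · exact hm2 h
    · exact hk (h ▸ hm3)
  · rintro rfl
    exact hm2 (hn.eq_of_isFace hl).symm

/-- A square with a free side collapses onto its other three sides. -/
theorem IsComplex.deforms_erase_pair (hδ : δ ≠ 0) {C : Finset Cell} (hC : IsComplex C)
    {n : Cell} (hnC : n ∈ C) (hn : IsSquare2 n) {k₀ : Fin 2 × Bool} (hk : nextCell n k₀ ∉ C)
    {Y : Set Plane} (hY : carrier α δ C ⊆ Y) :
    Deforms Y (carrier α δ ((C.erase n).erase (sideCell n k₀))) (carrier α δ C) := by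
  classical
  have hC' := hC.erase_pair hn hk
  -- the centre of the projection is the reflection of the centre of the square in the free side
  set q := gridPoint α δ fun i => (n i : ℝ) / 2 + if i = k₀.1 then (wallShift k₀ : ℝ) else 0 with hq
  have hqc : ∀ i, gridCoord α δ i q = (n i : ℝ) / 2 + if i = k₀.1 then (wallShift k₀ : ℝ) else 0 :=
    fun i => gridCoord_gridPoint hδ _ i
  have hnr : ∀ i, ((n i / 2 : ℤ) : ℝ) = (n i : ℝ) / 2 - 1 / 2 ∧
      (((n i + 1) / 2 : ℤ) : ℝ) = (n i : ℝ) / 2 + 1 / 2 := fun i => by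
    obtain ⟨t, ht⟩ : ∃ t, n i = 2 * t + 1 := ⟨n i / 2, by have := hn i; omega⟩
    have h1 : n i / 2 = t := by omega
    have h2 : (n i + 1) / 2 = t + 1 := by omega
    rw [h1, h2, ht]; push_cast; constructor <;> ring
  have hwall : ∀ k, wall α δ n k q =
      1 / 2 - if k.1 = k₀.1 then (wallShift k₀ : ℝ) * wallShift k else 0 := by
    rintro ⟨i, b⟩
    cases b <;> by_cases h : i = k₀.1 <;> simp [wall, wallShift, hqc, hnr, h] <;> ring
  obtain ⟨r, hr, hr'⟩ := exists_projection (wall α δ n) (continuous_wall n)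
    (fun k x y a b hab => wall_combo n k x y hab) q (Finset.univ.erase k₀)
    ⟨(k₀.1, !k₀.2), by simp [Prod.ext_iff]⟩
    (fun k hk => by
      rw [hwall]
      split_ifs with h
      · have hne : wallShift k ≠ wallShift k₀ := fun h' =>
          (Finset.mem_erase.1 hk).1 (eq_of_wallShift h h')
        rcases wallShift_cases k with h1 | h1 <;> rcases wallShift_cases k₀ with h2 | h2 <;>
          simp_all <;> norm_num
      · norm_num)
    (fun k hk => by
      obtain rfl : k = k₀ := by simpa using hk
      rw [hwall, if_pos rfl]
      rcases wallShift_cases k with h | h <;> rw [h] <;> norm_num) (cell α δ n)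
    (fun x hx => mem_cell_iff_wall.1 hx) (fun x hx => by
      by_contra! hcon
      have hx' := mem_cell_iff_wall.1 hx
      obtain ⟨i, hi⟩ : ∃ i, i ≠ k₀.1 := exists_ne k₀.1
      have hopp : (k₀.1, !k₀.2) ∈ Finset.univ.erase k₀ := by simp [Prod.ext_iff]
      have h1 := hcon _ hopp
      rw [hwall, if_pos rfl] at h1
      have h2 := wall_add_wall (α := α) (δ := δ) (hn k₀.1) x
      have h3 := hx' (k₀.1, true)
      have h4 := hx' (k₀.1, false)
      obtain ⟨i₀, b₀⟩ := k₀
      cases b₀ <;> simp [wallShift] at h1 h2 h3 h4 <;> linarith)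
  refine Deforms.glue (A' := carrier α δ ((C.erase n).erase (sideCell n k₀)))
    (D := cell α δ n) (D' := cell α δ n) ?_ hC'.isClosed_carrier ?_ (isClosed_cell n) ?_ hY
    r hr ?_ ?_ ?_
  · exact (inter_eq_right.2 (carrier_mono ((Finset.erase_subset _ _).trans
      (Finset.erase_subset _ _)))).symm
  · exact (inter_eq_right.2 (hC.cell_subset hnC)).symm
  · intro x hx
    by_cases h : cellOf α δ x ∈ (C.erase n).erase (sideCell n k₀)
    · exact Or.inl h
    · simp only [Finset.mem_erase, not_and_or, not_not] at h
      right
      rw [mem_cell_iff]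
      rcases h with h | h | h
      · rw [h]; exact sideCell_isFace hn k₀
      · rw [h]; exact IsFace.refl n
      · exact absurd hx h
  · intro x hx
    obtain ⟨h1, ⟨k, hkS, hk0⟩, -⟩ := hr' x hx
    have hk' := (wall_eq_zero_iff (hn k.1)).1 hk0
    have hc := wallShift_cases k
    have hmem := mem_cell_iff.1 (mem_cell_iff_wall.2 h1)
    refine Finset.mem_erase.2 ⟨fun h => ?_, Finset.mem_erase.2 ⟨fun h => ?_, hC n hnC _ hmem⟩⟩
    · rw [h] at hk'
      by_cases hi : k.1 = k₀.1
      · rw [hi, sideCell, Function.update_self] at hk'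
        exact (Finset.mem_erase.1 hkS).1 (eq_of_wallShift hi (by omega))
      · rw [sideCell, Function.update_of_ne hi] at hk'; omega
    · rw [h] at hk'; omega
  · rintro x ⟨hx, hxD⟩
    refine (hr' x hxD).2.2.1 ?_
    by_contra! hcon
    have hcon' : ∀ k, k ≠ k₀ → wall α δ n k x ≠ 0 := fun k hk =>
      hcon k (Finset.mem_erase.2 ⟨hk, Finset.mem_univ _⟩)
    obtain ⟨hx1, hx2, -⟩ : cellOf α δ x ≠ sideCell n k₀ ∧ cellOf α δ x ≠ n ∧ _ := by
      simpa [carrier, Finset.mem_erase] using hx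
    have hoff : ∀ i, i ≠ k₀.1 → cellOf α δ x i = n i := fun i hi => by
      by_contra hne
      obtain ⟨b, hb⟩ := exists_wall_eq_zero hn hxD hne
      exact hcon' (i, b) (fun h => hi (congrArg Prod.fst h)) hb
    by_cases hne : cellOf α δ x k₀.1 = n k₀.1
    · refine hx2 (funext fun i => ?_)
      by_cases hi : i = k₀.1
      · rw [hi, hne]
      · exact hoff i hi
    · obtain ⟨b, hb⟩ := exists_wall_eq_zero hn hxD hne
      have : (k₀.1, b) = k₀ := by by_contra h; exact hcon' _ h hb
      rw [this] at hb
      exact hx1 (Function.eq_update_iff.2 ⟨(wall_eq_zero_iff (hn k₀.1)).1 hb, hoff⟩)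
  · exact fun x hx => ((convex_cell n).segment_subset hx
      (mem_cell_iff_wall.2 (hr' x hx).1)).trans ((hC.cell_subset hnC).trans hY)

/-! ### Edges of the grid -/

/-- The end of an edge in the direction given by the sign `s`. -/
def edgeEnd (e : Cell) (i : Fin 2) (s : ℤ) : Cell := Function.update e i (e i + s)

/-- The cell `e` is an edge in the direction of the `i`-th coordinate. -/
def IsEdge (e : Cell) (i : Fin 2) : Prop := e i % 2 = 1 ∧ ∀ j ≠ i, e j % 2 = 0

theorem IsEdge.isFace_iff {e m : Cell} {i : Fin 2} (he : IsEdge e i) :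
    IsFace m e ↔ m = e ∨ m = edgeEnd e i 1 ∨ m = edgeEnd e i (-1) := by
  constructor
  · intro h
    have hoff : ∀ j, j ≠ i → m j = e j := fun j hj => by
      have := h j; have := he.2 j hj; omega
    rcases h i with h | ⟨-, h | h⟩
    · refine Or.inl (funext fun j => ?_)
      by_cases hj : j = i
      · rw [hj, h]
      · exact hoff j hj
    · exact Or.inr (Or.inr (Function.eq_update_iff.2 ⟨h, hoff⟩))
    · exact Or.inr (Or.inl (Function.eq_update_iff.2 ⟨h, hoff⟩))
  · have key : ∀ s : ℤ, s = 1 ∨ s = -1 → IsFace (edgeEnd e i s) e := fun s hs j => by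
      by_cases hj : j = i
      · subst hj
        have := he.1
        simp only [edgeEnd, Function.update_self]; omega
      · simp [edgeEnd, hj]
    rintro (rfl | rfl | rfl)
    · exact IsFace.refl _
    · exact key _ (Or.inl rfl)
    · exact key _ (Or.inr rfl)

theorem edgeEnd_even {e : Cell} {i : Fin 2} (he : IsEdge e i) {s : ℤ} (hs : s = 1 ∨ s = -1)
    (j : Fin 2) : edgeEnd e i s j % 2 = 0 := by
  by_cases hj : j = i
  · subst hj
    have := he.1
    simp only [edgeEnd, Function.update_self]; omega
  · simpa [edgeEnd, hj] using he.2 j hj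

theorem eq_of_mem_vertex (hδ : δ ≠ 0) {w : Cell} (hw : ∀ j, w j % 2 = 0) {x y : Plane}
    (hx : cellOf α δ x = w) (hy : cellOf α δ y = w) : x = y := by
  refine eq_of_gridCoord (α := α) hδ fun i => ?_
  have h : w i = 2 * (w i / 2) := by have := hw i; omega
  rw [cellOf_eq_two_mul_iff.1 ((congrFun hx i).trans h),
    cellOf_eq_two_mul_iff.1 ((congrFun hy i).trans h)]

theorem exists_mem_vertex (hδ : δ ≠ 0) {w : Cell} (hw : ∀ j, w j % 2 = 0) :
    ∃ x, cellOf α δ x = w := by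
  refine ⟨gridPoint α δ fun i => ((w i / 2 : ℤ) : ℝ), funext fun i => ?_⟩
  have h : w i = 2 * (w i / 2) := by have := hw i; omega
  rw [h, cellOf_eq_two_mul_iff, gridCoord_gridPoint hδ]

theorem IsComplex.insert_edge {C : Finset Cell} (hC : IsComplex C) {e : Cell} {i : Fin 2}
    (he : IsEdge e i) {s : ℤ} (hs : s = 1 ∨ s = -1) (hw : edgeEnd e i s ∈ C) :
    IsComplex (insert e (insert (edgeEnd e i (-s)) C)) := by
  intro m hm l hl
  simp only [Finset.mem_insert] at hm ⊢
  rcases hm with rfl | rfl | hm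
  · rw [he.isFace_iff] at hl
    rcases hs with rfl | rfl <;> rcases hl with rfl | rfl | rfl <;> simp_all
  · refine Or.inr (Or.inl (funext fun j => ?_))
    have := hl j
    have := edgeEnd_even he (s := -s) (by omega) j
    omega
  · exact Or.inr (Or.inr (hC m hm l hl))

/-- An edge with a free end collapses onto its other end. -/
theorem IsComplex.deforms_insert_edge (hδ : δ ≠ 0) {C : Finset Cell} (hC : IsComplex C) {e : Cell}
    {i : Fin 2} (he : IsEdge e i) {s : ℤ} (hs : s = 1 ∨ s = -1) (hw : edgeEnd e i s ∈ C)
    (hv : edgeEnd e i (-s) ∉ C) (heC : e ∉ C) {Y : Set Plane}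
    (hY : carrier α δ (insert e (insert (edgeEnd e i (-s)) C)) ⊆ Y) :
    Deforms Y (carrier α δ C) (carrier α δ (insert e (insert (edgeEnd e i (-s)) C))) := by
  have hC' := hC.insert_edge he hs hw
  obtain ⟨x₀, hx₀⟩ := exists_mem_vertex (α := α) hδ (edgeEnd_even he hs)
  have hwe : IsFace (edgeEnd e i s) e := by
    rw [he.isFace_iff]; rcases hs with rfl | rfl <;> simp
  have hve : IsFace (edgeEnd e i (-s)) e := by
    rw [he.isFace_iff]; rcases hs with rfl | rfl <;> simp
  have hx₀e : x₀ ∈ cell α δ e := mem_cell_iff.2 (hx₀ ▸ hwe)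
  have hCe : cell α δ e ⊆ carrier α δ (insert e (insert (edgeEnd e i (-s)) C)) :=
    hC'.cell_subset (Finset.mem_insert_self _ _)
  refine Deforms.glue (A' := carrier α δ C) (D := cell α δ e) (D' := cell α δ e) ?_
    hC.isClosed_carrier ?_ (isClosed_cell e) ?_ hY (fun _ => x₀) continuousOn_const ?_ ?_ ?_
  · exact (inter_eq_right.2 (carrier_mono ((Finset.subset_insert _ _).trans
      (Finset.subset_insert _ _)))).symm
  · exact (inter_eq_right.2 hCe).symm
  · intro x hx
    simp only [carrier, mem_ofPred_eq, Finset.mem_insert] at hx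
    rcases hx with hx | hx | hx
    · exact Or.inr (mem_cell_iff.2 (hx ▸ IsFace.refl _))
    · exact Or.inr (mem_cell_iff.2 (hx ▸ hve))
    · exact Or.inl hx
  · intro x _
    change cellOf α δ x₀ ∈ C
    rwa [hx₀]
  · rintro x ⟨hx, hxe⟩
    have hface := he.isFace_iff.1 (mem_cell_iff.1 hxe)
    have hxw : cellOf α δ x = edgeEnd e i s := by
      have hx : cellOf α δ x ∈ C := hx
      rcases hs with rfl | rfl <;> rcases hface with h | h | h
      · exact absurd (h ▸ hx) heC
      · exact h
      · exact absurd (h ▸ hx) hv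
      · exact absurd (h ▸ hx) heC
      · exact absurd (h ▸ hx) (by simpa using hv)
      · exact h
    exact (eq_of_mem_vertex hδ (edgeEnd_even he hs) hxw hx₀).symm
  · exact fun x hx => ((convex_cell e).segment_subset hx hx₀e).trans (hCe.trans hY)

end Collapse

/-! ### Boxes and stars in the grid -/

section Box

variable {α δ : ℝ}

/-- The cells of the box of points with grid coordinates in `[-N, N]`. -/
def boxCells (N : ℕ) : Finset Cell := Fintype.piFinset fun _ => Finset.Icc (-2 * N : ℤ) (2 * N)

theorem mem_boxCells {N : ℕ} {n : Cell} :
    n ∈ boxCells N ↔ ∀ i, -2 * (N : ℤ) ≤ n i ∧ n i ≤ 2 * N := by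
  simp [boxCells]

theorem isComplex_boxCells (N : ℕ) : IsComplex (boxCells N) := fun n hn m hm => by
  rw [mem_boxCells] at hn ⊢
  intro i
  have := hn i; have := hm i; omega

theorem mem_carrier_boxCells {N : ℕ} {x : Plane} :
    x ∈ carrier α δ (boxCells N) ↔ ∀ i, |gridCoord α δ i x| ≤ N := by
  change cellOf α δ x ∈ boxCells N ↔ _
  rw [mem_boxCells]
  refine forall_congr' fun i => ?_
  rw [abs_le, show -(N : ℝ) = ((-N : ℤ) : ℝ) by push_cast; rfl, ← Int.le_floor,
    show (N : ℝ) = ((N : ℤ) : ℝ) by push_cast; rfl, ← Int.ceil_le]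
  simp only [cellOf]
  have h1 := Int.floor_le_ceil (gridCoord α δ i x)
  have h2 := Int.ceil_le_floor_add_one (gridCoord α δ i x)
  omega

/-- The complement of finitely many points of the open box retracts onto the box. -/
theorem deforms_box (hδ : δ ≠ 0) {N : ℕ} {Z : Set Plane}
    (hZ : ∀ y ∈ Z, ∀ i, |gridCoord α δ i y| < N) :
    Deforms Zᶜ (carrier α δ (boxCells N) \ Z) Zᶜ := by
  have hN : (0 : ℝ) ≤ N := Nat.cast_nonneg N
  set r : Plane → Plane := fun x => gridPoint α δ fun i => max (-N) (min N (gridCoord α δ i x))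
  have hrc : ∀ x i, gridCoord α δ i (r x) = max (-(N : ℝ)) (min N (gridCoord α δ i x)) :=
    fun x i => gridCoord_gridPoint hδ _ i
  have hrid : ∀ x ∈ carrier α δ (boxCells N), r x = x := fun x hx =>
    eq_of_gridCoord hδ fun i => by
      have := abs_le.1 (mem_carrier_boxCells.1 hx i)
      rw [hrc, min_eq_right this.2, max_eq_right this.1]
  have hrbox : ∀ x, r x ∈ carrier α δ (boxCells N) := fun x =>
    mem_carrier_boxCells.2 fun i => by
      rw [hrc]
      exact abs_le.2 ⟨le_max_left _ _, max_le (by linarith) (min_le_left _ _)⟩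
  have hseg : ∀ x ∈ Zᶜ, segment ℝ x (r x) ⊆ Zᶜ := by
    rintro x hx y hy hyZ
    by_cases hbox : x ∈ carrier α δ (boxCells N)
    · rw [hrid x hbox, segment_same, mem_singleton_iff] at hy
      exact hx (hy ▸ hyZ)
    · rw [mem_carrier_boxCells] at hbox
      push Not at hbox
      obtain ⟨i, hi⟩ := hbox
      obtain ⟨a, b, ha, hb, hab, rfl⟩ := hy
      have h1 := hZ _ hyZ i
      rw [gridCoord_combo _ _ _ hab, hrc, abs_lt] at h1
      obtain rfl : a = 1 - b := by linarith
      rcases lt_abs.1 hi with h | h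
      · rw [min_eq_left h.le, max_eq_right (by linarith)] at h1
        nlinarith
      · rw [min_eq_right (by linarith), max_eq_left (by linarith)] at h1
        nlinarith
  refine Deforms.of_segment (fun x hx => hx.2) r ?_ (fun x hx => ⟨hrbox x, ?_⟩)
    (fun x hx => hrid x hx.1) hseg
  · refine (continuous_gridPoint fun i => ?_).continuousOn
    have := continuous_gridCoord (α := α) (δ := δ) i
    fun_prop
  · exact hseg x hx (right_mem_segment ℝ _ _)

/-- The cells with a given face form a neighborhood of each point of that face. -/
theorem eventually_isFace (y : Plane) : ∀ᶠ x in 𝓝 y, IsFace (cellOf α δ y) (cellOf α δ x) := by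
  have key : ∀ i, ∀ᶠ x in 𝓝 y, (⌈gridCoord α δ i y⌉ - 1 : ℝ) < gridCoord α δ i x ∧
      gridCoord α δ i x < ⌊gridCoord α δ i y⌋ + 1 := fun i =>
    ((continuous_gridCoord i).continuousAt.eventually (lt_mem_nhds (by
      linarith [Int.ceil_lt_add_one (gridCoord α δ i y)]))).and
      ((continuous_gridCoord i).continuousAt.eventually (gt_mem_nhds (Int.lt_floor_add_one _)))
  filter_upwards [Filter.eventually_all.2 key] with x hx i
  obtain ⟨h1, h2⟩ := hx i
  have a1 : ⌈gridCoord α δ i y⌉ - 1 < ⌈gridCoord α δ i x⌉ := Int.lt_ceil.2 (by push_cast; exact h1)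
  have a2 : ⌈gridCoord α δ i y⌉ - 1 ≤ ⌊gridCoord α δ i x⌋ :=
    Int.le_floor.2 (by push_cast; exact h1.le)
  have a3 : ⌊gridCoord α δ i x⌋ < ⌊gridCoord α δ i y⌋ + 1 := Int.floor_lt.2 (by push_cast; exact h2)
  have a4 : ⌈gridCoord α δ i x⌉ ≤ ⌊gridCoord α δ i y⌋ + 1 :=
    Int.ceil_le.2 (by push_cast; exact h2.le)
  have b1 := Int.floor_le_ceil (gridCoord α δ i x)
  have b2 := Int.ceil_le_floor_add_one (gridCoord α δ i x)
  have b3 := Int.floor_le_ceil (gridCoord α δ i y)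
  have b4 := Int.ceil_le_floor_add_one (gridCoord α δ i y)
  simp only [cellOf]
  omega

theorem cell_nonempty (hδ : δ ≠ 0) (n : Cell) : (cell α δ n).Nonempty := by
  refine ⟨gridPoint α δ fun i => ((n i / 2 : ℤ) : ℝ), fun i => ?_⟩
  rw [gridCoord_gridPoint hδ]
  exact ⟨le_rfl, by exact_mod_cast (by omega : n i / 2 ≤ (n i + 1) / 2)⟩

theorem sideCell_isFace_nextCell {n : Cell} (hn : IsSquare2 n) (k : Fin 2 × Bool) :
    IsFace (sideCell n k) (nextCell n k) := fun i => by
  by_cases h : i = k.1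
  · subst h
    have := wallShift_cases k
    have := hn k.1
    simp only [sideCell, nextCell, Function.update_self]; omega
  · simp [sideCell, nextCell, h]

theorem exists_square_of_lt {N : ℕ} {x : Plane} (hx : ∀ i, |gridCoord α δ i x| < N) :
    ∃ n ∈ boxCells N, IsSquare2 n ∧ IsFace (cellOf α δ x) n := by
  have h := mem_boxCells.1 (mem_carrier_boxCells.2 fun i => (hx i).le : cellOf α δ x ∈ boxCells N)
  have h' : ∀ i, cellOf α δ x i ≠ 2 * N := fun i hi => by
    have := cellOf_eq_two_mul_iff.1 hi
    have h2 := hx i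
    rw [this] at h2
    exact absurd h2 (not_lt.2 (le_abs_self _))
  refine ⟨fun i => 2 * (cellOf α δ x i / 2) + 1, mem_boxCells.2 fun i => ?_, fun i => ?_,
    fun i => ?_⟩
  · have := h i; have := h' i
    omega
  · change (2 * (cellOf α δ x i / 2) + 1) % 2 = 1; omega
  · dsimp only; omega

end Box

/-! ### Complexes without free squares away from a compact set -/

section Terminal

variable {α δ : ℝ} {N : ℕ} {K Z : Set Plane}

/-- Puncturing the squares that contain the points of `Z`. -/
theorem deforms_punctured_box (hδ : δ ≠ 0) {Z : Finset Plane}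
    (hZsq : ∀ y ∈ Z, IsSquare2 (cellOf α δ y)) (hZinj : InjOn (cellOf α δ) (Z : Set Plane))
    (hZbox : ∀ y ∈ Z, ∀ i, |gridCoord α δ i y| < N) :
    IsComplex (boxCells N \ Z.image (cellOf α δ)) ∧
      Deforms (Z : Set Plane)ᶜ (carrier α δ (boxCells N \ Z.image (cellOf α δ)))
        (Z : Set Plane)ᶜ := by
  classical
  have key : ∀ S : Finset Plane, S ⊆ Z → IsComplex (boxCells N \ S.image (cellOf α δ)) ∧
      Deforms (Z : Set Plane)ᶜ (carrier α δ (boxCells N \ S.image (cellOf α δ)) \ Z)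
        (Z : Set Plane)ᶜ := by
    intro S
    induction S using Finset.induction_on with
    | empty =>
      intro _
      simpa using ⟨isComplex_boxCells N, deforms_box hδ hZbox⟩
    | insert a S ha ih =>
      intro hS
      obtain ⟨h1, h2⟩ := ih ((Finset.subset_insert _ _).trans hS)
      have haZ : a ∈ Z := hS (Finset.mem_insert_self _ _)
      have heq : boxCells N \ (insert a S).image (cellOf α δ) =
          (boxCells N \ S.image (cellOf α δ)).erase (cellOf α δ a) := by
        ext n
        simp only [Finset.mem_sdiff, Finset.image_insert, Finset.mem_insert, Finset.mem_erase]
        tauto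
      have hmem : cellOf α δ a ∈ boxCells N \ S.image (cellOf α δ) := by
        refine Finset.mem_sdiff.2 ⟨mem_carrier_boxCells.2 fun i => (hZbox a haZ i).le, fun h => ?_⟩
        obtain ⟨b, hb, hba⟩ := Finset.mem_image.1 h
        exact ha (hZinj (hS (Finset.mem_insert_of_mem hb)) haZ hba ▸ hb)
      rw [heq]
      exact ⟨h1.erase_square (hZsq a haZ), (h1.deforms_erase_square hδ hmem (hZsq a haZ) hZsq haZ
        rfl fun y hy h => hZinj hy haZ h).trans h2⟩
  obtain ⟨h1, h2⟩ := key Z le_rfl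
  refine ⟨h1, ?_⟩
  rwa [sdiff_eq_left.2] at h2
  rw [Set.disjoint_left]
  exact fun x hx hxZ => (Finset.mem_sdiff.1 hx).2 (Finset.mem_image_of_mem _ hxZ)

/-- Squares that do not meet `K` and have a free side can be collapsed until none is left. -/
theorem exists_terminal_complex (hδ : δ ≠ 0) {Z : Finset Plane}
    (hZsq : ∀ y ∈ Z, IsSquare2 (cellOf α δ y)) (hZinj : InjOn (cellOf α δ) (Z : Set Plane))
    (hZbox : ∀ y ∈ Z, ∀ i, |gridCoord α δ i y| < N)
    (hKZ : ∀ y ∈ Z, Disjoint (cell α δ (cellOf α δ y)) K) :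
    ∃ C : Finset Cell, IsComplex C ∧ C ⊆ boxCells N ∧
      (∀ n ∈ boxCells N, IsSquare2 n → (cell α δ n ∩ K).Nonempty → n ∈ C) ∧
      Deforms (Z : Set Plane)ᶜ (carrier α δ C) (Z : Set Plane)ᶜ ∧
      ∀ n ∈ C, IsSquare2 n → Disjoint (cell α δ n) K → ∀ k, nextCell n k ∈ C := by
  classical
  let P : Finset Cell → Prop := fun C => IsComplex C ∧ C ⊆ boxCells N ∧
      (∀ n ∈ boxCells N, IsSquare2 n → (cell α δ n ∩ K).Nonempty → n ∈ C) ∧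
      Deforms (Z : Set Plane)ᶜ (carrier α δ C) (Z : Set Plane)ᶜ
  have hP : ∃ C, P C := by
    obtain ⟨h1, h2⟩ := deforms_punctured_box hδ hZsq hZinj hZbox
    refine ⟨_, h1, Finset.sdiff_subset, fun n hn _ hK => Finset.mem_sdiff.2 ⟨hn, fun h => ?_⟩, h2⟩
    obtain ⟨y, hy, rfl⟩ := Finset.mem_image.1 h
    exact Set.not_disjoint_iff_nonempty_inter.2 hK (hKZ y hy)
  obtain ⟨C, ⟨h1, h2, h3, h4⟩, hmin⟩ := exists_minimalFor_of_wellFoundedLT P Finset.card hP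
  refine ⟨C, h1, h2, h3, h4, fun n hn hsq hK k => ?_⟩
  by_contra hk
  have hlt : ((C.erase n).erase (sideCell n k)).card < C.card :=
    (Finset.card_le_card (Finset.erase_subset _ _)).trans_lt (Finset.card_erase_lt_of_mem hn)
  refine absurd (hmin (j := (C.erase n).erase (sideCell n k))
    ⟨h1.erase_pair hsq hk, ?_, ?_, ?_⟩ hlt.le) (not_le.2 hlt)
  · exact ((Finset.erase_subset _ _).trans (Finset.erase_subset _ _)).trans h2
  · intro m hm hmsq hmK
    refine Finset.mem_erase.2 ⟨?_, Finset.mem_erase.2 ⟨?_, h3 m hm hmsq hmK⟩⟩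
    · rintro rfl
      have h5 := hsq k.1
      have h6 := hmsq k.1
      have := wallShift_cases k
      simp only [sideCell, Function.update_self] at h6
      omega
    · rintro rfl
      exact Set.not_disjoint_iff_nonempty_inter.2 hmK hK
  · exact (h1.deforms_erase_pair hδ hn hsq hk h4.1).trans h4

/-- The cells of `C` that are faces of squares of `C`. -/
def pureCells (C : Finset Cell) : Finset Cell :=
  open Classical in C.filter fun m => ∃ n ∈ C, IsSquare2 n ∧ IsFace m n

theorem mem_pureCells {C : Finset Cell} (hC : IsComplex C) {m : Cell} :
    m ∈ pureCells C ↔ ∃ n ∈ C, IsSquare2 n ∧ IsFace m n := by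
  simp only [pureCells, Finset.mem_filter, and_iff_right_iff_imp]
  rintro ⟨n, hn, -, h⟩
  exact hC n hn m h

theorem isComplex_pureCells {C : Finset Cell} (hC : IsComplex C) : IsComplex (pureCells C) := by
  intro n hn m hm
  rw [mem_pureCells hC] at hn ⊢
  obtain ⟨l, hl, hsq, h⟩ := hn
  exact ⟨l, hl, hsq, hm.trans h⟩

theorem pureCells_subset {C : Finset Cell} (hC : IsComplex C) : pureCells C ⊆ C := fun m hm => by
  obtain ⟨n, hn, -, h⟩ := (mem_pureCells hC).1 hm
  exact hC n hn m h

theorem subset_carrier_pureCells {C : Finset Cell} (hC : IsComplex C)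
    (hKbox : ∀ y ∈ K, ∀ i, |gridCoord α δ i y| < N)
    (h : ∀ n ∈ boxCells N, IsSquare2 n → (cell α δ n ∩ K).Nonempty → n ∈ C) :
    K ⊆ carrier α δ (pureCells C) := fun x hx => by
  obtain ⟨n, hn, hsq, hf⟩ := exists_square_of_lt (hKbox x hx)
  exact (mem_pureCells hC).2 ⟨n, h n hn hsq ⟨x, mem_cell_iff.2 hf, hx⟩, hsq, hf⟩

/-- The squares of a terminal complex form a connected set: from a square that does not meet `K`
one gets, moving in one direction, to a square that does. -/
theorem isPreconnected_pureCells (hδ : δ ≠ 0) {C : Finset Cell} (hC : IsComplex C)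
    (hCN : C ⊆ boxCells N) (hK : IsConnected K) (hKC : K ⊆ carrier α δ (pureCells C))
    (hterm : ∀ n ∈ C, IsSquare2 n → Disjoint (cell α δ n) K → ∀ k, nextCell n k ∈ C) :
    IsPreconnected (carrier α δ (pureCells C)) := by
  have hpc := isComplex_pureCells hC
  have hsub : ∀ n ∈ C, IsSquare2 n → cell α δ n ⊆ carrier α δ (pureCells C) := fun n hn hsq =>
    hpc.cell_subset ((mem_pureCells hC).2 ⟨n, hn, hsq, IsFace.refl n⟩)
  have march : ∀ d : ℕ, ∀ n ∈ C, IsSquare2 n → 2 * (N : ℤ) < n 0 + d →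
      ∃ t, IsPreconnected t ∧ t ⊆ carrier α δ (pureCells C) ∧ cell α δ n ⊆ t ∧
        (t ∩ K).Nonempty := by
    intro d
    induction d with
    | zero =>
      intro n hn _ hd
      have := (mem_boxCells.1 (hCN hn) 0).2
      omega
    | succ d ih =>
      intro n hn hsq hd
      by_cases hnK : Disjoint (cell α δ n) K
      · obtain ⟨t, h1, h2, h3, h4⟩ := ih _ (hterm n hn hsq hnK (0, true))
          (nextCell_isSquare2 hsq _) (by
            simp only [nextCell, Function.update_self, wallShift, if_true]
            push_cast at hd; omega)
        obtain ⟨x, hx⟩ := cell_nonempty (α := α) hδ (sideCell n (0, true))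
        refine ⟨cell α δ n ∪ t, (convex_cell n).isPreconnected.union x
          (cell_mono (sideCell_isFace hsq _) hx)
          (h3 (cell_mono (sideCell_isFace_nextCell hsq _) hx)) h1,
          union_subset (hsub n hn hsq) h2, subset_union_left,
          h4.mono (inter_subset_inter_left _ subset_union_right)⟩
      · exact ⟨cell α δ n, (convex_cell n).isPreconnected, hsub n hn hsq, le_rfl,
          Set.not_disjoint_iff_nonempty_inter.1 hnK⟩
  obtain ⟨a, ha⟩ := hK.nonempty
  refine isPreconnected_of_forall a fun x hx => ?_
  obtain ⟨n, hn, hsq, hf⟩ := (mem_pureCells hC).1 hx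
  obtain ⟨t, h1, h2, h3, b, hb, hbK⟩ := march (2 * N - n 0 + 1).toNat n hn hsq (by omega)
  exact ⟨K ∪ t, union_subset hKC h2, Or.inl ha, Or.inr (h3 (mem_cell_iff.2 hf)),
    hK.isPreconnected.union b hbK hb h1⟩

/-- The squares of a terminal complex are close to `K`: those at a point away from `K` spread along
every connected set that stays away from `K`. -/
theorem subset_of_terminal {C : Finset Cell} (hC : IsComplex C)
    (hterm : ∀ n ∈ C, IsSquare2 n → Disjoint (cell α δ n) K → ∀ k, nextCell n k ∈ C)
    {D : Set Plane} (hD : IsPreconnected D)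
    (hDK : ∀ y ∈ D, ∀ n, y ∈ cell α δ n → Disjoint (cell α δ n) K)
    (hne : (D ∩ carrier α δ (pureCells C)).Nonempty) : D ⊆ carrier α δ (pureCells C) := by
  -- squares with the face `y` are reached by changing one coordinate at a time
  have step : ∀ y ∈ D, ∀ n ∈ C, IsSquare2 n → IsFace (cellOf α δ y) n → ∀ m, IsSquare2 m →
      IsFace (cellOf α δ y) m → ∀ i, Function.update n i (m i) ∈ C := by
    intro y hy n hn hsq hf m hm hfm i
    have h1 := hsq i; have h2 := hm i; have h3 := hf i; have h4 := hfm i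
    have hnext := hterm n hn hsq (hDK y hy n (mem_cell_iff.2 hf))
    obtain h | h | h : m i = n i ∨ m i = n i + 2 ∨ m i = n i - 2 := by omega
    · rwa [h, Function.update_eq_self]
    · rw [h]; exact hnext (i, true)
    · have := hnext (i, false)
      rw [h]
      simpa [nextCell, wallShift, sub_eq_add_neg] using this
  -- every square at `y` belongs to `C`
  have hopen : ∀ y ∈ D, y ∈ carrier α δ (pureCells C) →
      y ∈ interior (carrier α δ (pureCells C)) := by
    intro y hy hyC
    obtain ⟨n, hn, hsq, hf⟩ := (mem_pureCells hC).1 hyC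
    rw [mem_interior_iff_mem_nhds]
    filter_upwards [eventually_isFace (α := α) (δ := δ) y] with x hx
    set m : Cell := fun i => 2 * (cellOf α δ x i / 2) + 1 with hm
    have hmsq : IsSquare2 m := fun i => by simp only [hm]; omega
    have hxm : IsFace (cellOf α δ x) m := fun i => by simp only [hm]; omega
    have hym := hx.trans hxm
    refine (mem_pureCells hC).2 ⟨m, ?_, hmsq, hxm⟩
    have h0 := step y hy n hn hsq hf m hmsq hym 0
    have h1 := step y hy _ h0 (fun i => by
      by_cases hi : i = 0
      · subst hi; simpa using hmsq 0
      · simpa [hi] using hsq i) (fun i => by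
      by_cases hi : i = 0
      · subst hi; simpa using hym 0
      · simpa [hi] using hf i) m hmsq hym 1
    convert h1 using 1
    funext i
    fin_cases i <;> simp [Function.update]
  refine (hD.subset_left_of_subset_union (v := (carrier α δ (pureCells C))ᶜ) isOpen_interior
    (isComplex_pureCells hC).isClosed_carrier.isOpen_compl ?_ ?_ ?_).trans interior_subset
  · exact disjoint_compl_right.mono_left interior_subset
  · intro y hy
    by_cases h : y ∈ carrier α δ (pureCells C)
    · exact Or.inl (hopen y hy h)
    · exact Or.inr h
  · obtain ⟨y, hy, hyC⟩ := hne
    exact ⟨y, hy, hopen y hy hyC⟩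

end Terminal

/-! ### Complexes with edges: no loops -/

section Loops

variable {α δ : ℝ} {K Y : Set Plane}

/-- If every circle-valued map on `Y` that vanishes on `K` lifts, then an edge of a retract of `Y`
cannot join two points of a connected set that contains `K`: a map that winds once around the circle
along the edge would not lift. -/
theorem not_both_ends (hδ : δ ≠ 0) {C A : Finset Cell} (hC : IsComplex C)
    (hX : ∀ f : Plane → UnitAddCircle, ContinuousOn f Y → (∀ x ∈ K, f x = 0) →
      ∃ μ : Plane → ℝ, ContinuousOn μ Y ∧ ∀ x ∈ Y, (μ x : UnitAddCircle) = f x)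
    (hAC : A ⊆ C) (hKA : K ⊆ carrier α δ A) (hA : IsPreconnected (carrier α δ A))
    (hCY : Deforms Y (carrier α δ C) Y) {e : Cell} {i : Fin 2} (he : IsEdge e i) (heC : e ∈ C)
    (heA : e ∉ A) (hmax : ∀ n ∈ C, IsFace e n → n = e)
    (h1 : edgeEnd e i 1 ∈ A) (h2 : edgeEnd e i (-1) ∈ A) : False := by
  classical
  obtain ⟨hCY', -, r, hr, hrC, hrid, -⟩ := hCY
  have hE : IsComplex (C.erase e) := fun n hn m hm => by
    obtain ⟨hne, hnC⟩ := Finset.mem_erase.1 hn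
    refine Finset.mem_erase.2 ⟨?_, hC n hnC m hm⟩
    rintro rfl
    exact hne (hmax n hnC hm)
  -- the map that winds once around the circle along the edge
  set f : Plane → UnitAddCircle := fun x =>
    if cellOf α δ x = e then (gridCoord α δ i x : UnitAddCircle) else 0 with hf
  have hend : ∀ {x} {s : ℤ}, s = 1 ∨ s = -1 → cellOf α δ x = edgeEnd e i s →
      gridCoord α δ i x = ((e i + s) / 2 : ℤ) := fun {x s} hs hx => by
    have h := edgeEnd_even he hs i
    have hx' := congrFun hx i
    rw [show edgeEnd e i s i = 2 * ((e i + s) / 2) by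
      simp only [edgeEnd, Function.update_self] at h ⊢; omega] at hx'
    exact cellOf_eq_two_mul_iff.1 hx'
  have hfe : ∀ x ∈ cell α δ e, f x = (gridCoord α δ i x : UnitAddCircle) := fun x hx => by
    by_cases h : cellOf α δ x = e
    · simp [hf, h]
    · have : ∃ k : ℤ, gridCoord α δ i x = k := by
        rcases he.isFace_iff.1 (mem_cell_iff.1 hx) with h' | h' | h'
        · exact absurd h' h
        · exact ⟨_, hend (Or.inl rfl) h'⟩
        · exact ⟨_, hend (Or.inr rfl) h'⟩
      obtain ⟨k, hk⟩ := this
      simp only [hf, if_neg h, hk]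
      refine (AddCircle.coe_eq_zero_iff (1 : ℝ) |>.2 ⟨k, by simp⟩).symm
  have hfE : ∀ x ∈ carrier α δ (C.erase e), f x = 0 := fun x hx =>
    if_neg (Finset.mem_erase.1 hx).1
  have hfC : ContinuousOn f (carrier α δ C) := by
    have hunion : carrier α δ C = cell α δ e ∪ carrier α δ (C.erase e) := by
      refine subset_antisymm (fun x hx => ?_) (union_subset (hC.cell_subset heC)
        (carrier_mono (Finset.erase_subset _ _)))
      by_cases h : cellOf α δ x = e
      · exact Or.inl (h ▸ mem_cell_cellOf x)
      · exact Or.inr (Finset.mem_erase.2 ⟨h, hx⟩)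
    rw [hunion]
    refine ContinuousOn.union_of_isClosed ?_ ?_ (isClosed_cell e) hE.isClosed_carrier
    · exact ((AddCircle.continuous_mk' 1).comp (continuous_gridCoord i)).continuousOn.congr hfe
    · exact continuousOn_const.congr hfE
  have hAE : carrier α δ A ⊆ carrier α δ (C.erase e) := fun x hx =>
    Finset.mem_erase.2 ⟨fun h => heA (h ▸ hx), hAC hx⟩
  obtain ⟨μ, hμ, hμf⟩ := hX (f ∘ r) (hfC.comp hr hrC) fun x hx => by
    simp only [Function.comp_apply, hrid (carrier_mono hAC (hKA hx)), id]
    exact hfE _ (hAE (hKA hx))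
  have hμC : ∀ x ∈ carrier α δ C, (μ x : UnitAddCircle) = f x := fun x hx => by
    rw [hμf x (hCY' hx), Function.comp_apply, hrid hx, id]
  obtain ⟨x, hx⟩ := exists_mem_vertex (α := α) hδ (edgeEnd_even he (Or.inl rfl))
  obtain ⟨y, hy⟩ := exists_mem_vertex (α := α) hδ (edgeEnd_even he (Or.inr rfl))
  have hxA : x ∈ carrier α δ A := by change cellOf α δ x ∈ A; rwa [hx]
  have hyA : y ∈ carrier α δ A := by change cellOf α δ y ∈ A; rwa [hy]
  have hxe : x ∈ cell α δ e := mem_cell_iff.2 (he.isFace_iff.2 (Or.inr (Or.inl hx)))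
  have hye : y ∈ cell α δ e := mem_cell_iff.2 (he.isFace_iff.2 (Or.inr (Or.inr hy)))
  have heq : μ x = μ y := eq_of_coe_eq hA (hμ.mono ((carrier_mono hAC).trans hCY')) 0
    (fun a ha => (hμC a (carrier_mono hAC ha)).trans (hfE a (hAE ha))) hxA hyA
  have hec := hC.cell_subset (α := α) (δ := δ) heC
  have heq' : μ x - gridCoord α δ i x = μ y - gridCoord α δ i y :=
    eq_of_coe_eq (convex_cell (α := α) (δ := δ) e).isPreconnected
      (μ := fun a => μ a - gridCoord α δ i a)
      ((hμ.mono (hec.trans hCY')).sub (continuous_gridCoord i).continuousOn) 0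
      (fun a ha => by rw [AddCircle.coe_sub, hμC a (hec ha), hfe a ha, sub_self]) hxe hye
  rw [hend (Or.inl rfl) hx, hend (Or.inr rfl) hy, heq] at heq'
  have h3 : ((e i + 1) / 2 : ℤ) = (e i + -1) / 2 + 1 := by omega
  rw [h3] at heq'
  push_cast at heq'
  linarith

/-- A connected complex without loops through `K` retracts onto every connected subcomplex that
contains `K` and all squares. -/
theorem IsComplex.deforms_of_squares (hδ : δ ≠ 0) {C A : Finset Cell} (hC : IsComplex C)
    (hX : ∀ f : Plane → UnitAddCircle, ContinuousOn f Y → (∀ x ∈ K, f x = 0) →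
      ∃ μ : Plane → ℝ, ContinuousOn μ Y ∧ ∀ x ∈ Y, (μ x : UnitAddCircle) = f x)
    (hAc : IsComplex A) (hAC : A ⊆ C) (hK : K.Nonempty) (hKA : K ⊆ carrier α δ A)
    (hA : IsPreconnected (carrier α δ A)) (hsq : ∀ n ∈ C, IsSquare2 n → n ∈ A)
    (hCc : IsPreconnected (carrier α δ C)) (hCY : Deforms Y (carrier α δ C) Y) :
    Deforms Y (carrier α δ A) (carrier α δ C) := by
  classical
  let P : Finset Cell → Prop := fun B => IsComplex B ∧ A ⊆ B ∧ B ⊆ C ∧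
    IsPreconnected (carrier α δ B) ∧ Deforms Y (carrier α δ A) (carrier α δ B)
  obtain ⟨B, ⟨hB, hAB, hBC, hBpc, hdef⟩, hmin⟩ := exists_minimalFor_of_wellFoundedLT P
    (fun B => C.card - B.card)
    ⟨A, hAc, le_rfl, hAC, hA, Deforms.refl ((carrier_mono hAC).trans hCY.1)⟩
  by_cases hBC' : C ⊆ B
  · rwa [hBC.antisymm hBC'] at hdef
  exfalso
  -- a cell outside `B` is an edge
  have hedge : ∀ e ∈ C, e ∉ B → ∀ m ∈ B, IsFace m e → ∃ i, IsEdge e i := by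
    intro e he heB m hm hme
    by_contra! hne
    have hnsq : ¬ IsSquare2 e := fun h => heB (hAB (hsq e he h))
    have a0 := hne 0; have a1 := hne 1
    simp only [IsSquare2, IsEdge, Fin.forall_fin_two, ne_eq, not_true_eq_false, false_imp_iff,
      true_and, and_true, one_ne_zero, zero_ne_one, not_false_eq_true, forall_const] at hnsq a0 a1
    have : m = e := funext fun j => by
      have := hme j
      have : e j % 2 ≠ 1 := by fin_cases j <;> simp <;> omega
      omega
    exact heB (this ▸ hm)
  obtain ⟨e, heC, heB, m, hmB, hme⟩ : ∃ e ∈ C, e ∉ B ∧ ∃ m ∈ B, IsFace m e := by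
    by_contra! hcon
    have hcl : IsClosed (⋃ n ∈ C \ B, cell α δ n) :=
      (C \ B).finite_toSet.isClosed_biUnion fun n _ => isClosed_cell n
    obtain ⟨a, ha⟩ := hK
    obtain ⟨e, heC, heB⟩ := Finset.not_subset.1 hBC'
    obtain ⟨x, hx⟩ := cell_nonempty (α := α) hδ e
    obtain ⟨y, -, hyB, hyn⟩ := isPreconnected_closed_iff.1 hCc _ _
      (hB.isClosed_carrier (α := α) (δ := δ)) hcl
      (fun y hy => by
        by_cases h : cellOf α δ y ∈ B
        · exact Or.inl h
        · exact Or.inr (mem_biUnion (Finset.mem_sdiff.2 ⟨hy, h⟩) (mem_cell_cellOf y)))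
      ⟨a, carrier_mono hAC (hKA ha), carrier_mono hAB (hKA ha)⟩
      ⟨x, hC.cell_subset heC hx, mem_biUnion (Finset.mem_sdiff.2 ⟨heC, heB⟩) hx⟩
    obtain ⟨n, hn, hyn⟩ := mem_iUnion₂.1 hyn
    obtain ⟨hnC, hnB⟩ := Finset.mem_sdiff.1 hn
    exact hcon n hnC hnB _ hyB (mem_cell_iff.1 hyn)
  obtain ⟨i, he⟩ := hedge e heC heB m hmB hme
  obtain ⟨s, hs, hw⟩ : ∃ s : ℤ, (s = 1 ∨ s = -1) ∧ edgeEnd e i s ∈ B := by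
    rcases he.isFace_iff.1 hme with rfl | rfl | rfl
    · exact absurd hmB heB
    · exact ⟨1, Or.inl rfl, hmB⟩
    · exact ⟨-1, Or.inr rfl, hmB⟩
  have hmax : ∀ n ∈ C, IsFace e n → n = e := fun n hn hen => by
    by_contra hne
    refine heB (hB n ?_ e hen)
    refine hAB (hsq n hn fun j => ?_)
    by_contra hj
    refine hne (funext fun l => ?_)
    have h1 := hen l; have h2 := hen j; have h3 := he.1
    by_cases hjl : l = j
    · subst hjl; omega
    · by_cases hji : j = i
      · subst hji; omega
      · have : l = i := by fin_cases l <;> fin_cases j <;> fin_cases i <;> simp_all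
        subst this; omega
  by_cases hv : edgeEnd e i (-s) ∈ B
  · have hboth : edgeEnd e i 1 ∈ B ∧ edgeEnd e i (-1) ∈ B := by
      rcases hs with rfl | rfl
      · exact ⟨hw, hv⟩
      · exact ⟨by simpa using hv, hw⟩
    exact not_both_ends hδ hC hX hBC (hKA.trans (carrier_mono hAB)) hBpc hCY he heC heB hmax
      hboth.1 hboth.2
  · set B' := insert e (insert (edgeEnd e i (-s)) B) with hB'
    have hB'c : IsComplex B' := hB.insert_edge he hs hw
    have hve : IsFace (edgeEnd e i (-s)) e := by
      rw [he.isFace_iff]; rcases hs with rfl | rfl <;> simp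
    have hwe : IsFace (edgeEnd e i s) e := by
      rw [he.isFace_iff]; rcases hs with rfl | rfl <;> simp
    have hB'C : B' ⊆ C := by
      intro n hn
      simp only [hB', Finset.mem_insert] at hn
      rcases hn with rfl | rfl | hn
      · exact heC
      · exact hC e heC _ hve
      · exact hBC hn
    have hBB' : B ⊆ B' := (Finset.subset_insert _ _).trans (Finset.subset_insert _ _)
    have hcar : carrier α δ B' = carrier α δ B ∪ cell α δ e := by
      refine subset_antisymm (fun x hx => ?_) (union_subset (carrier_mono hBB')
        (hB'c.cell_subset (Finset.mem_insert_self _ _)))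
      simp only [carrier, mem_ofPred_eq, hB', Finset.mem_insert] at hx
      rcases hx with hx | hx | hx
      · exact Or.inr (hx ▸ mem_cell_cellOf x)
      · exact Or.inr (mem_cell_iff.2 (hx ▸ hve))
      · exact Or.inl hx
    obtain ⟨x, hx⟩ := exists_mem_vertex (α := α) hδ (edgeEnd_even he hs)
    have hpc : IsPreconnected (carrier α δ B') := by
      rw [hcar]
      exact hBpc.union x (by change cellOf α δ x ∈ B; rwa [hx]) (mem_cell_iff.2 (hx ▸ hwe))
        (convex_cell e).isPreconnected
    have hlt : B.card < B'.card := Finset.card_lt_card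
      ⟨hBB', fun h => heB (h (Finset.mem_insert_self _ _))⟩
    have hle := Finset.card_le_card hB'C
    have := hmin (j := B') ⟨hB'c, hAB.trans hBB', hB'C, hpc, hdef.trans
      (hB.deforms_insert_edge hδ he hs hw hv heB ((carrier_mono hB'C).trans hCY.1))⟩
      (by simp only; omega)
    simp only at this
    omega

/-- The plane without the finite set `Z` retracts onto a set near `K`, provided that the grid is
fine enough: points away from `K` can be joined to `Z`, or to far away points, by connected sets
that stay away from `K`. -/
theorem exists_deforms_near (hδ : δ ≠ 0) {N : ℕ} {Z : Finset Plane}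
    (hZsq : ∀ y ∈ Z, IsSquare2 (cellOf α δ y)) (hZinj : InjOn (cellOf α δ) (Z : Set Plane))
    (hZbox : ∀ y ∈ Z, ∀ i, |gridCoord α δ i y| < N)
    (hK : IsConnected K) (hKbox : ∀ y ∈ K, ∀ i, |gridCoord α δ i y| < N)
    (hKZ : ∀ y ∈ Z, Disjoint (cell α δ (cellOf α δ y)) K)
    (hX : ∀ f : Plane → UnitAddCircle, ContinuousOn f (Z : Set Plane)ᶜ → (∀ x ∈ K, f x = 0) →
      ∃ μ : Plane → ℝ, ContinuousOn μ (Z : Set Plane)ᶜ ∧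
        ∀ x ∈ (Z : Set Plane)ᶜ, (μ x : UnitAddCircle) = f x)
    {V : Set Plane} (hV : ∀ x ∉ V, ∃ D, IsPreconnected D ∧ x ∈ D ∧
      (∀ y ∈ D, ∀ n, y ∈ cell α δ n → Disjoint (cell α δ n) K) ∧
      ∃ y ∈ D, y ∈ Z ∨ ∃ i, (N : ℝ) < |gridCoord α δ i y|) :
    ∃ A, K ⊆ A ∧ A ⊆ V ∧ Deforms (Z : Set Plane)ᶜ A (Z : Set Plane)ᶜ := by
  obtain ⟨C, hC, hCN, hCK, hCdef, hterm⟩ := exists_terminal_complex hδ hZsq hZinj hZbox hKZ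
  have hKC := subset_carrier_pureCells hC hKbox hCK
  have hsub := carrier_mono (α := α) (δ := δ) (pureCells_subset hC)
  refine ⟨carrier α δ (pureCells C), hKC, fun x hx => ?_, ?_⟩
  · by_contra hxV
    obtain ⟨D, hD, hxD, hDK, y, hyD, hy⟩ := hV x hxV
    have hyC := hsub (subset_of_terminal hC hterm hD hDK ⟨x, hxD, hx⟩ hyD)
    rcases hy with hy | ⟨i, hy⟩
    · exact hCdef.1 hyC hy
    · exact absurd (mem_carrier_boxCells.1 (carrier_mono hCN hyC) i) (not_le.2 hy)
  · refine Deforms.trans (hC.deforms_of_squares hδ hX (isComplex_pureCells hC) (pureCells_subset hC)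
      hK.nonempty hKC (isPreconnected_pureCells hδ hC hCN hK hKC hterm)
      (fun n hn hsq => (mem_pureCells hC).2 ⟨n, hn, hsq, IsFace.refl n⟩) ?_ hCdef) hCdef
    obtain ⟨h1, -, r, hr, hrC, hrid, -⟩ := hCdef
    have hpre : IsPreconnected (Z : Set Plane)ᶜ :=
      (Z.countable_toSet.isConnected_compl_of_one_lt_rank (by
        rw [← Module.finrank_eq_rank, finrank_euclideanSpace_fin]; norm_num)).isPreconnected
    have himg : r '' (Z : Set Plane)ᶜ = carrier α δ C :=
      subset_antisymm hrC.image_subset fun x hx => ⟨x, h1 hx, hrid hx⟩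
    rw [← himg]
    exact hpre.image r hr

end Loops

/-! ### The punctured plane retracts onto a compact set with one puncture per hole -/

theorem norm_le_abs_add_abs (x : Plane) : ‖x‖ ≤ |x 0| + |x 1| := by
  rw [EuclideanSpace.norm_eq, Fin.sum_univ_two, Real.norm_eq_abs, Real.norm_eq_abs]
  refine Real.sqrt_le_iff.2 ⟨by positivity, ?_⟩
  have := abs_nonneg (x 0)
  have := abs_nonneg (x 1)
  nlinarith

theorem abs_apply_le_norm (x : Plane) (i : Fin 2) : |x i| ≤ ‖x‖ := by
  simpa using PiLp.norm_apply_le x i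

theorem dist_le_of_mem_cell {α δ : ℝ} (hδ : 0 < δ) {n : Cell} {x y : Plane} (hx : x ∈ cell α δ n)
    (hy : y ∈ cell α δ n) : dist x y ≤ 2 * δ := by
  have key : ∀ i, |(x - y) i| ≤ δ := fun i => by
    obtain ⟨h1, h2⟩ := hx i
    obtain ⟨h3, h4⟩ := hy i
    have h5 : (((n i + 1) / 2 : ℤ) : ℝ) ≤ ((n i / 2 : ℤ) : ℝ) + 1 := by
      exact_mod_cast (by omega : (n i + 1) / 2 ≤ n i / 2 + 1)
    have h6 : (x - y) i = δ * (gridCoord α δ i x - gridCoord α δ i y) := by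
      simp only [gridCoord, PiLp.sub_apply]; field_simp; ring
    rw [h6, abs_mul, abs_of_pos hδ]
    have : |gridCoord α δ i x - gridCoord α δ i y| ≤ 1 := abs_le.2 ⟨by linarith, by linarith⟩
    nlinarith
  rw [dist_eq_norm]
  linarith [norm_le_abs_add_abs (x - y), key 0, key 1]

/-- The points of a compact set outside `K` can be joined to the punctures or to a far away point by
connected sets that keep a uniform distance from `K`. -/
theorem exists_uniform_distance {K T P : Set Plane} (hK : IsClosed K) (hT : IsCompact T)
    (hTK : Disjoint T K) (hjoin : ∀ x ∈ Kᶜ, ∃ w ∈ P, JoinedIn Kᶜ x w) :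
    ∃ η > 0, ∀ x ∈ T, ∃ D, IsPreconnected D ∧ x ∈ D ∧ (∃ w ∈ D, w ∈ P) ∧
      ∀ y ∈ D, ∀ k ∈ K, η ≤ dist y k := by
  refine hT.induction_on (p := fun S => ∃ η > 0, ∀ x ∈ S, ∃ D, IsPreconnected D ∧ x ∈ D ∧
    (∃ w ∈ D, w ∈ P) ∧ ∀ y ∈ D, ∀ k ∈ K, η ≤ dist y k) ⟨1, one_pos, by simp⟩ ?_ ?_ ?_
  · rintro s t hst ⟨η, hη, h⟩
    exact ⟨η, hη, fun x hx => h x (hst hx)⟩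
  · rintro s t ⟨η, hη, h⟩ ⟨η', hη', h'⟩
    refine ⟨min η η', lt_min hη hη', ?_⟩
    rintro x (hx | hx)
    · obtain ⟨D, h1, h2, h3, h4⟩ := h x hx
      exact ⟨D, h1, h2, h3, fun y hy k hk => (min_le_left _ _).trans (h4 y hy k hk)⟩
    · obtain ⟨D, h1, h2, h3, h4⟩ := h' x hx
      exact ⟨D, h1, h2, h3, fun y hy k hk => (min_le_right _ _).trans (h4 y hy k hk)⟩
  · intro x hx
    have hxK : x ∈ Kᶜ := Set.disjoint_left.1 hTK hx
    obtain ⟨w, hw, γ, hγ⟩ := hjoin x hxK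
    obtain ⟨ε, hε, hball⟩ := Metric.isOpen_iff.1 hK.isOpen_compl x hxK
    obtain ⟨η, hη, hdist⟩ := Metric.exists_pos_forall_lt_edist (isCompact_range γ.continuous) hK
      (Set.disjoint_left.2 (by rintro _ ⟨t, rfl⟩; exact hγ t))
    refine ⟨_, mem_nhdsWithin_of_mem_nhds (Metric.ball_mem_nhds x (half_pos hε)), min (ε / 2) η,
      lt_min (half_pos hε) (by exact_mod_cast hη), fun x' hx' =>
      ⟨Metric.ball x (ε / 2) ∪ range γ, ?_, Or.inl hx', ⟨w, Or.inr ⟨1, γ.target⟩, hw⟩, ?_⟩⟩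
    · exact (convex_ball x (ε / 2)).isPreconnected.union x (Metric.mem_ball_self (half_pos hε))
        ⟨0, γ.source⟩ (isPreconnected_range γ.continuous)
    · rintro y (hy | hy) k hk
      · refine (min_le_left _ _).trans ?_
        have h1 : ε ≤ dist k x := not_lt.1 fun h => hball h hk
        have h2 := dist_triangle k y x
        rw [Metric.mem_ball] at hy
        rw [dist_comm y k]
        linarith
      · refine (min_le_right _ _).trans ?_
        have := (hdist y hy k hk).le
        rw [edist_nndist] at this
        exact_mod_cast this

theorem exists_good_origin (Z : Finset Plane) {δ : ℝ} (hδ : δ ≠ 0) :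
    ∃ α : ℝ, 0 < α ∧ α < 1 ∧ ∀ y ∈ Z, IsSquare2 (cellOf α δ y) := by
  obtain ⟨α, ⟨h0, h1⟩, hα⟩ := ((countable_range fun p : Z × Fin 2 × ℤ =>
    p.1.1 p.2.1 - δ * p.2.2).dense_compl ℝ).inter_open_nonempty (Ioo 0 1) isOpen_Ioo
    ⟨1 / 2, by norm_num⟩
  refine ⟨α, h0, h1, fun y hy i => ?_⟩
  by_contra hodd
  obtain ⟨k, hk⟩ : ∃ k, cellOf α δ y i = 2 * k := ⟨cellOf α δ y i / 2, by omega⟩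
  rw [cellOf_eq_two_mul_iff, gridCoord, div_eq_iff hδ] at hk
  refine hα ⟨⟨⟨y, hy⟩, i, k⟩, ?_⟩
  dsimp only
  linarith

namespace Holes

variable {ι : Type*} {K : Set Plane} {U : ι → Set Plane} {z : ι → Plane}

/-- The complement of the punctures deforms onto `K` if `K` is a finite union of convex sets. -/
theorem deforms [Finite ι] (h : Holes K U z) {κ : Type*} (s : Finset κ) (A : κ → Set Plane)
    (hA : ∀ i ∈ s, Convex ℝ (A i)) (hAc : ∀ i ∈ s, IsClosed (A i)) (hKA : K = ⋃ i ∈ s, A i) :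
    Deforms (punctured z) K (punctured z) := by
  classical
  have hKc := h.isCompact.isClosed
  have hKY := h.subset_punctured
  obtain ⟨V, ρ, hVo, hKV, hρ, hρK, hρid⟩ := exists_neighborhood_retraction s A hA hAc
  rw [← hKA] at hKV hρK hρid
  -- points near `K` move to `K` along segments that avoid the punctures
  have hnear : ∀ k ∈ K, ∀ᶠ x in 𝓝 k, x ∈ V ∧ segment ℝ x (ρ x) ⊆ punctured z := by
    intro k hk
    obtain ⟨ε, hε, hball⟩ := Metric.isOpen_iff.1 (isOpen_punctured (z := z)) k (hKY hk)
    have h1 : Filter.Tendsto ρ (𝓝 k) (𝓝 k) := by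
      have := (hρ.continuousAt (hVo.mem_nhds (hKV hk))).tendsto
      rwa [hρid hk] at this
    filter_upwards [hVo.mem_nhds (hKV hk), Metric.ball_mem_nhds k hε,
      h1 (Metric.ball_mem_nhds k hε)] with x hxV hx hρx
    exact ⟨hxV, ((convex_ball k ε).segment_subset hx hρx).trans hball⟩
  set G := interior {x | x ∈ V ∧ segment ℝ x (ρ x) ⊆ punctured z} with hG
  have hKG : K ⊆ G := fun k hk => mem_interior_iff_mem_nhds.2 (hnear k hk)
  -- `K` and all holes lie in the disc of radius `R`
  obtain ⟨R, hR0, hR⟩ : ∃ R > 0, K ∪ ⋃ j, U j ⊆ Metric.ball 0 R := by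
    have hb : Bornology.IsBounded (K ∪ ⋃ j, U j) :=
      h.isCompact.isBounded.union (Bornology.isBounded_iUnion.2 h.isBounded)
    obtain ⟨R, hR0, hR⟩ := hb.subset_ball_lt 0 0
    exact ⟨R, hR0, hR⟩
  have hKR : ∀ k ∈ K, ‖k‖ < R := fun k hk => mem_ball_zero_iff.1 (hR (Or.inl hk))
  have hzR : ∀ j, ‖z j‖ < R := fun j =>
    mem_ball_zero_iff.1 (hR (Or.inr (mem_iUnion.2 ⟨j, h.mem j⟩)))
  have hzK : ∀ j, z j ∉ K := fun j hj => hKY hj ⟨j, rfl⟩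
  have hzinj : Function.Injective z := fun j k hjk => h.eq_of_mem (h.mem j) (hjk ▸ h.mem k)
  -- every point outside `K` is joined, off `K`, to a puncture or to the point `w` outside the disc
  set w : Plane := !₂[R + 4, 0] with hw
  have hw0 : w 0 = R + 4 := rfl
  have hjoin : ∀ x ∈ Kᶜ, ∃ y ∈ insert w (range z), JoinedIn Kᶜ x y := by
    intro x hx
    by_cases hxU : ∃ j, x ∈ U j
    · obtain ⟨j, hj⟩ := hxU
      have hpc : IsPathConnected (U j) := ((h.isOpen j).isConnected_iff_isPathConnected).1
        ⟨⟨_, h.mem j⟩, h.isPreconnected j⟩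
      exact ⟨z j, Or.inr ⟨j, rfl⟩, (hpc.joinedIn x hj _ (h.mem j)).mono
        fun y hy hyK => Set.disjoint_left.1 (h.disjoint_left j) hyK hy⟩
    · have hxo : x ∈ (K ∪ ⋃ j, U j)ᶜ := by
        rintro (hx' | hx')
        · exact hx hx'
        · exact hxU (mem_iUnion.1 hx')
      have hwo : w ∈ (K ∪ ⋃ j, U j)ᶜ := fun hw' => by
        have h1 := mem_ball_zero_iff.1 (hR hw')
        have h2 := abs_apply_le_norm w 0
        rw [hw0, abs_of_pos (by linarith)] at h2
        linarith
      have hpc : IsPathConnected (K ∪ ⋃ j, U j)ᶜ :=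
        (h.isClosed_inner.isOpen_compl.isConnected_iff_isPathConnected).1
          ⟨⟨_, hwo⟩, h.isPreconnected_outer⟩
      exact ⟨w, Or.inl rfl, (hpc.joinedIn x hxo _ hwo).mono
        (compl_subset_compl.2 subset_union_left)⟩
  obtain ⟨η, hη, hdist⟩ := exists_uniform_distance hKc
    (((isCompact_closedBall (0 : Plane) (2 * R + 8))).diff isOpen_interior)
    (Set.disjoint_left.2 fun x hx hxK => hx.2 (hKG hxK)) hjoin
  -- a mesh that separates the punctures from each other and from `K`, and is small against `η`
  obtain ⟨δ, hδη, hδ1, hδK, hδz, hδ⟩ : ∃ δ : ℝ, 2 * δ < η ∧ δ < 1 / 2 ∧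
      (∀ j, ∀ k ∈ K, 2 * δ < dist (z j) k) ∧ (∀ j j', z j ≠ z j' → 2 * δ < dist (z j) (z j')) ∧
      0 < δ := by
    have hsmall : ∀ c : ℝ, 0 < c → ∀ᶠ δ in 𝓝[>] (0 : ℝ), 2 * δ < c := fun c hc => by
      filter_upwards [Ioo_mem_nhdsGT (half_pos hc)] with δ hδ
      linarith [hδ.2]
    have h1 : ∀ j, ∀ᶠ δ in 𝓝[>] (0 : ℝ), ∀ k ∈ K, 2 * δ < dist (z j) k := fun j => by
      obtain ⟨ε, hε, hball⟩ := Metric.isOpen_iff.1 hKc.isOpen_compl _ (hzK j)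
      filter_upwards [hsmall ε hε] with δ hδ k hk
      refine hδ.trans_le (not_lt.1 fun hlt => hball ?_ hk)
      rwa [Metric.mem_ball, dist_comm]
    have h2 : ∀ j j', ∀ᶠ δ in 𝓝[>] (0 : ℝ), z j ≠ z j' → 2 * δ < dist (z j) (z j') := fun j j' => by
      by_cases hne : z j = z j'
      · exact Filter.Eventually.of_forall fun δ h => absurd hne h
      · filter_upwards [hsmall _ (dist_pos.2 hne)] with δ hδ _ using hδ
    obtain ⟨δ, hδ⟩ := ((hsmall η hη).and ((hsmall 1 one_pos).and ((Filter.eventually_all.2 h1).and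
      ((Filter.eventually_all.2 fun j => Filter.eventually_all.2 (h2 j)).and
        self_mem_nhdsWithin)))).exists
    exact ⟨δ, hδ.1, by linarith [hδ.2.1], hδ.2.2.1, hδ.2.2.2.1, hδ.2.2.2.2⟩
  set Z : Finset Plane := (finite_range z).toFinset with hZ
  have hZc : (Z : Set Plane) = range z := by simp [hZ]
  have hZmem : ∀ {y}, y ∈ Z → ∃ j, z j = y := fun {y} hy => by simpa [hZ] using hy
  obtain ⟨α, hα0, hα1, hsq⟩ := exists_good_origin Z hδ.ne'
  -- a box that contains the disc of radius `R` but not `w`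
  set N : ℕ := ⌈(R + 1) / δ⌉₊ with hN
  have hN1 : R + 1 ≤ N * δ := (div_le_iff₀ hδ).1 (Nat.le_ceil _)
  have hN2 : N * δ < R + 2 := by
    have h1 := Nat.ceil_lt_add_one (a := (R + 1) / δ) (by positivity)
    have h2 : (N : ℝ) * δ < ((R + 1) / δ + 1) * δ := by gcongr
    rw [add_mul, div_mul_cancel₀ _ hδ.ne'] at h2
    linarith
  have hin : ∀ y : Plane, ‖y‖ < R → ∀ i, |gridCoord α δ i y| < N := fun y hy i => by
    rw [gridCoord, abs_div, abs_of_pos hδ, div_lt_iff₀ hδ]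
    refine lt_of_lt_of_le ?_ hN1
    have h1 := abs_apply_le_norm y i
    have h2 := abs_sub (y i) α
    rw [abs_of_pos hα0] at h2
    linarith
  have hout : ∀ y : Plane, ∀ i, R + 3 < |y i| → (N : ℝ) < |gridCoord α δ i y| := fun y i hy => by
    rw [gridCoord, abs_div, abs_of_pos hδ, lt_div_iff₀ hδ]
    have h2 := abs_sub_abs_le_abs_sub (y i) α
    rw [abs_of_pos hα0] at h2
    linarith
  have hclose : ∀ {y : Plane}, (∀ k ∈ K, 2 * δ < dist y k) → ∀ n, y ∈ cell α δ n →
      Disjoint (cell α δ n) K := fun {y} hy n hyn =>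
    Set.disjoint_left.2 fun k hk hkK =>
      absurd (dist_le_of_mem_cell hδ hyn hk) (not_le.2 (hy k hkK))
  obtain ⟨B, hKB, hBG, hBY⟩ := exists_deforms_near (α := α) (N := N) (K := K) (Z := Z) (V := G)
    hδ.ne' hsq
    (fun y hy y' hy' heq => by
      obtain ⟨j, rfl⟩ := hZmem hy
      obtain ⟨j', rfl⟩ := hZmem hy'
      by_contra hne
      exact absurd (dist_le_of_mem_cell hδ (mem_cell_cellOf (z j)) (heq ▸ mem_cell_cellOf (z j')))
        (not_le.2 (hδz _ _ hne)))
    (fun y hy => by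
      obtain ⟨j, rfl⟩ := hZmem hy
      exact hin _ (hzR j))
    h.isConnected (fun y hy => hin y (hKR y hy))
    (fun y hy => by
      obtain ⟨j, rfl⟩ := hZmem hy
      exact hclose (hδK j) _ (mem_cell_cellOf _))
    (fun f hf hfK => by
      rw [hZc] at hf ⊢
      exact h.exists_real_lift hf hfK)
    (fun x hx => by
      by_cases hxR : x ∈ Metric.closedBall (0 : Plane) (2 * R + 8)
      · obtain ⟨D, hD, hxD, ⟨y, hyD, hy⟩, hDK⟩ := hdist x ⟨hxR, hx⟩
        refine ⟨D, hD, hxD, fun y hy => hclose fun k hk => hδη.trans_le (hDK y hy k hk), y, hyD, ?_⟩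
        rcases hy with rfl | hy
        · refine Or.inr ⟨0, hout _ 0 ?_⟩
          rw [hw0, abs_of_pos (by linarith)]; linarith
        · exact Or.inl (by simpa [hZ] using hy)
      · rw [mem_closedBall_zero_iff, not_le] at hxR
        refine ⟨{x}, isPreconnected_singleton, rfl, ?_, x, rfl, Or.inr ?_⟩
        · rintro y rfl
          refine hclose fun k hk => ?_
          have h1 := hKR k hk
          have h2 := norm_sub_norm_le y k
          rw [dist_eq_norm]
          linarith
        · have h1 := norm_le_abs_add_abs x
          rcases le_total |x 0| |x 1| with h2 | h2
          · exact ⟨1, hout _ _ (by linarith)⟩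
          · exact ⟨0, hout _ _ (by linarith)⟩)
  rw [hZc] at hBY
  have hBV : B ⊆ {x | x ∈ V ∧ segment ℝ x (ρ x) ⊆ punctured z} := hBG.trans interior_subset
  exact (Deforms.of_segment hKB ρ (hρ.mono fun x hx => (hBV hx).1)
    (fun x hx => hρK (hBV hx).1) hρid fun x hx => (hBV hx).2).trans hBY

end Holes

/-! ### Polygonal sets as finite unions of convex sets -/

/-- A finite union of convex sets. -/
def IsConvexUnion (S : Set Plane) : Prop :=
  ∃ F : Set (Set Plane), F.Finite ∧ (∀ C ∈ F, Convex ℝ C) ∧ S = ⋃₀ F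

theorem IsConvexUnion.of_convex {C : Set Plane} (h : Convex ℝ C) : IsConvexUnion C :=
  ⟨{C}, finite_singleton C, by simpa using h, by simp⟩

theorem IsConvexUnion.biUnion {ι : Type*} {T : Set ι} (hT : T.Finite) {S : ι → Set Plane}
    (h : ∀ i ∈ T, IsConvexUnion (S i)) : IsConvexUnion (⋃ i ∈ T, S i) := by
  choose! F hF hFc hFS using h
  refine ⟨⋃ i ∈ T, F i, hT.biUnion hF, fun C hC => ?_, ?_⟩
  · obtain ⟨i, hi, hC⟩ := mem_iUnion₂.1 hC
    exact hFc i hi C hC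
  · rw [sUnion_iUnion]
    refine iUnion_congr fun i => ?_
    rw [sUnion_iUnion]
    exact iUnion_congr fun hi => hFS i hi

theorem IsConvexUnion.inter {S S' : Set Plane} (h : IsConvexUnion S) (h' : IsConvexUnion S') :
    IsConvexUnion (S ∩ S') := by
  obtain ⟨F, hF, hFc, rfl⟩ := h
  obtain ⟨F', hF', hFc', rfl⟩ := h'
  refine ⟨image2 (· ∩ ·) F F', hF.image2 _ hF', ?_, ?_⟩
  · rintro _ ⟨C, hC, C', hC', rfl⟩
    exact (hFc C hC).inter (hFc' C' hC')
  · ext x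
    simp only [mem_inter_iff, mem_sUnion, mem_image2]
    constructor
    · rintro ⟨⟨C, hC, hx⟩, C', hC', hx'⟩
      exact ⟨_, ⟨C, hC, C', hC', rfl⟩, hx, hx'⟩
    · rintro ⟨_, ⟨C, hC, C', hC', rfl⟩, hx, hx'⟩
      exact ⟨⟨C, hC, hx⟩, C', hC', hx'⟩

theorem IsConvexUnion.biInter {ι : Type*} {T : Set ι} (hT : T.Finite) {S : ι → Set Plane}
    (h : ∀ i ∈ T, IsConvexUnion (S i)) : IsConvexUnion (⋂ i ∈ T, S i) := by
  induction T, hT using Set.Finite.induction_on with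
  | empty => simpa using IsConvexUnion.of_convex convex_univ
  | insert _ _ ih =>
    rw [biInter_insert]
    exact (h _ (mem_insert _ _)).inter (ih fun i hi => h i (mem_insert_of_mem _ hi))

theorem IsConvexUnion.exists_closure {S : Set Plane} (h : IsConvexUnion S) :
    ∃ F : Finset (Set Plane), (∀ C ∈ F, Convex ℝ C) ∧ (∀ C ∈ F, IsClosed C) ∧
      closure S = ⋃ C ∈ F, C := by
  classical
  obtain ⟨F, hF, hFc, rfl⟩ := h
  refine ⟨hF.toFinset.image closure, ?_, ?_, ?_⟩
  · simp only [Finset.mem_image, Finite.mem_toFinset]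
    rintro _ ⟨C, hC, rfl⟩
    exact (hFc C hC).closure
  · simp only [Finset.mem_image, Finite.mem_toFinset]
    rintro _ ⟨C, hC, rfl⟩
    exact isClosed_closure
  · rw [hF.closure_sUnion]
    simp

/-- The complement of a triangle is a union of three open half-planes. -/
theorem isConvexUnion_compl_triangle {t : Fin 3 → Plane} (ht : AffineIndependent ℝ t) :
    IsConvexUnion (convexHull ℝ (range t))ᶜ := by
  let b : AffineBasis (Fin 3) ℝ Plane :=
    ⟨t, ht, ht.affineSpan_eq_top_iff_card_eq_finrank_add_one.2 (by simp)⟩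
  have h : (convexHull ℝ (range t))ᶜ = ⋃ i ∈ (univ : Set (Fin 3)), b.coord i ⁻¹' Iio 0 := by
    rw [show range t = range b from rfl, b.convexHull_eq_nonneg_coord]
    ext x
    simp
  rw [h]
  exact IsConvexUnion.biUnion finite_univ fun i _ =>
    IsConvexUnion.of_convex ((convex_Iio (0 : ℝ)).affine_preimage (b.coord i))

theorem IsPolygon.isConvexUnion {P : Set Plane} (h : IsPolygon P) : IsConvexUnion P := by
  obtain ⟨⟨T, hT, -, rfl⟩, -⟩ := h
  exact IsConvexUnion.biUnion hT fun t _ => IsConvexUnion.of_convex (convex_convexHull ℝ _)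

theorem IsPolygon.isConvexUnion_compl {P : Set Plane} (h : IsPolygon P) : IsConvexUnion Pᶜ := by
  obtain ⟨⟨T, hT, hTi, rfl⟩, -⟩ := h
  simp only [compl_iUnion]
  exact IsConvexUnion.biInter hT fun t ht => isConvexUnion_compl_triangle (hTi t ht)

theorem IsPolygon.isCompact {P : Set Plane} (h : IsPolygon P) : IsCompact P := by
  obtain ⟨⟨T, hT, -, rfl⟩, -⟩ := h
  exact hT.isCompact_biUnion fun t _ => (finite_range t).isCompact_convexHull ℝ

theorem IsPolygon.isClosed {P : Set Plane} (h : IsPolygon P) : IsClosed P := h.isCompact.isClosed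

/-! ### The complement of the free workspace -/

section Workspace

variable {n : ℕ} {W : Set Plane} {O : Fin n → Set Plane}

theorem isConvexUnion_sdiff (hW : IsPolygon W) (hO : ∀ i, IsPolygon (O i)) :
    IsConvexUnion (W \ ⋃ i, O i) := by
  have : W \ ⋃ i, O i = W ∩ ⋂ i ∈ (univ : Set (Fin n)), (O i)ᶜ := by ext x; simp
  rw [this]
  exact hW.isConvexUnion.inter (IsConvexUnion.biInter finite_univ fun i _ =>
    (hO i).isConvexUnion_compl)

theorem freeSpace_subset (hW : IsPolygon W) : freeSpace W O ⊆ W :=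
  hW.isClosed.closure_subset_iff.2 sdiff_subset

theorem isCompact_freeSpace (hW : IsPolygon W) : IsCompact (freeSpace W O) :=
  hW.isCompact.of_isClosed_subset isClosed_closure (freeSpace_subset hW)

theorem disjoint_freeSpaceWithout {i j : Fin n} (hij : i ≠ j) :
    Disjoint (freeSpaceWithout W O j) (interior (O i)) := by
  refine Disjoint.closure_left ?_ isOpen_interior
  rw [Set.disjoint_left]
  exact fun x hx hxi => hx.2 (mem_biUnion (show i ∈ {k | k ≠ j} from hij) (interior_subset hxi))

theorem disjoint_freeSpace (i : Fin n) : Disjoint (freeSpace W O) (interior (O i)) := by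
  refine Disjoint.closure_left ?_ isOpen_interior
  rw [Set.disjoint_left]
  exact fun x hx hxi => hx.2 (mem_iUnion.2 ⟨i, interior_subset hxi⟩)

/-- `U₀` is the unbounded component of the complement of the free workspace, and the other
components are interiors of obstacles. -/
structure IsOuter (W : Set Plane) (O : Fin n → Set Plane) (U₀ : Set Plane) : Prop where
  isOpen : IsOpen U₀
  isPreconnected : IsPreconnected U₀
  compl_subset : Wᶜ ⊆ U₀
  disjoint : Disjoint (freeSpace W O) U₀
  mem_or : ∀ x ∉ freeSpace W O, x ∈ U₀ ∨ ∃ i, x ∈ interior (O i) ∧ Disjoint (interior (O i)) U₀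

/-- A component of the complement of the free workspace that does not leave `W` is the interior of
one of the obstacles. -/
theorem exists_isOuter (hW : IsPolygon W) (hO : ∀ i, IsPolygon (O i))
    (hdisj : ∀ i j, i ≠ j → Disjoint (O i) (O j)) : ∃ U₀, IsOuter W O U₀ := by
  obtain ⟨w, hw⟩ := hW.2.2.nonempty
  have hopen : IsOpen (freeSpace W O)ᶜ := isClosed_closure.isOpen_compl
  have hwK : w ∈ (freeSpace W O)ᶜ := fun h => hw (freeSpace_subset hW h)
  set U₀ := connectedComponentIn (freeSpace W O)ᶜ w with hU
  have hsub : Wᶜ ⊆ U₀ := hW.2.2.isPreconnected.subset_connectedComponentIn hw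
    (compl_subset_compl.2 (freeSpace_subset hW))
  refine ⟨U₀, hopen.connectedComponentIn, isPreconnected_connectedComponentIn, hsub,
    Set.disjoint_right.2 fun x hx => connectedComponentIn_subset _ _ hx, fun x hx => ?_⟩
  by_cases hxU : x ∈ U₀
  · exact Or.inl hxU
  right
  set C := connectedComponentIn (freeSpace W O)ᶜ x with hC
  have hxC : x ∈ C := mem_connectedComponentIn hx
  have hCU : Disjoint C U₀ := by
    rw [Set.disjoint_left]
    intro y hy hyU
    rw [hU, connectedComponentIn_eq hyU, ← connectedComponentIn_eq hy] at hxU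
    exact hxU hxC
  have hCO : C ⊆ ⋃ i, O i := fun y hy => by
    by_contra hyO
    refine connectedComponentIn_subset _ _ hy (subset_closure ⟨?_, hyO⟩)
    by_contra hyW
    exact Set.disjoint_left.1 hCU hy (hsub hyW)
  obtain ⟨i, hi⟩ := mem_iUnion.1 (hCO hxC)
  have hCi : C ⊆ O i := by
    have hpre : IsPreconnected C := isPreconnected_connectedComponentIn
    refine ((isPreconnected_iff_subset_of_disjoint_closed.1 hpre) (O i)
      (⋃ j ∈ {j | j ≠ i}, O j) (hO i).isClosed
      ((toFinite _).isClosed_biUnion fun j _ => (hO j).isClosed) ?_ ?_).resolve_right fun h => ?_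
    · intro y hy
      obtain ⟨j, hj⟩ := mem_iUnion.1 (hCO hy)
      by_cases hji : j = i
      · exact Or.inl (hji ▸ hj)
      · exact Or.inr (mem_biUnion (show j ∈ {j | j ≠ i} from hji) hj)
    · rw [eq_empty_iff_forall_notMem]
      rintro y ⟨-, hy, hy'⟩
      obtain ⟨j, hj, hyj⟩ := mem_iUnion₂.1 hy'
      exact Set.disjoint_left.1 (hdisj j i hj) hyj hy
    · obtain ⟨j, hj, hxj⟩ := mem_iUnion₂.1 (h hxC)
      exact Set.disjoint_left.1 (hdisj j i hj) hxj hi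
  have hxi : x ∈ interior (O i) := interior_maximal hCi hopen.connectedComponentIn hxC
  refine ⟨i, hxi, hCU.mono_left ?_⟩
  exact (hO i).2.1.isPreconnected.subset_connectedComponentIn hxi
    fun y hy hyK => Set.disjoint_left.1 (disjoint_freeSpace i) hyK hy

/-- The interiors of the obstacles that do not meet the unbounded component are the holes of the
free workspace. -/
theorem IsOuter.holes {U₀ : Set Plane} (h : IsOuter W O U₀) (hW : IsPolygon W)
    (hO : ∀ i, IsPolygon (O i)) (hdisj : ∀ i j, i ≠ j → Disjoint (O i) (O j))
    (hconn : IsConnected (freeSpace W O)) {ι : Type*} {b : ι → Fin n} (hb : Function.Injective b)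
    (hrange : range b = {i | Disjoint (interior (O i)) U₀}) {z : ι → Plane}
    (hz : ∀ j, z j ∈ interior (O (b j))) :
    Holes (freeSpace W O) (fun j => interior (O (b j))) z where
  isCompact := isCompact_freeSpace hW
  isConnected := hconn
  isOpen j := isOpen_interior
  isPreconnected j := (hO (b j)).2.1.isPreconnected
  mem := hz
  isBounded j := (hO (b j)).isCompact.isBounded.subset interior_subset
  disjoint j k hjk := (hdisj _ _ (hb.ne hjk)).mono interior_subset interior_subset
  disjoint_left j := disjoint_freeSpace (b j)
  frontier_subset j := by
    intro x hx
    by_contra hxK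
    have hj : Disjoint (interior (O (b j))) U₀ := hrange.le ⟨j, rfl⟩
    rcases h.mem_or x hxK with hxU | ⟨i, hxi, -⟩
    · exact Set.disjoint_left.1 (hj.closure_left h.isOpen) hx.1 hxU
    · by_cases hij : i = b j
      · rw [isOpen_interior.frontier_eq] at hx
        exact hx.2 (hij ▸ hxi)
      · exact Set.disjoint_left.1 ((((hdisj i (b j) hij).symm).mono interior_subset
          interior_subset).closure_left isOpen_interior) hx.1 hxi
  isPreconnected_outer := by
    have : (freeSpace W O ∪ ⋃ j, interior (O (b j)))ᶜ = U₀ := by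
      ext x
      simp only [mem_compl_iff, mem_union, mem_iUnion, not_or, not_exists]
      constructor
      · rintro ⟨hxK, hx⟩
        refine (h.mem_or x hxK).resolve_right ?_
        rintro ⟨i, hxi, hi⟩
        obtain ⟨j, rfl⟩ := hrange.ge hi
        exact hx j hxi
      · intro hx
        refine ⟨fun hxK => Set.disjoint_left.1 h.disjoint hxK hx, fun j hxj => ?_⟩
        exact Set.disjoint_left.1 (hrange.le ⟨j, rfl⟩ : Disjoint (interior (O (b j))) U₀) hxj hx
    rw [this]
    exact h.isPreconnected

theorem IsOuter.deforms {U₀ : Set Plane} (h : IsOuter W O U₀) (hW : IsPolygon W)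
    (hO : ∀ i, IsPolygon (O i)) (hdisj : ∀ i j, i ≠ j → Disjoint (O i) (O j))
    (hconn : IsConnected (freeSpace W O)) {ι : Type*} [Finite ι] {b : ι → Fin n}
    (hb : Function.Injective b) (hrange : range b = {i | Disjoint (interior (O i)) U₀})
    {z : ι → Plane} (hz : ∀ j, z j ∈ interior (O (b j))) :
    Deforms (punctured z) (freeSpace W O) (punctured z) := by
  obtain ⟨F, hF, hFc, hFK⟩ := (isConvexUnion_sdiff hW hO).exists_closure
  exact (h.holes hW hO hdisj hconn hb hrange hz).deforms F id hF hFc hFK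

/-- The hole of an obstacle that does not meet the unbounded component belongs to the free
workspace left when the obstacle is taken away. -/
theorem IsOuter.closure_interior_subset {U₀ : Set Plane} (h : IsOuter W O U₀)
    (hdisj : ∀ i j, i ≠ j → Disjoint (O i) (O j)) {i : Fin n}
    (hi : Disjoint (interior (O i)) U₀) : closure (interior (O i)) ⊆ freeSpaceWithout W O i := by
  refine closure_mono fun x hx => ⟨?_, fun hxO => ?_⟩
  · by_contra hxW
    exact Set.disjoint_left.1 hi hx (h.compl_subset hxW)
  · obtain ⟨j, hj, hxj⟩ := mem_iUnion₂.1 hxO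
    exact Set.disjoint_left.1 (hdisj j i hj) hxj (interior_subset hx)

end Workspace

/-! ### The relevant obstacles are the holes -/

/-- Rays in a common generic direction are disjoint. -/
theorem exists_isRaySystem {m : ℕ} {z : Fin m → Plane} (hz : Function.Injective z) :
    ∃ u : Plane, IsRaySystem z fun _ => u := by
  obtain ⟨t, ht⟩ := (finite_range fun p : Fin m × Fin m =>
    (z p.1 - z p.2) 1 / (z p.1 - z p.2) 0).exists_notMem
  refine ⟨!₂[1, t], fun j h => by simpa using congrArg (fun x : Plane => x 0) h, fun j k hjk => ?_⟩
  rw [Set.disjoint_left]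
  rintro x ⟨s, -, hs⟩ ⟨s', -, hs'⟩
  have h0 : (z j - z k) 0 = s' - s := by
    have h1 := congrArg (fun x : Plane => x 0) (hs.symm.trans hs')
    simp at h1 ⊢
    linarith
  have h1 : (z j - z k) 1 = (s' - s) * t := by
    have h1 := congrArg (fun x : Plane => x 1) (hs.symm.trans hs')
    simp at h1 ⊢
    linarith
  by_cases hss : s' - s = 0
  · refine hjk (hz ?_)
    rw [hss] at h0
    rw [hss, zero_mul] at h1
    rw [← sub_eq_zero]
    ext i
    fin_cases i
    · exact h0
    · exact h1
  · refine ht ⟨(j, k), ?_⟩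
    simp only [h0, h1]
    field_simp

/-- A deformation of `Y` onto `K` gives a retraction, and paths in `Y` between points of `K` are
homotopic to their images. -/
theorem Deforms.exists_retraction {Y K : Set Plane} (h : Deforms Y K Y) (hKY : K ⊆ Y) :
    ∃ r : C(Y, K), (∀ x, r (inclusion hKY x) = x) ∧
      ∀ γ : C(I, Y), (γ 0 : Plane) ∈ K → (γ 1 : Plane) ∈ K →
        γ.HomotopicRel ((ContinuousMap.inclusion hKY).comp (r.comp γ)) {0, 1} := by
  obtain ⟨-, -, r, hr, hrK, hrid, hγ⟩ := h
  refine ⟨⟨fun x => ⟨r x, hrK x.2⟩, (hr.domRestrict).subtype_mk _⟩, fun x => Subtype.ext (hrid x.2),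
    fun γ h0 h1 => hγ γ _ (fun t => (γ t).2) h0 h1 fun t => rfl⟩

section Workspace

variable {n : ℕ} {W : Set Plane} {O : Fin n → Set Plane} {U₀ : Set Plane}

/-- The holes, enumerated, with a puncture in each of them. -/
theorem exists_enumeration (hO : ∀ i, IsPolygon (O i)) (B : Set (Fin n)) :
    ∃ (m : ℕ) (b : Fin m → Fin n) (z : Fin m → Plane), Function.Injective b ∧ range b = B ∧
      ∀ j, z j ∈ interior (O (b j)) := by
  classical
  let e := (Fintype.equivFin B).symm
  choose q hq using fun i => (hO i).2.1.nonempty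
  exact ⟨_, fun j => (e j : Fin n), fun j => q (e j), Subtype.val_injective.comp e.injective,
    by rw [← Function.comp_def, range_comp, e.surjective.range_eq, image_univ, Subtype.range_coe],
    fun j => hq _⟩

theorem disjoint_of_isRelevant (hW : IsPolygon W) (hO : ∀ i, IsPolygon (O i))
    (hdisj : ∀ i j, i ≠ j → Disjoint (O i) (O j)) (hconn : IsConnected (freeSpace W O))
    (h : IsOuter W O U₀) {i : Fin n} (hi : IsRelevant W O i) : Disjoint (interior (O i)) U₀ := by
  by_contra hiU
  obtain ⟨m, b, z, hb, hrange, hz⟩ := exists_enumeration hO {i | Disjoint (interior (O i)) U₀}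
  have hKY := (h.holes hW hO hdisj hconn hb hrange hz).subset_punctured
  obtain ⟨r, hr, -⟩ := (h.deforms hW hO hdisj hconn hb hrange hz).exists_retraction hKY
  have hY : freeSpaceWithout W O i ⊆ punctured z := by
    rintro x hx ⟨j, rfl⟩
    have hij : b j ≠ i := by
      rintro rfl
      exact hiU (hrange.le ⟨j, rfl⟩)
    exact Set.disjoint_left.1 (disjoint_freeSpaceWithout hij) hx (hz j)
  obtain ⟨x, y, γ₁, γ₂, hne, hhom⟩ := hi
  refine hne ?_
  have h1 : ContinuousMap.HomotopicRel _ _ _ := hhom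
  have h2 := h1.comp_continuousMap (r.comp (ContinuousMap.inclusion hY))
  have key : ∀ γ : Path x y, (r.comp (ContinuousMap.inclusion hY)).comp (γ.map (continuous_inclusion
      (freeSpace_subset_without W O i))).toContinuousMap = γ.toContinuousMap := fun γ => by
    ext1 t
    exact hr (γ t)
  rw [key, key] at h2
  exact h2

theorem isRelevant_of_disjoint (hW : IsPolygon W) (hO : ∀ i, IsPolygon (O i))
    (hdisj : ∀ i j, i ≠ j → Disjoint (O i) (O j)) (hconn : IsConnected (freeSpace W O))
    (h : IsOuter W O U₀) {i : Fin n} (hi : Disjoint (interior (O i)) U₀) : IsRelevant W O i := by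
  classical
  obtain ⟨m, b, z, hb, hrange, hz⟩ := exists_enumeration hO {i | Disjoint (interior (O i)) U₀}
  have hholes := h.holes hW hO hdisj hconn hb hrange hz
  have hKY := hholes.subset_punctured
  have hdef := h.deforms hW hO hdisj hconn hb hrange hz
  obtain ⟨r, hr, hrγ⟩ := hdef.exists_retraction hKY
  obtain ⟨u, hu⟩ := exists_isRaySystem (z := z) fun j k hjk =>
    hholes.eq_of_mem (hz j) (hjk ▸ hz k)
  obtain ⟨j, rfl⟩ := hrange.ge hi
  obtain ⟨x, hx⟩ := hconn.nonempty
  set x' : punctured z := ⟨x, hKY hx⟩ with hx'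
  have hrx : r x' = ⟨x, hx⟩ := hr ⟨x, hx⟩
  obtain ⟨α, β, w, w', hne, hα, hβ, hαβ⟩ := hu.exists_pair_around j x' x'
  have hend : ∀ γ : Path x' x', γ.toContinuousMap.HomotopicRel
      ((ContinuousMap.inclusion hKY).comp (r.comp γ.toContinuousMap)) {0, 1} := fun γ =>
    hrγ γ.toContinuousMap (by simpa [hx'] using hx) (by simpa [hx'] using hx)
  refine ⟨⟨x, hx⟩, ⟨x, hx⟩, (α.map r.continuous).cast hrx.symm hrx.symm,
    (β.map r.continuous).cast hrx.symm hrx.symm, fun hhom => hne ?_, ?_⟩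
  · have h1 : (r.comp α.toContinuousMap).HomotopicRel (r.comp β.toContinuousMap) {0, 1} := hhom
    exact hu.isSignature_homotopic hα hβ (((hend α).trans
      (h1.comp_continuousMap (ContinuousMap.inclusion hKY))).trans (hend β).symm)
  · -- the homotopy that passes through the hole is retracted outside the hole only
    set Y := {y : Plane | ∀ k, k ≠ j → y ≠ z k} with hYdef
    have hY : punctured z ⊆ Y := fun y hy k _ hyk => hy ⟨k, hyk.symm⟩
    have hslit : slitOf z (fun _ => u) {k | k ≠ j} ⊆ Y := fun y hy k hk hyk =>
      mem_slitOf.1 hy k hk (hyk ▸ start_mem_ray _ _)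
    have h1 : ((ContinuousMap.inclusion hY).comp α.toContinuousMap).HomotopicRel
      ((ContinuousMap.inclusion hY).comp β.toContinuousMap) {0, 1} := hαβ Y hY hslit
    have h2 := (((hend α).comp_continuousMap (ContinuousMap.inclusion hY)).symm.trans h1).trans
      ((hend β).comp_continuousMap (ContinuousMap.inclusion hY))
    obtain ⟨-, -, ρ, hρ, hρK, hρid, -⟩ := hdef
    set D := interior (O (b j)) with hD
    have hmem : ∀ y ∈ Y, y ∉ D → y ∈ punctured z := by
      rintro y hy hyD ⟨k, rfl⟩
      by_cases hkj : k = j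
      · exact hyD (hkj ▸ hz k)
      · exact hy k hkj rfl
    have hsub := freeSpace_subset_without W O (b j)
    have hmaps : ∀ y ∈ Y, D.piecewise id ρ y ∈ freeSpaceWithout W O (b j) := fun y hy => by
      by_cases hyD : y ∈ D
      · rw [piecewise_eq_of_mem _ _ _ hyD]
        exact h.closure_interior_subset hdisj hi (subset_closure hyD)
      · rw [piecewise_eq_of_notMem _ _ _ hyD]
        exact hsub (hρK (hmem y hy hyD))
    have hcont : ContinuousOn (D.piecewise id ρ) Y := by
      refine ContinuousOn.piecewise (fun y hy => ?_) continuousOn_id (hρ.mono fun y hy => ?_)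
      · exact (hρid (hholes.frontier_subset j hy.2)).symm
      · refine hmem y hy.1 ?_
        have := hy.2
        rwa [isOpen_interior.isClosed_compl.closure_eq] at this
    let R : C(Y, freeSpaceWithout W O (b j)) :=
      ⟨fun y => ⟨D.piecewise id ρ y, hmaps y y.2⟩, hcont.domRestrict.subtype_mk _⟩
    have h3 := h2.comp_continuousMap R
    have key : ∀ γ : Path x' x', R.comp ((ContinuousMap.inclusion hY).comp
        ((ContinuousMap.inclusion hKY).comp (r.comp γ.toContinuousMap))) =
        (((γ.map r.continuous).cast hrx.symm hrx.symm).map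
          (continuous_inclusion hsub)).toContinuousMap := fun γ => by
      ext1 t
      apply Subtype.ext
      change D.piecewise id ρ (r (γ t) : Plane) = (r (γ t) : Plane)
      rw [piecewise_eq_of_notMem _ _ _ (Set.disjoint_left.1 (disjoint_freeSpace (b j)) (r (γ t)).2)]
      exact hρid (r (γ t)).2
    rw [key, key] at h3
    exact h3

end Workspace

/-! ### Configurations and the universal covering -/

section Config

variable {X : Set Plane} {E : Type*} [TopologicalSpace E] {p : E → X} {a : X} {e : E}

/-- In a simply connected covering space, lifts that end together come from homotopic paths. -/
theorem homotopicRel_iff_liftEnd_eq [SimplyConnectedSpace E] (hp : IsCoveringMap p) (he : p e = a)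
    (γ₁ γ₂ : Config a) :
    ContinuousMap.HomotopicRel γ₁.1 γ₂.1 {0, 1} ↔ liftEnd hp he γ₁ = liftEnd hp he γ₂ := by
  refine ⟨fun h => hp.liftPath_apply_one_eq_of_homotopicRel h e _ _, fun h => ?_⟩
  set Γ₁ := hp.liftPath γ₁.1 e (γ₁.2.trans he.symm) with hΓ₁
  set Γ₂ := hp.liftPath γ₂.1 e (γ₂.2.trans he.symm) with hΓ₂
  have h' : Γ₁ 1 = Γ₂ 1 := h
  let P₁ : Path e (Γ₁ 1) := ⟨Γ₁, hp.liftPath_zero _ _ _, rfl⟩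
  let P₂ : Path e (Γ₁ 1) := ⟨Γ₂, hp.liftPath_zero _ _ _, h'.symm⟩
  have hhom : Γ₁.HomotopicRel Γ₂ {0, 1} := SimplyConnectedSpace.paths_homotopic P₁ P₂
  have key := hhom.comp_continuousMap ⟨p, hp.continuous⟩
  have h1 : (⟨p, hp.continuous⟩ : C(E, X)).comp Γ₁ = γ₁.1 :=
    ContinuousMap.ext fun t => congrFun (hp.liftPath_lifts _ _ _) t
  have h2 : (⟨p, hp.continuous⟩ : C(E, X)).comp Γ₂ = γ₂.1 :=
    ContinuousMap.ext fun t => congrFun (hp.liftPath_lifts _ _ _) t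
  rwa [h1, h2] at key

/-- Every point of the universal covering space is the end of a lift. -/
theorem exists_liftEnd_eq [PathConnectedSpace E] (hp : IsCoveringMap p) (he : p e = a) (y : E) :
    ∃ γ : Config a, liftEnd hp he γ = y := by
  obtain ⟨Γ⟩ := PathConnectedSpace.joined e y
  refine ⟨⟨(⟨p, hp.continuous⟩ : C(E, X)).comp Γ.toContinuousMap, by simp [he]⟩, ?_⟩
  have := (hp.eq_liftPath_iff' (γ := (⟨p, hp.continuous⟩ : C(E, X)).comp Γ.toContinuousMap)
    (e := e) (γ_0 := by simp) (Γ := Γ.toContinuousMap)).2 ⟨rfl, Γ.source⟩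
  exact (congrArg (fun f : C(I, E) => f 1) this.symm).trans Γ.target

variable {m : ℕ} {z v : Fin m → Plane}

theorem isSignature_inclusion_iff {Y : Set Plane} (hXY : X ⊆ Y) {γ : C(I, X)}
    {w : FreeGroup (Fin m)} :
    IsSignature z v ((ContinuousMap.inclusion hXY).comp γ) w ↔ IsSignature z v γ w := Iff.rfl

theorem IsRaySystem.isSignature_iff (hs : IsRaySystem z v) (hX : X ⊆ punctured z) (γ : C(I, X))
    (w : FreeGroup (Fin m)) : IsSignature z v γ w ↔ w = signature z v γ := by
  have hsig : IsSignature z v γ (signature z v γ) :=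
    Classical.epsilon_spec (hs.exists_isSignature ((ContinuousMap.inclusion hX).comp γ))
  refine ⟨fun h => ?_, fun h => h ▸ hsig⟩
  exact hs.isSignature_homotopic ((isSignature_inclusion_iff hX).2 h)
    ((isSignature_inclusion_iff hX).2 hsig) (ContinuousMap.HomotopicRel.refl _)

theorem IsRaySystem.surjective_reduced (hs : IsRaySystem z v) (hX : X ⊆ punctured z)
    (hdef : Deforms (punctured z) X (punctured z)) :
    Function.Surjective (reduced z v : Config a → _) := by
  rintro ⟨b, w⟩
  obtain ⟨r, hr, hrγ⟩ := hdef.exists_retraction hX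
  obtain ⟨γ, hγ⟩ := hs.reaches (inclusion hX a) (inclusion hX b) w
  have h := hrγ γ.toContinuousMap (by simp) (by simp)
  obtain ⟨w', hw'⟩ := hs.exists_isSignature
    ((ContinuousMap.inclusion hX).comp (r.comp γ.toContinuousMap))
  obtain rfl := hs.isSignature_homotopic hγ hw' h
  refine ⟨⟨r.comp γ.toContinuousMap, by simp [hr]⟩, Prod.ext (by simp [reduced, hr]) ?_⟩
  exact ((hs.isSignature_iff hX _ _).1 ((isSignature_inclusion_iff hX).1 hw')).symm

/-- Configurations with the same endpoint and the same signature have lifts that end together. -/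
theorem IsRaySystem.liftEnd_eq_of_reduced_eq (hs : IsRaySystem z v) (hX : X ⊆ punctured z)
    (hdef : Deforms (punctured z) X (punctured z)) (hp : IsCoveringMap p) (he : p e = a)
    {γ₁ γ₂ : Config a} (h : reduced z v γ₁ = reduced z v γ₂) :
    liftEnd hp he γ₁ = liftEnd hp he γ₂ := by
  obtain ⟨r, hr, -⟩ := hdef.exists_retraction hX
  have h1 : γ₁.1 1 = γ₂.1 1 := congrArg Prod.fst h
  have h2 : signature z v γ₁.1 = signature z v γ₂.1 := congrArg Prod.snd h
  have hlift : ∀ (γ : Config a) t, p (hp.liftPath γ.1 e (γ.2.trans he.symm) t) =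
      r (((ContinuousMap.inclusion hX).comp γ.1) t) := fun γ t =>
    (congrFun (hp.liftPath_lifts _ _ _) t).trans (hr (γ.1 t)).symm
  refine hs.lift_eq_of_isSignature hp r (w := signature z v γ₁.1)
    (γ := (ContinuousMap.inclusion hX).comp γ₁.1) (γ' := (ContinuousMap.inclusion hX).comp γ₂.1)
    ((hs.isSignature_iff hX _ _).2 rfl) ((hs.isSignature_iff hX _ _).2 h2) ?_ ?_ (hlift γ₁)
    (hlift γ₂) ((hp.liftPath_zero _ _ _).trans (hp.liftPath_zero _ _ _).symm)
  · exact congrArg (inclusion hX) (γ₁.2.trans γ₂.2.symm)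
  · exact congrArg (inclusion hX) h1

/-- Configurations whose lifts end together have the same endpoint and the same signature. -/
theorem IsRaySystem.reduced_eq_of_liftEnd_eq [SimplyConnectedSpace E] (hs : IsRaySystem z v)
    (hX : X ⊆ punctured z) (hp : IsCoveringMap p) (he : p e = a) {γ₁ γ₂ : Config a}
    (h : liftEnd hp he γ₁ = liftEnd hp he γ₂) : reduced z v γ₁ = reduced z v γ₂ := by
  have hhom := (homotopicRel_iff_liftEnd_eq hp he γ₁ γ₂).2 h
  have hproj : ∀ γ : Config a, p (liftEnd hp he γ) = γ.1 1 := fun γ =>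
    congrFun (hp.liftPath_lifts _ _ _) 1
  refine Prod.ext ((hproj γ₁).symm.trans ((congrArg p h).trans (hproj γ₂))) ?_
  have h1 := (isSignature_inclusion_iff hX).2 ((hs.isSignature_iff hX γ₁.1 _).2 rfl)
  have h2 := (isSignature_inclusion_iff hX).2 ((hs.isSignature_iff hX γ₂.1 _).2 rfl)
  exact hs.isSignature_homotopic h1 h2 (hhom.comp_continuousMap (ContinuousMap.inclusion hX))

end Config

end Tether

end

theorem proposition1 {n m : ℕ}
    -- the workspace, the obstacles, and the connected free workspace
    (W : Set Tether.Plane) (O : Fin n → Set Tether.Plane)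
    (hW : Tether.IsPolygon W) (hO : ∀ i, Tether.IsPolygon (O i))
    (hdisj : ∀ i j, i ≠ j → Disjoint (O i) (O j))
    (hconn : IsConnected (Tether.freeSpace W O))
    -- the enumeration of the obstacles that give rise to multiple homotopy classes
    (rel : Fin m → Fin n) (hrel : Function.Injective rel)
    (hrange : Set.range rel = {i | Tether.IsRelevant W O i})
    -- their generators: pairwise disjoint rays that start inside the obstacles
    (z v : Fin m → Tether.Plane) (hz : ∀ j, z j ∈ interior (O (rel j))) (hv : ∀ j, v j ≠ 0)
    (hray : ∀ j k, j ≠ k → Disjoint (Tether.ray (z j) (v j)) (Tether.ray (z k) (v k)))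
    -- the anchor, the universal covering space, and the lifted anchor
    (a : Tether.freeSpace W O) {E : Type*} [TopologicalSpace E] [SimplyConnectedSpace E]
    (p : E → Tether.freeSpace W O) (hp : IsCoveringMap p) (e : E) (he : p e = a) :
    -- every configuration has exactly one signature
    (∀ (γ : Tether.Config a) (w : FreeGroup (Fin m)),
      Tether.IsSignature z v γ.1 w ↔ w = Tether.signature z v γ.1) ∧
    -- every pair in `W_free × F_m` is a reduced configuration
    Function.Surjective (Tether.reduced z v : Tether.Config a → _) ∧
    -- the map `g` is well defined on `W_free × F_m`, unique, and bijective
    (∃ g : Tether.freeSpace W O × FreeGroup (Fin m) → E,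
      (∀ γ : Tether.Config a, g (Tether.reduced z v γ) = Tether.liftEnd hp he γ) ∧
      (∀ g' : Tether.freeSpace W O × FreeGroup (Fin m) → E,
        (∀ γ : Tether.Config a, g' (Tether.reduced z v γ) = Tether.liftEnd hp he γ) → g' = g) ∧
      Function.Bijective g) ∧
    -- two configurations with the same endpoint are homotopic iff their lifts end together
    (∀ γ₁ γ₂ : Tether.Config a, γ₁.1 1 = γ₂.1 1 →
      (ContinuousMap.HomotopicRel γ₁.1 γ₂.1 {0, 1} ↔
        Tether.liftEnd hp he γ₁ = Tether.liftEnd hp he γ₂)) := by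
  obtain ⟨U₀, hU₀⟩ := Tether.exists_isOuter hW hO hdisj
  have hrange' : Set.range rel = {i | Disjoint (interior (O i)) U₀} := by
    rw [hrange]
    ext i
    exact ⟨Tether.disjoint_of_isRelevant hW hO hdisj hconn hU₀,
      Tether.isRelevant_of_disjoint hW hO hdisj hconn hU₀⟩
  have hs : Tether.IsRaySystem z v := ⟨hv, hray⟩
  have hX : Tether.freeSpace W O ⊆ Tether.punctured z :=
    (hU₀.holes hW hO hdisj hconn hrel hrange' hz).subset_punctured
  have hdef := hU₀.deforms hW hO hdisj hconn hrel hrange' hz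
  have hsurj : Function.Surjective (Tether.reduced z v : Tether.Config a → _) :=
    hs.surjective_reduced hX hdef
  refine ⟨fun γ w => hs.isSignature_iff hX γ.1 w, hsurj, ?_,
    fun γ₁ γ₂ _ => Tether.homotopicRel_iff_liftEnd_eq hp he γ₁ γ₂⟩
  -- `g` lifts an arbitrary configuration with the given endpoint and signature
  choose c hc using hsurj
  have hg : ∀ γ : Tether.Config a,
      Tether.liftEnd hp he (c (Tether.reduced z v γ)) = Tether.liftEnd hp he γ := fun γ =>
    hs.liftEnd_eq_of_reduced_eq hX hdef hp he (hc _)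
  refine ⟨fun q => Tether.liftEnd hp he (c q), hg, fun g' hg' => ?_, fun q q' h => ?_, fun y => ?_⟩
  · funext q
    rw [← hg' (c q), hc]
  · rw [← hc q, ← hc q']
    exact hs.reduced_eq_of_liftEnd_eq hX hp he h
  · obtain ⟨γ, hγ⟩ := Tether.exists_liftEnd_eq hp he y
    exact ⟨Tether.reduced z v γ, (hg γ).trans hγ⟩
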